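/- **Setting.** Let $(X,\mathcal X,\rho)$ be a probability space, $f:X\to\mathbb R$ a measurable function that is not $\rho$-a.s. constant, and $h:X\to[0,\infty)$ a probability density with respect to $\rho$. Let $\Theta=\{\theta\in\mathbb R:\int e^{\theta f}h\,d\rho<\infty\}$, $\Lambda(\theta)=\log\int e^{\theta f}h\,d\rho$, $p_\theta(x)=e^{\theta f(x)-\Lambda(\theta)}h(x)$, $\mu(\theta)=\int f\,p_\theta\,d\rho$ and $\mathcal M=\mu(\Theta)$. Assume that $\Theta$ is open. For $m,\nu\in\mathcal M$ let $\mathrm{KL}(m,\nu)$ be the Kullback–Leibler divergence between the members of the family with means $m$ and $\nu$; for $\nu\in\mathcal M$ extend $\mathrm{KL}(\cdot,\nu)$ by continuity to $\overline{\mathcal M}$, and by $\infty$ outside $\overline{\mathcal M}$. There are $K\ge 2$ independent arms. Arm $a$ has a parameter $\theta_a\in\Theta$ and yields rewards $Y^a_n=f(X^a_n)$, $n\ge1$, where $X^a_1,X^a_2,\dots$ are i.i.d. with density $p_{\theta_a}$. Fix $1\le M\le K$. In each round $t=1,2,\dots$ a set $\phi_t$ of $M$ distinct arms is played; $N_a(t)$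 is the number of rounds $s\le t$ with $a\in\phi_s$, and the player observes $Z^a_t=Y^a_{N_a(t)}$ if $a\in\phi_t$, and $Z^a_t=0$ otherwise. An adaptive allocation rule is a sequence $\phi=(\phi_t)$ such that $\{\phi_t=A\}\in\sigma(\phi_s,(Z_s^a)_a: s<t)$ for all $t$ and $A$. The arms are numbered so that $$\mu(\theta_1)\ge\dots\ge\mu(\theta_N)>\mu(\theta_{N+1})=\dots=\mu(\theta_M)=\dots=\mu(\theta_L)>\mu(\theta_{L+1})\ge\dots\ge\mu(\theta_K),$$ with $0\le N<M\le L\le K$. The expected regret is $R^\phi_\theta(T)=T\sum_{a=1}^M\mu(\theta_a)-\mathbb E\big[\sum_{t=1}^T\sum_aZ^a_t\big]$ (for arms in another order, the first sum is over the $M$ largest means). A rule is uniformly good if $R^\phi_\theta(T)=o(T^\alpha)$ for all $\theta\in\Theta^K$ and $\alpha>0$. It is asymptotically optimal at $\theta$ if it is uniformly good and $\limsup_T R^\phi_\theta(T)/\log T\le\liminf_T R^\psi_\theta(T)/\log T$ for every uniformly good adaptive allocation rule $\psi$. **Round-robin KL-UCB.** Fix $\delta\in(0,1/K)$ and $g(t)=\log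 t+3\log\log t$. In the first $K$ rounds play each arm exactly $M$ times. For $t\ge K$ let $\bar Y_a(t)$ be the average of the first $N_a(t)$ rewards of arm $a$ and $W_t=\{a:N_a(t)\ge\lceil\delta t\rceil\}$. Pick any $L_t\subseteq W_t$ with $|L_t|=M$ and $\min_{a\in L_t}\bar Y_a(t)\ge\bar Y_b(t)$ for all $b\in W_t\setminus L_t$. Let $b\in\{1,\dots,K\}$ with $b\equiv t+1\pmod K$ and $$U_b(t)=\sup\{\nu\in\mathcal M:\mathrm{KL}(\bar Y_b(t),\nu)\le g(t)/N_b(t)\}\qquad(\sup\emptyset=-\infty).$$ If $b\in L_t$ or $\min_{a\in L_t}\bar Y_a(t)\ge U_b(t)$, play $\phi_{t+1}=L_t$. Otherwise pick any $a\in\arg\min_{a\in L_t}\bar Y_a(t)$ and play $\phi_{t+1}=(L_t\setminus\{a\})\cup\{b\}$. **Theorem.** (i) Let $0<\varepsilon<\min(\mu(\theta_N)-\mu(\theta_M),\,\mu(\theta_M)-\mu(\theta_{L+1}))$, with $\mu(\theta_0)=\infty$ and $\mu(\theta_{K+1})=-\infty$. There are constants $c_1,c_2,c_3,c_4$, which do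 not depend on $T$ nor on how ties are broken, such that every adaptive allocation rule $\phi$ that follows the algorithm satisfies, for all $T\ge\max(K,3)$, $$R^\phi_\theta(T)\le\sum_{b=L+1}^K\frac{\mu(\theta_M)-\mu(\theta_b)}{\mathrm{KL}(\mu(\theta_b),\mu(\theta_M)-\varepsilon)}\log T+c_1\sqrt{\log T}+c_2\log\log T+c_3\sqrt{\log\log T}+c_4 .$$ (ii) Every such $\phi$ is asymptotically optimal at $\theta$, and $$\lim_{T\to\infty}\frac{R^\phi_\theta(T)}{\log T}=\sum_{b=L+1}^K\frac{\mu(\theta_M)-\mu(\theta_b)}{\mathrm{KL}(\mu(\theta_b),\mu(\theta_M))}.$$ -/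

import Mathlib

open MeasureTheory Filter Topology
open scoped ENNReal NNReal BigOperators

noncomputable section

namespace Bandit

/-- The data generating a one-parameter exponential family on a probability space `(𝒳, ρ)`:
a measurable sufficient statistic `f`, not `ρ`-a.s. constant, and a carrier density `h`. -/
structure ExpFamily (𝒳 : Type*) [MeasurableSpace 𝒳] where
  ρ : Measure 𝒳
  prob_ρ : IsProbabilityMeasure ρ
  f : 𝒳 → ℝ
  measurable_f : Measurable f
  not_const_f : ¬ ∃ c : ℝ, ∀ᵐ x ∂ρ, f x = c
  h : 𝒳 → ℝ≥0
  measurable_h : Measurable h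
  lintegral_h : ∫⁻ x, (h x : ℝ≥0∞) ∂ρ = 1

/-- A sample point of the bandit model lists all the potential observations:
`ω (a, n)` is the `n`-th observation (`n ≥ 1`) of arm `a`. The coordinates `n = 0` are not used. -/
abbrev Sample (𝒳 : Type*) (K : ℕ) : Type _ := Fin K × ℕ → 𝒳

/-- `plays φ a t ω` is the number of rounds `1 ≤ s ≤ t` in which arm `a` is played, where
`φ s ω` is the set of arms played at round `s` (rounds start at `1`). -/
def plays {Ω : Type*} {K : ℕ} (φ : ℕ → Ω → Finset (Fin K)) (a : Fin K) (t : ℕ) (ω : Ω) : ℕ :=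
  ((Finset.Icc 1 t).filter fun s => a ∈ φ s ω).card

/-- The largest sum of `M` entries of `v`, taken over `M` distinct positions. -/
def topSum {K : ℕ} (M : ℕ) (v : Fin K → ℝ) : ℝ :=
  sSup ((fun A : Finset (Fin K) => ∑ a ∈ A, v a) '' {A | A.card = M})

/-- If the entries are in decreasing order, `topSum` is the sum of the first `M` of them. -/
theorem topSum_of_antitone {K M : ℕ} (hM : M ≤ K) (v : Fin K → ℝ) (hv : Antitone v) :
    topSum M v = ∑ a ∈ Finset.univ.filter (fun a : Fin K => (a : ℕ) < M), v a := by
  set B : Finset (Fin K) := Finset.univ.filter (fun a : Fin K => (a : ℕ) < M) with hB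
  have hBc : B.card = M := by
    rw [hB, Fin.card_filter_val_lt, min_eq_right hM]
  refine IsGreatest.csSup_eq ⟨⟨B, hBc, rfl⟩, ?_⟩
  rintro _ ⟨A, hA, rfl⟩
  have hA' : A.card = M := hA
  have hc : (A \ B).card = (B \ A).card :=
    Finset.card_sdiff_comm (hA'.trans hBc.symm)
  have h1 : ∑ a ∈ A, v a = ∑ a ∈ A \ B, v a + ∑ a ∈ A ∩ B, v a := by
    rw [add_comm, Finset.sum_inter_add_sum_sdiff]
  have h2 : ∑ a ∈ B, v a = ∑ a ∈ B \ A, v a + ∑ a ∈ A ∩ B, v a := by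
    rw [add_comm, Finset.inter_comm, Finset.sum_inter_add_sum_sdiff]
  simp only
  rw [h1, h2]
  refine add_le_add ?_ le_rfl
  rcases (A \ B).eq_empty_or_nonempty with he | ⟨x, hx⟩
  · have : B \ A = ∅ := by
      rw [← Finset.card_eq_zero, ← hc, he, Finset.card_empty]
    rw [he, this]
  · have hMK : 0 < M ∨ M = 0 := by omega
    rcases hMK with hM0 | hM0
    · let m : Fin K := ⟨M - 1, by omega⟩
      calc ∑ a ∈ A \ B, v a ≤ (A \ B).card • v m := by
            refine Finset.sum_le_card_nsmul _ _ _ fun a ha => hv ?_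
            have : ¬ (a : ℕ) < M := by
              intro h
              exact (Finset.mem_sdiff.1 ha).2 (by simp [hB, h])
            change M - 1 ≤ (a : ℕ)
            omega
        _ = (B \ A).card • v m := by rw [hc]
        _ ≤ ∑ a ∈ B \ A, v a := by
            refine Finset.card_nsmul_le_sum _ _ _ fun a ha => hv ?_
            have : (a : ℕ) < M := by
              have := (Finset.mem_sdiff.1 ha).1
              simpa [hB] using this
            change (a : ℕ) ≤ M - 1
            omega
    · have : A = ∅ := by rw [← Finset.card_eq_zero]; omega
      simp [this] at hx

namespace ExpFamily

variable {𝒳 : Type*} [MeasurableSpace 𝒳] (E : ExpFamily 𝒳)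

/-- The natural parameter space `Θ = {θ : ∫ exp (θ f) h dρ < ∞}`. -/
def naturalSpace : Set ℝ :=
  {θ | Integrable (fun x => Real.exp (θ * E.f x) * (E.h x : ℝ)) E.ρ}

/-- The log-moment-generating function `Λ`. -/
def logMGF (θ : ℝ) : ℝ := Real.log (∫ x, Real.exp (θ * E.f x) * (E.h x : ℝ) ∂E.ρ)

/-- The density `p_θ` with respect to `ρ`. -/
def density (θ : ℝ) (x : 𝒳) : ℝ := Real.exp (θ * E.f x - E.logMGF θ) * (E.h x : ℝ)

/-- The law on `𝒳` with density `p_θ`. -/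
def law (θ : ℝ) : Measure 𝒳 := E.ρ.withDensity fun x => ENNReal.ofReal (E.density θ x)

/-- The mean parameter `μ(θ) = ∫ f p_θ dρ`. -/
def mean (θ : ℝ) : ℝ := ∫ x, E.f x * E.density θ x ∂E.ρ

/-- The mean parameter space `ℳ`. -/
def meanSpace : Set ℝ := E.mean '' E.naturalSpace

/-- For natural parameters `p_θ` is a probability density. -/
theorem isProbabilityMeasure_law {θ : ℝ} (hθ : θ ∈ E.naturalSpace) :
    IsProbabilityMeasure (E.law θ) := by
  have hθ' : Integrable (fun x => Real.exp (θ * E.f x) * (E.h x : ℝ)) E.ρ := hθ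
  have hnn : 0 ≤ᵐ[E.ρ] fun x => Real.exp (θ * E.f x) * (E.h x : ℝ) :=
    Eventually.of_forall fun x => by positivity
  have hpos : 0 < ∫ x, Real.exp (θ * E.f x) * (E.h x : ℝ) ∂E.ρ := by
    refine lt_of_le_of_ne (integral_nonneg_of_ae hnn) fun h0 => ?_
    have h1 := (integral_eq_zero_iff_of_nonneg_ae hnn hθ').1 h0.symm
    have h2 : ∀ᵐ x ∂E.ρ, (E.h x : ℝ≥0∞) = 0 := by
      filter_upwards [h1] with x hx
      have hx' : Real.exp (θ * E.f x) * (E.h x : ℝ) = 0 := hx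
      rcases mul_eq_zero.1 hx' with h | h
      · exact absurd h (Real.exp_pos _).ne'
      · exact_mod_cast h
    have h3 : ∫⁻ x, (E.h x : ℝ≥0∞) ∂E.ρ = 0 := by
      rw [lintegral_congr_ae h2, lintegral_zero]
    rw [E.lintegral_h] at h3
    exact one_ne_zero h3
  set Z : ℝ := ∫ x, Real.exp (θ * E.f x) * (E.h x : ℝ) ∂E.ρ with hZ
  have hd : E.density θ = fun x => Z⁻¹ * (Real.exp (θ * E.f x) * (E.h x : ℝ)) := by
    funext x
    have hL : E.logMGF θ = Real.log Z := rfl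
    simp only [density]
    rw [hL, Real.exp_sub, Real.exp_log hpos]
    ring
  refine ⟨?_⟩
  rw [law, withDensity_apply _ MeasurableSet.univ, Measure.restrict_univ, hd,
    ← ofReal_integral_eq_lintegral_ofReal (hθ'.const_mul _)
      (Eventually.of_forall fun x => by positivity),
    integral_const_mul, ← hZ, inv_mul_cancel₀ hpos.ne', ENNReal.ofReal_one]

/-- `KL(m, ν)` for mean parameters `m, ν ∈ ℳ`: the Kullback-Leibler divergence between the members
of the family that have the means `m` and `ν`. -/
def klMean (m ν : ℝ) : ℝ≥0∞ :=
  InformationTheory.klDiv (E.law (Function.invFunOn E.mean E.naturalSpace m))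
    (E.law (Function.invFunOn E.mean E.naturalSpace ν))

open scoped Classical in
/-- The extension of `KL(·, ν)`, for `ν ∈ ℳ`, to the whole line: by continuity to the closure
of `ℳ`, and by `∞` outside of it. -/
def klExt (m ν : ℝ) : ℝ≥0∞ :=
  if m ∈ closure E.meanSpace then extendFrom E.meanSpace (fun m' => E.klMean m' ν) m else ∞

variable {K : ℕ}

/-- The law of the `K` independent i.i.d. arms with parameters `θ 0, …, θ (K-1)`. -/
def banditLaw (θ : Fin K → ℝ) : Measure (Sample 𝒳 K) :=
  Measure.infinitePi fun i : Fin K × ℕ => E.law (θ i.1)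

/-- The `n`-th reward `Y_n^a` of arm `a`. -/
def Y (a : Fin K) (n : ℕ) (ω : Sample 𝒳 K) : ℝ := E.f (ω (a, n))

/-- The reward `Z_t^a` observed at round `t` from arm `a`, and `0` if `a` is not played. -/
def Z (φ : ℕ → Sample 𝒳 K → Finset (Fin K)) (t : ℕ) (a : Fin K) (ω : Sample 𝒳 K) : ℝ :=
  if a ∈ φ t ω then E.Y a (plays φ a t ω) ω else 0

/-- The total reward `S_T` of the rounds `1, …, T`. -/
def totalReward (φ : ℕ → Sample 𝒳 K → Finset (Fin K)) (T : ℕ) (ω : Sample 𝒳 K) : ℝ :=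
  ∑ t ∈ Finset.Icc 1 T, ∑ a, E.Z φ t a ω

/-- The σ-field generated by the plays and the observed rewards of the rounds before `t`. -/
@[reducible] def history (φ : ℕ → Sample 𝒳 K → Finset (Fin K)) (t : ℕ) : MeasurableSpace (Sample 𝒳 K) :=
  ⨆ s ∈ Finset.Ico 1 t, (MeasurableSpace.comap (φ s) ⊤ ⊔
    MeasurableSpace.comap (fun ω a => E.Z φ s a ω) (inferInstance : MeasurableSpace (Fin K → ℝ)))

/-- An adaptive allocation rule which plays `M` distinct arms per round: the play of round `t` is
determined by the plays and the observed rewards of the rounds before `t`. -/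
def IsAllocationRule (M : ℕ) (φ : ℕ → Sample 𝒳 K → Finset (Fin K)) : Prop :=
  ∀ t, 1 ≤ t → (∀ ω, (φ t ω).card = M) ∧
    ∀ A : Finset (Fin K), MeasurableSet[E.history φ t] {ω | φ t ω = A}

/-- The expected regret after `T` rounds. The reward of the best `M` arms is written
independently of the order of the arms, see `topSum_of_antitone` for ordered arms. -/
def regret (M : ℕ) (θ : Fin K → ℝ) (φ : ℕ → Sample 𝒳 K → Finset (Fin K)) (T : ℕ) : ℝ :=
  T * topSum M (fun a => E.mean (θ a)) - ∫ ω, E.totalReward φ T ω ∂(E.banditLaw θ)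

/-- Uniformly good rules: the regret is `o(T^α)` for all parameter configurations and `α > 0`. -/
def IsUniformlyGood (M : ℕ) (φ : ℕ → Sample 𝒳 K → Finset (Fin K)) : Prop :=
  ∀ θ : Fin K → ℝ, (∀ a, θ a ∈ E.naturalSpace) → ∀ α : ℝ, 0 < α →
    (fun T : ℕ => E.regret M θ φ T) =o[atTop] fun T : ℕ => (T : ℝ) ^ α

/-- A rule is asymptotically optimal at `θ` if it is uniformly good and if, on the scale `log T`,
no uniformly good adaptive allocation rule has a smaller regret at `θ`. -/
def IsAsymptoticallyOptimal (M : ℕ) (θ : Fin K → ℝ)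
    (φ : ℕ → Sample 𝒳 K → Finset (Fin K)) : Prop :=
  E.IsUniformlyGood M φ ∧
    ∀ ψ : ℕ → Sample 𝒳 K → Finset (Fin K), E.IsAllocationRule M ψ → E.IsUniformlyGood M ψ →
      limsup (fun T : ℕ => ((E.regret M θ φ T / Real.log T : ℝ) : EReal)) atTop ≤
        liminf (fun T : ℕ => ((E.regret M θ ψ T / Real.log T : ℝ) : EReal)) atTop

/-- The empirical mean `Ȳ_a(t)` of arm `a` after round `t`. -/
def empMean (φ : ℕ → Sample 𝒳 K → Finset (Fin K)) (a : Fin K) (t : ℕ) (ω : Sample 𝒳 K) : ℝ :=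
  (∑ n ∈ Finset.Icc 1 (plays φ a t ω), E.Y a n ω) / (plays φ a t ω : ℝ)

/-- The upper confidence bound `U_a(t) = sup {ν ∈ ℳ : KL(Ȳ_a(t), ν) ≤ g(t) / N_a(t)}`, a supremum
in the extended reals (so `-∞` if there is no such `ν`). -/
def ucb (g : ℕ → ℝ) (φ : ℕ → Sample 𝒳 K → Finset (Fin K)) (a : Fin K) (t : ℕ)
    (ω : Sample 𝒳 K) : EReal :=
  sSup ((fun ν : ℝ => (ν : EReal)) '' {ν | ν ∈ E.meanSpace ∧
    (E.klExt (E.empMean φ a t ω) ν : EReal) ≤ ((g t / (plays φ a t ω : ℝ) : ℝ) : EReal)})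

/-- The set `W_t` of the arms that were played at least `⌈δ t⌉` times up to round `t`. -/
def wellSampled (δ : ℝ) (φ : ℕ → Sample 𝒳 K → Finset (Fin K)) (t : ℕ) (ω : Sample 𝒳 K) :
    Finset (Fin K) :=
  Finset.univ.filter fun a => ⌈δ * (t : ℝ)⌉₊ ≤ plays φ a t ω

/-- `φ` plays according to the round-robin KL-UCB algorithm with parameters `δ` and `g`, ties being
broken in any way. Arm `b : Fin K` is the arm number `b + 1`. -/
structure IsRoundRobinKLUCB (M : ℕ) (δ : ℝ) (g : ℕ → ℝ)
    (φ : ℕ → Sample 𝒳 K → Finset (Fin K)) : Prop where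
  init : ∀ ω a, plays φ a K ω = M
  step : ∀ ω t, K ≤ t → ∃ L : Finset (Fin K),
    L ⊆ wellSampled δ φ t ω ∧ L.card = M ∧
    (∀ a ∈ L, ∀ b ∈ wellSampled δ φ t ω \ L, E.empMean φ b t ω ≤ E.empMean φ a t ω) ∧
    ∀ b : Fin K, (b : ℕ) + 1 ≡ t + 1 [MOD K] →
      ((b ∈ L ∨ ∀ a ∈ L, E.ucb g φ b t ω ≤ (E.empMean φ a t ω : EReal)) → φ (t + 1) ω = L) ∧
      (¬ (b ∈ L ∨ ∀ a ∈ L, E.ucb g φ b t ω ≤ (E.empMean φ a t ω : EReal)) →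
        ∃ a ∈ L, (∀ a' ∈ L, E.empMean φ a t ω ≤ E.empMean φ a' t ω) ∧
          φ (t + 1) ω = insert b (L.erase a))

end ExpFamily

end Bandit

end

/-!
The proof has two halves, which meet at the rate `regretRate`.

*Exponential families.* On the open natural parameter space the mean `E.mean` is the derivative of
the log-moment-generating function and its derivative is a variance. So either all members have
the same mean, in which case nobody has any regret (`regret_eq_zero`), or the mean is a strictly
increasing parametrization (`strictMonoOn_mean`). In the second case `KL` is the explicit function
`klNat` of the natural parameters (`klMean_mean`), a Bregman divergence, which is continuous and
increasing as the arguments move apart; its extension `klExt` is bounded from below by the same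
function (`klNat_le_klExt`).

*The regret.* For a threshold arm, one whose mean is the `M`-th largest, the regret is the sum of
the gaps of the better arms times the expected number of rounds without them, and of the gaps of
the bad arms times their expected number of plays (`regret_eq_sum_plays`).

*Lower bound.* For a uniformly good rule the parameter of a bad arm `b` is changed to one slightly
above the threshold. Under the changed law `b` has to be played in almost all rounds. The two laws
differ only in the rewards of `b`, so the likelihood ratio of the first `n` of these controls the
probability that `b` is played at most `n` times under the original law, and this forces about
`log T / klNat` plays of `b` (`eventually_mul_log_le_regret`).

*Upper bound.* Let `0 < c < 1` be a suitable constant. The bad event at time `t` is that one of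
the sample means of at least `δ c t` rewards is inaccurate, or that an index fails to be an upper
confidence bound at some time between `c t` and `t`. A Chernoff bound and a peeling argument
(`banditLaw_exists_lt_klExt_le`) show that its probability is `O(1 / (t log t))`
(`exists_banditLaw_badEvent_le`), which sums to `O(log log T)`. Outside of the bad event the
round-robin candidates have made enough good arms well-sampled (`wellSampled_of_window`), so that
all the better arms are played, and a bad arm is played only if its index exceeds nearly the
threshold mean (`of_notMem_badEvent`). For a bad arm with an accurate sample mean this is possible
at most `g(T) / κ` times, where `κ` is any number below its divergence from the threshold
(`exists_integral_plays_le`). Hence the finite-time bound `exists_regret_le`. For part (i) `κ` is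
the divergence from the mean `μ(θ_M) - ε`, which is strictly smaller than the one from `μ(θ_M)`;
the terms with square roots are not needed. For part (ii) `κ` tends to the divergence from
`μ(θ_M)`.
-/

noncomputable section

namespace Bandit

namespace ExpFamily

open ProbabilityTheory

variable {𝒳 : Type*} [MeasurableSpace 𝒳] (E : ExpFamily 𝒳)

/-! ### The exponential family -/

/-- The law with density `h`, of which every member of the family is an exponential tilt. -/
def carrier : Measure 𝒳 := E.ρ.withDensity fun x => (E.h x : ℝ≥0∞)

instance : IsProbabilityMeasure E.carrier :=
  ⟨by rw [carrier, withDensity_apply _ MeasurableSet.univ, Measure.restrict_univ, E.lintegral_h]⟩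

theorem integrable_carrier_iff {u : 𝒳 → ℝ} :
    Integrable u E.carrier ↔ Integrable (fun x => u x * (E.h x : ℝ)) E.ρ := by
  rw [carrier, integrable_withDensity_iff_integrable_smul E.measurable_h]
  simp only [NNReal.smul_def, smul_eq_mul, mul_comm]

theorem integral_carrier (u : 𝒳 → ℝ) :
    ∫ x, u x ∂E.carrier = ∫ x, u x * (E.h x : ℝ) ∂E.ρ := by
  rw [carrier, integral_withDensity_eq_integral_smul E.measurable_h]
  simp only [NNReal.smul_def, smul_eq_mul, mul_comm]

theorem naturalSpace_eq : E.naturalSpace = integrableExpSet E.f E.carrier := by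
  ext θ
  exact (E.integrable_carrier_iff).symm

theorem logMGF_eq : E.logMGF = cgf E.f E.carrier := by
  funext θ
  rw [logMGF, cgf, mgf, integral_carrier]

theorem zero_mem_naturalSpace : (0 : ℝ) ∈ E.naturalSpace := by
  rw [naturalSpace_eq]
  simp [integrableExpSet]

variable {E}

theorem exp_logMGF {θ : ℝ} (hθ : θ ∈ E.naturalSpace) :
    Real.exp (E.logMGF θ) = ∫ x, Real.exp (θ * E.f x) ∂E.carrier := by
  rw [logMGF_eq]
  rw [naturalSpace_eq] at hθ
  exact exp_cgf hθ

theorem law_eq_tilted {θ : ℝ} (hθ : θ ∈ E.naturalSpace) :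
    E.law θ = E.carrier.tilted (fun x => θ * E.f x) := by
  have hf := E.measurable_f
  have hh := E.measurable_h
  rw [Measure.tilted, ← exp_logMGF hθ, carrier, ← withDensity_mul _ (by fun_prop) (by fun_prop),
    law]
  congr 1
  funext x
  simp only [density, Pi.mul_apply]
  rw [ENNReal.ofReal_mul (Real.exp_pos _).le, ENNReal.ofReal_coe_nnreal, mul_comm, Real.exp_sub]

/-- Changing the natural parameter amounts to an exponential change of density. -/
theorem law_eq_withDensity (θ θ' : ℝ) :
    E.law θ' = (E.law θ).withDensity
      fun x => ENNReal.ofReal (Real.exp ((θ' - θ) * E.f x - (E.logMGF θ' - E.logMGF θ))) := by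
  have hf := E.measurable_f
  have hh := E.measurable_h
  rw [law, law, ← withDensity_mul _ (by unfold density; fun_prop) (by fun_prop)]
  congr 1
  funext x
  simp only [density, Pi.mul_apply]
  rw [← ENNReal.ofReal_mul (by positivity)]
  congr 1
  rw [mul_right_comm, ← Real.exp_add]
  congr 2
  ring

theorem law_absolutelyContinuous (θ θ' : ℝ) : E.law θ' ≪ E.law θ := by
  rw [law_eq_withDensity θ θ']
  exact withDensity_absolutelyContinuous _ _

theorem mean_eq_integral_law (θ : ℝ) : E.mean θ = ∫ x, E.f x ∂E.law θ := by
  have hf := E.measurable_f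
  have hh := E.measurable_h
  have hd : Measurable (fun x => (E.density θ x).toNNReal) := by unfold density; fun_prop
  have : E.law θ = E.ρ.withDensity fun x => ((E.density θ x).toNNReal : ℝ≥0∞) := rfl
  rw [this, integral_withDensity_eq_integral_smul hd, mean]
  refine integral_congr_ae (Eventually.of_forall fun x => ?_)
  have : 0 ≤ E.density θ x := by unfold density; positivity
  simp only [NNReal.smul_def, smul_eq_mul, Real.coe_toNNReal _ this, mul_comm]

theorem interior_integrableExpSet (hreg : IsOpen E.naturalSpace) :
    interior (integrableExpSet E.f E.carrier) = E.naturalSpace := by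
  rw [naturalSpace_eq] at hreg ⊢
  exact hreg.interior_eq

theorem mean_eq_deriv (hreg : IsOpen E.naturalSpace) {θ : ℝ} (hθ : θ ∈ E.naturalSpace) :
    E.mean θ = deriv E.logMGF θ := by
  rw [mean_eq_integral_law, law_eq_tilted hθ, logMGF_eq]
  exact integral_tilted_mul_self (by rwa [interior_integrableExpSet hreg])

theorem analyticAt_logMGF (hreg : IsOpen E.naturalSpace) {θ : ℝ} (hθ : θ ∈ E.naturalSpace) :
    AnalyticAt ℝ E.logMGF θ := by
  rw [logMGF_eq]
  exact analyticAt_cgf (by rwa [interior_integrableExpSet hreg])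

theorem hasDerivAt_logMGF (hreg : IsOpen E.naturalSpace) {θ : ℝ} (hθ : θ ∈ E.naturalSpace) :
    HasDerivAt E.logMGF (E.mean θ) θ := by
  rw [mean_eq_deriv hreg hθ]
  exact (analyticAt_logMGF hreg hθ).differentiableAt.hasDerivAt

theorem hasDerivAt_mean (hreg : IsOpen E.naturalSpace) {θ : ℝ} (hθ : θ ∈ E.naturalSpace) :
    HasDerivAt E.mean (variance E.f (E.law θ)) θ := by
  have h1 : HasDerivAt (deriv E.logMGF) (deriv (deriv E.logMGF) θ) θ :=
    (analyticAt_logMGF hreg hθ).deriv.differentiableAt.hasDerivAt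
  have h2 : variance E.f (E.law θ) = deriv (deriv E.logMGF) θ := by
    rw [law_eq_tilted hθ, variance_tilted_mul (by rwa [interior_integrableExpSet hreg]),
      iteratedDeriv_succ, iteratedDeriv_one, logMGF_eq]
  rw [h2]
  refine h1.congr_of_eventuallyEq ?_
  filter_upwards [hreg.mem_nhds hθ] with y hy using mean_eq_deriv hreg hy

theorem continuousOn_mean (hreg : IsOpen E.naturalSpace) : ContinuousOn E.mean E.naturalSpace :=
  fun _ hθ => (hasDerivAt_mean hreg hθ).continuousAt.continuousWithinAt

theorem continuousOn_logMGF (hreg : IsOpen E.naturalSpace) :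
    ContinuousOn E.logMGF E.naturalSpace :=
  fun _ hθ => (hasDerivAt_logMGF hreg hθ).continuousAt.continuousWithinAt

variable (E) in
theorem convex_naturalSpace : Convex ℝ E.naturalSpace := by
  rw [naturalSpace_eq]
  exact convex_integrableExpSet

variable (E) in
theorem ordConnected_naturalSpace : E.naturalSpace.OrdConnected :=
  E.convex_naturalSpace.ordConnected

theorem memLp_f_law (hreg : IsOpen E.naturalSpace) {θ : ℝ} (hθ : θ ∈ E.naturalSpace) (p : ℝ≥0) :
    MemLp E.f p (E.law θ) := by
  rw [law_eq_tilted hθ]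
  exact memLp_tilted_mul (by rwa [interior_integrableExpSet hreg]) p

theorem integrable_f_law (hreg : IsOpen E.naturalSpace) {θ : ℝ} (hθ : θ ∈ E.naturalSpace) :
    Integrable E.f (E.law θ) :=
  memLp_one_iff_integrable.1 (memLp_f_law hreg hθ 1)

/-- The family is degenerate if all its means agree; this happens when `f` is constant on the
support of the carrier density. Otherwise the mean determines the natural parameter. -/
theorem strictMonoOn_mean (hreg : IsOpen E.naturalSpace)
    (hnd : ∃ θ₁ ∈ E.naturalSpace, ∃ θ₂ ∈ E.naturalSpace, E.mean θ₁ ≠ E.mean θ₂) :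
    StrictMonoOn E.mean E.naturalSpace := by
  have hpos : ∀ θ ∈ E.naturalSpace, 0 < variance E.f (E.law θ) := by
    intro θ hθ
    have := E.isProbabilityMeasure_law hθ
    refine lt_of_le_of_ne (variance_nonneg _ _) fun h0 => ?_
    have hae : E.f =ᵐ[E.law θ] fun _ => ∫ x, E.f x ∂E.law θ := by
      refine (evariance_eq_zero_iff E.measurable_f.aemeasurable).1 ?_
      rw [← (memLp_f_law hreg hθ 2).ofReal_variance_eq, ← h0, ENNReal.ofReal_zero]
    have hm : ∀ θ' ∈ E.naturalSpace, E.mean θ' = E.mean θ := by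
      intro θ' hθ'
      have := E.isProbabilityMeasure_law hθ'
      rw [mean_eq_integral_law θ',
        integral_congr_ae ((law_absolutelyContinuous θ θ').ae_le hae), mean_eq_integral_law θ]
      simp
    obtain ⟨θ₁, h₁, θ₂, h₂, hne⟩ := hnd
    exact hne ((hm _ h₁).trans (hm _ h₂).symm)
  refine strictMonoOn_of_deriv_pos E.convex_naturalSpace (continuousOn_mean hreg) fun θ hθ => ?_
  rw [hreg.interior_eq] at hθ
  rw [(hasDerivAt_mean hreg hθ).deriv]
  exact hpos θ hθ

/-! ### The Kullback-Leibler divergence in the natural parameters -/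

variable (E) in
/-- The Kullback-Leibler divergence between the members of the family with the natural parameters
`θ₁` and `θ₂`, see `klMean_mean`. -/
def klNat (θ₁ θ₂ : ℝ) : ℝ := (θ₁ - θ₂) * E.mean θ₁ - (E.logMGF θ₁ - E.logMGF θ₂)

theorem klDiv_law (hreg : IsOpen E.naturalSpace) {θ₁ θ₂ : ℝ} (h₁ : θ₁ ∈ E.naturalSpace)
    (h₂ : θ₂ ∈ E.naturalSpace) :
    InformationTheory.klDiv (E.law θ₁) (E.law θ₂) = ENNReal.ofReal (E.klNat θ₁ θ₂) := by
  have hp₁ := E.isProbabilityMeasure_law h₁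
  have hp₂ := E.isProbabilityMeasure_law h₂
  have hf := E.measurable_f
  have hac := law_absolutelyContinuous (E := E) θ₂ θ₁
  have hllr : llr (E.law θ₁) (E.law θ₂) =ᵐ[E.law θ₁]
      fun x => (θ₁ - θ₂) * E.f x - (E.logMGF θ₁ - E.logMGF θ₂) := by
    have h := Measure.rnDeriv_withDensity (E.law θ₂)
      (f := fun x => ENNReal.ofReal
        (Real.exp ((θ₁ - θ₂) * E.f x - (E.logMGF θ₁ - E.logMGF θ₂)))) (by fun_prop)
    rw [← law_eq_withDensity θ₂ θ₁] at h
    filter_upwards [hac.ae_le h] with x hx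
    rw [llr, hx, ENNReal.toReal_ofReal (Real.exp_pos _).le, Real.log_exp]
  have hint : Integrable (fun x => (θ₁ - θ₂) * E.f x - (E.logMGF θ₁ - E.logMGF θ₂)) (E.law θ₁) :=
    ((integrable_f_law hreg h₁).const_mul _).sub (integrable_const _)
  rw [InformationTheory.klDiv_of_ac_of_integrable hac (hint.congr hllr.symm),
    integral_congr_ae hllr, integral_sub ((integrable_f_law hreg h₁).const_mul _)
      (integrable_const _), integral_const_mul, ← mean_eq_integral_law]
  simp [klNat]

theorem klMean_mean (hreg : IsOpen E.naturalSpace)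
    (hmono : StrictMonoOn E.mean E.naturalSpace) {θ₁ θ₂ : ℝ} (h₁ : θ₁ ∈ E.naturalSpace)
    (h₂ : θ₂ ∈ E.naturalSpace) :
    E.klMean (E.mean θ₁) (E.mean θ₂) = ENNReal.ofReal (E.klNat θ₁ θ₂) := by
  have hinv := hmono.injOn.leftInvOn_invFunOn
  rw [klMean, hinv h₁, hinv h₂, klDiv_law hreg h₁ h₂]

theorem klNat_self (θ : ℝ) : E.klNat θ θ = 0 := by simp [klNat]

theorem continuousOn_klNat_left (hreg : IsOpen E.naturalSpace) (θ₂ : ℝ) :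
    ContinuousOn (fun θ₁ => E.klNat θ₁ θ₂) E.naturalSpace := by
  have h1 := continuousOn_mean hreg
  have h2 := continuousOn_logMGF hreg
  unfold klNat
  fun_prop

theorem continuousOn_klNat_right (hreg : IsOpen E.naturalSpace) (θ₁ : ℝ) :
    ContinuousOn (fun θ₂ => E.klNat θ₁ θ₂) E.naturalSpace := by
  have h2 := continuousOn_logMGF hreg
  unfold klNat
  fun_prop

/-- The mean value theorem for `logMGF`, whose derivative is the mean. -/
theorem exists_klNat_eq (hreg : IsOpen E.naturalSpace) {θ₁ θ₂ : ℝ} (h₁ : θ₁ ∈ E.naturalSpace)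
    (h₂ : θ₂ ∈ E.naturalSpace) (hlt : θ₁ < θ₂) :
    ∃ c ∈ Set.Ioo θ₁ θ₂, E.logMGF θ₂ - E.logMGF θ₁ = (θ₂ - θ₁) * E.mean c := by
  have hsub : Set.Icc θ₁ θ₂ ⊆ E.naturalSpace := E.ordConnected_naturalSpace.out h₁ h₂
  obtain ⟨c, hc, h⟩ := exists_hasDerivAt_eq_slope E.logMGF E.mean hlt
    ((continuousOn_logMGF hreg).mono hsub)
    fun x hx => hasDerivAt_logMGF hreg (hsub (Set.Ioo_subset_Icc_self hx))
  refine ⟨c, hc, ?_⟩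
  rw [h, mul_div_cancel₀ _ (sub_pos.2 hlt).ne']

theorem klNat_pos (hreg : IsOpen E.naturalSpace)
    (hmono : StrictMonoOn E.mean E.naturalSpace) {θ₁ θ₂ : ℝ} (h₁ : θ₁ ∈ E.naturalSpace)
    (h₂ : θ₂ ∈ E.naturalSpace) (hne : θ₁ ≠ θ₂) : 0 < E.klNat θ₁ θ₂ := by
  rcases lt_or_gt_of_ne hne with hlt | hlt
  · obtain ⟨c, hc, h⟩ := exists_klNat_eq hreg h₁ h₂ hlt
    have hcm : c ∈ E.naturalSpace :=
      E.ordConnected_naturalSpace.out h₁ h₂ (Set.Ioo_subset_Icc_self hc)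
    have := hmono h₁ hcm hc.1
    have : E.klNat θ₁ θ₂ = (θ₂ - θ₁) * (E.mean c - E.mean θ₁) := by rw [klNat]; linarith
    rw [this]
    exact mul_pos (by linarith) (by linarith)
  · obtain ⟨c, hc, h⟩ := exists_klNat_eq hreg h₂ h₁ hlt
    have hcm : c ∈ E.naturalSpace :=
      E.ordConnected_naturalSpace.out h₂ h₁ (Set.Ioo_subset_Icc_self hc)
    have := hmono hcm h₁ hc.2
    have : E.klNat θ₁ θ₂ = (θ₁ - θ₂) * (E.mean θ₁ - E.mean c) := by rw [klNat]; linarith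
    rw [this]
    exact mul_pos (by linarith) (by linarith)

theorem klNat_nonneg (hreg : IsOpen E.naturalSpace)
    (hmono : StrictMonoOn E.mean E.naturalSpace) {θ₁ θ₂ : ℝ} (h₁ : θ₁ ∈ E.naturalSpace)
    (h₂ : θ₂ ∈ E.naturalSpace) : 0 ≤ E.klNat θ₁ θ₂ := by
  rcases eq_or_ne θ₁ θ₂ with rfl | h
  · rw [klNat_self]
  · exact (klNat_pos hreg hmono h₁ h₂ h).le

/-- The three-point identity of the Kullback-Leibler divergence. -/
theorem klNat_three_point (θ₁ θ₂ θ₃ : ℝ) :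
    E.klNat θ₁ θ₃ = E.klNat θ₁ θ₂ + E.klNat θ₂ θ₃ + (θ₂ - θ₃) * (E.mean θ₁ - E.mean θ₂) := by
  unfold klNat
  ring

/-- `KL` increases when its arguments move apart: the first one down, the second one up. -/
theorem klNat_le_of_le (hreg : IsOpen E.naturalSpace)
    (hmono : StrictMonoOn E.mean E.naturalSpace) {a b c d : ℝ} (ha : a ∈ E.naturalSpace)
    (hb : b ∈ E.naturalSpace) (hc : c ∈ E.naturalSpace) (hd : d ∈ E.naturalSpace)
    (hab : a ≤ b) (hbc : b ≤ c) (hcd : c ≤ d) : E.klNat b c ≤ E.klNat a d := by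
  have h1 := klNat_three_point (E := E) a b d
  have h2 := klNat_three_point (E := E) b c d
  have h3 := klNat_nonneg hreg hmono ha hb
  have h4 := klNat_nonneg hreg hmono hc hd
  have h5 : E.mean a ≤ E.mean b := hmono.monotoneOn ha hb hab
  have h6 : E.mean b ≤ E.mean c := hmono.monotoneOn hb hc hbc
  nlinarith [mul_nonneg (by linarith : 0 ≤ d - b) (by linarith : 0 ≤ E.mean b - E.mean a),
    mul_nonneg (by linarith : 0 ≤ d - c) (by linarith : 0 ≤ E.mean c - E.mean b)]

/-- `KL` increases when its arguments move apart: the first one up, the second one down. -/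
theorem klNat_le_of_ge (hreg : IsOpen E.naturalSpace)
    (hmono : StrictMonoOn E.mean E.naturalSpace) {a b c d : ℝ} (ha : a ∈ E.naturalSpace)
    (hb : b ∈ E.naturalSpace) (hc : c ∈ E.naturalSpace) (hd : d ∈ E.naturalSpace)
    (hab : b ≤ a) (hbc : c ≤ b) (hcd : d ≤ c) : E.klNat b c ≤ E.klNat a d := by
  have h1 := klNat_three_point (E := E) a b d
  have h2 := klNat_three_point (E := E) b c d
  have h3 := klNat_nonneg hreg hmono ha hb
  have h4 := klNat_nonneg hreg hmono hc hd
  have h5 : E.mean b ≤ E.mean a := hmono.monotoneOn hb ha hab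
  have h6 : E.mean c ≤ E.mean b := hmono.monotoneOn hc hb hbc
  nlinarith [mul_nonneg (by linarith : 0 ≤ b - d) (by linarith : 0 ≤ E.mean a - E.mean b),
    mul_nonneg (by linarith : 0 ≤ c - d) (by linarith : 0 ≤ E.mean b - E.mean c)]

end ExpFamily

namespace ExpFamily

open ProbabilityTheory

variable {𝒳 : Type*} [MeasurableSpace 𝒳] {E : ExpFamily 𝒳}

/-! ### The Kullback-Leibler divergence on the closure of the mean space -/

theorem ordConnected_meanSpace (hreg : IsOpen E.naturalSpace) : E.meanSpace.OrdConnected :=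
  (E.convex_naturalSpace.isPreconnected.image _ (continuousOn_mean hreg)).ordConnected

theorem mean_mem_meanSpace {θ : ℝ} (hθ : θ ∈ E.naturalSpace) : E.mean θ ∈ E.meanSpace :=
  ⟨θ, hθ, rfl⟩

/-- The inverse of the mean map is continuous. -/
theorem tendsto_invFunOn_mean (hreg : IsOpen E.naturalSpace)
    (hmono : StrictMonoOn E.mean E.naturalSpace) {θ : ℝ} (hθ : θ ∈ E.naturalSpace) :
    Tendsto (Function.invFunOn E.mean E.naturalSpace) (𝓝[E.meanSpace] E.mean θ)
      (𝓝[E.naturalSpace] θ) := by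
  have hmem : ∀ᶠ y in 𝓝[E.meanSpace] E.mean θ,
      Function.invFunOn E.mean E.naturalSpace y ∈ E.naturalSpace := by
    filter_upwards [self_mem_nhdsWithin] with y hy using Function.invFunOn_mem hy
  refine tendsto_nhdsWithin_iff.2 ⟨tendsto_order.2 ⟨fun a ha => ?_, fun b hb => ?_⟩, hmem⟩
  · obtain ⟨a', ⟨ha1, ha2⟩, ha3⟩ : ∃ a', a' ∈ Set.Ioo a θ ∧ a' ∈ E.naturalSpace :=
      ((Ioo_mem_nhdsLT ha |> fun h => (h : ∀ᶠ x in 𝓝[<] θ, x ∈ Set.Ioo a θ)).and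
        (mem_nhdsWithin_of_mem_nhds (hreg.mem_nhds hθ))).exists
    filter_upwards [self_mem_nhdsWithin,
      mem_nhdsWithin_of_mem_nhds (Ioi_mem_nhds (hmono ha3 hθ ha2))] with y hy hy2
    rw [Set.mem_Ioi, ← Function.invFunOn_eq (f := E.mean) (s := E.naturalSpace) hy] at hy2
    exact ha1.trans ((hmono.lt_iff_lt ha3 (Function.invFunOn_mem hy)).1 hy2)
  · obtain ⟨b', ⟨hb1, hb2⟩, hb3⟩ : ∃ b', b' ∈ Set.Ioo θ b ∧ b' ∈ E.naturalSpace :=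
      ((Ioo_mem_nhdsGT hb |> fun h => (h : ∀ᶠ x in 𝓝[>] θ, x ∈ Set.Ioo θ b)).and
        (mem_nhdsWithin_of_mem_nhds (hreg.mem_nhds hθ))).exists
    filter_upwards [self_mem_nhdsWithin,
      mem_nhdsWithin_of_mem_nhds (Iio_mem_nhds (hmono hθ hb3 hb1))] with y hy hy2
    rw [Set.mem_Iio, ← Function.invFunOn_eq (f := E.mean) (s := E.naturalSpace) hy] at hy2
    exact ((hmono.lt_iff_lt (Function.invFunOn_mem hy) hb3).1 hy2).trans hb2

theorem tendsto_klMean_mean (hreg : IsOpen E.naturalSpace)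
    (hmono : StrictMonoOn E.mean E.naturalSpace) {θ₁ θ₂ : ℝ} (h₁ : θ₁ ∈ E.naturalSpace)
    (h₂ : θ₂ ∈ E.naturalSpace) :
    Tendsto (fun m => E.klMean m (E.mean θ₂)) (𝓝[E.meanSpace] E.mean θ₁)
      (𝓝 (ENNReal.ofReal (E.klNat θ₁ θ₂))) := by
  have h := ENNReal.continuous_ofReal.continuousAt.tendsto.comp
    ((continuousOn_klNat_left hreg θ₂ θ₁ h₁).tendsto.comp (tendsto_invFunOn_mean hreg hmono h₁))
  refine h.congr' ?_
  filter_upwards [self_mem_nhdsWithin] with y hy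
  have hy' := Function.invFunOn_mem (f := E.mean) (s := E.naturalSpace) hy
  simp only [Function.comp_apply]
  rw [← klMean_mean hreg hmono hy' h₂, Function.invFunOn_eq hy]

theorem klMean_le_of_le (hreg : IsOpen E.naturalSpace)
    (hmono : StrictMonoOn E.mean E.naturalSpace) {a b c d : ℝ} (ha : a ∈ E.meanSpace)
    (hb : b ∈ E.meanSpace) (hc : c ∈ E.meanSpace) (hd : d ∈ E.meanSpace)
    (hab : a ≤ b) (hbc : b ≤ c) (hcd : c ≤ d) : E.klMean b c ≤ E.klMean a d := by
  obtain ⟨a, ha, rfl⟩ := ha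
  obtain ⟨b, hb, rfl⟩ := hb
  obtain ⟨c, hc, rfl⟩ := hc
  obtain ⟨d, hd, rfl⟩ := hd
  rw [klMean_mean hreg hmono hb hc, klMean_mean hreg hmono ha hd]
  exact ENNReal.ofReal_le_ofReal (klNat_le_of_le hreg hmono ha hb hc hd
    ((hmono.le_iff_le ha hb).1 hab) ((hmono.le_iff_le hb hc).1 hbc) ((hmono.le_iff_le hc hd).1 hcd))

theorem klMean_le_of_ge (hreg : IsOpen E.naturalSpace)
    (hmono : StrictMonoOn E.mean E.naturalSpace) {a b c d : ℝ} (ha : a ∈ E.meanSpace)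
    (hb : b ∈ E.meanSpace) (hc : c ∈ E.meanSpace) (hd : d ∈ E.meanSpace)
    (hab : b ≤ a) (hbc : c ≤ b) (hcd : d ≤ c) : E.klMean b c ≤ E.klMean a d := by
  obtain ⟨a, ha, rfl⟩ := ha
  obtain ⟨b, hb, rfl⟩ := hb
  obtain ⟨c, hc, rfl⟩ := hc
  obtain ⟨d, hd, rfl⟩ := hd
  rw [klMean_mean hreg hmono hb hc, klMean_mean hreg hmono ha hd]
  exact ENNReal.ofReal_le_ofReal (klNat_le_of_ge hreg hmono ha hb hc hd
    ((hmono.le_iff_le hb ha).1 hab) ((hmono.le_iff_le hc hb).1 hbc) ((hmono.le_iff_le hd hc).1 hcd))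

theorem meanSpace_gt_or_lt (hreg : IsOpen E.naturalSpace) {y : ℝ} (hy : y ∉ E.meanSpace) :
    (∀ m ∈ E.meanSpace, y < m) ∨ ∀ m ∈ E.meanSpace, m < y := by
  by_contra! h
  obtain ⟨⟨a, ha, hay⟩, b, hb, hyb⟩ := h
  exact hy ((ordConnected_meanSpace hreg).out ha hb ⟨hay, hyb⟩)

/-- The extension of `KL(·, ν)` to the closure of the mean space is a genuine limit, because
`KL(·, ν)` is monotone on both sides of `ν`. -/
theorem tendsto_klMean_klExt (hreg : IsOpen E.naturalSpace)
    (hmono : StrictMonoOn E.mean E.naturalSpace) {y ν : ℝ} (hy : y ∈ closure E.meanSpace)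
    (hν : ν ∈ E.meanSpace) :
    Tendsto (fun m => E.klMean m ν) (𝓝[E.meanSpace] y) (𝓝 (E.klExt y ν)) := by
  rw [klExt, if_pos hy]
  refine tendsto_extendFrom ?_
  by_cases hyM : y ∈ E.meanSpace
  · obtain ⟨θ₁, h₁, rfl⟩ := hyM
    obtain ⟨θ₂, h₂, rfl⟩ := hν
    exact ⟨_, tendsto_klMean_mean hreg hmono h₁ h₂⟩
  rcases meanSpace_gt_or_lt hreg hyM with hlt | hlt
  · refine ⟨⨆ m ∈ E.meanSpace ∩ Set.Iic ν, E.klMean m ν, tendsto_order.2 ⟨fun a ha => ?_,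
      fun b hb => ?_⟩⟩
    · obtain ⟨m, hm⟩ := lt_iSup_iff.1 ha
      obtain ⟨⟨hmM, hmν⟩, hm⟩ := lt_iSup_iff.1 hm
      filter_upwards [self_mem_nhdsWithin,
        mem_nhdsWithin_of_mem_nhds (Iio_mem_nhds (hlt m hmM))] with x hx hxm
      exact hm.trans_le (klMean_le_of_le hreg hmono hx hmM hν hν (le_of_lt hxm) hmν le_rfl)
    · filter_upwards [self_mem_nhdsWithin,
        mem_nhdsWithin_of_mem_nhds (Iio_mem_nhds (hlt ν hν))] with x hx hxν
      exact (le_iSup₂ (f := fun m (_ : m ∈ E.meanSpace ∩ Set.Iic ν) => E.klMean m ν) x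
        ⟨hx, le_of_lt (Set.mem_Iio.1 hxν)⟩).trans_lt hb
  · refine ⟨⨆ m ∈ E.meanSpace ∩ Set.Ici ν, E.klMean m ν, tendsto_order.2 ⟨fun a ha => ?_,
      fun b hb => ?_⟩⟩
    · obtain ⟨m, hm⟩ := lt_iSup_iff.1 ha
      obtain ⟨⟨hmM, hmν⟩, hm⟩ := lt_iSup_iff.1 hm
      filter_upwards [self_mem_nhdsWithin,
        mem_nhdsWithin_of_mem_nhds (Ioi_mem_nhds (hlt m hmM))] with x hx hxm
      exact hm.trans_le (klMean_le_of_ge hreg hmono hx hmM hν hν (le_of_lt hxm) hmν le_rfl)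
    · filter_upwards [self_mem_nhdsWithin,
        mem_nhdsWithin_of_mem_nhds (Ioi_mem_nhds (hlt ν hν))] with x hx hxν
      exact (le_iSup₂ (f := fun m (_ : m ∈ E.meanSpace ∩ Set.Ici ν) => E.klMean m ν) x
        ⟨hx, le_of_lt (Set.mem_Ioi.1 hxν)⟩).trans_lt hb

theorem neBot_nhdsWithin_meanSpace {y : ℝ} (hy : y ∈ closure E.meanSpace) :
    (𝓝[E.meanSpace] y).NeBot := mem_closure_iff_nhdsWithin_neBot.1 hy

theorem klExt_mean (hreg : IsOpen E.naturalSpace)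
    (hmono : StrictMonoOn E.mean E.naturalSpace) {θ₁ θ₂ : ℝ} (h₁ : θ₁ ∈ E.naturalSpace)
    (h₂ : θ₂ ∈ E.naturalSpace) :
    E.klExt (E.mean θ₁) (E.mean θ₂) = ENNReal.ofReal (E.klNat θ₁ θ₂) := by
  have hy : E.mean θ₁ ∈ closure E.meanSpace := subset_closure (mean_mem_meanSpace h₁)
  have := neBot_nhdsWithin_meanSpace hy
  exact tendsto_nhds_unique (tendsto_klMean_klExt hreg hmono hy (mean_mem_meanSpace h₂))
    (tendsto_klMean_mean hreg hmono h₁ h₂)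

/-- A bound for `KL(·, ν)` on the mean space below `ν` also holds at the lower boundary. -/
theorem klExt_le_of_forall_le (hreg : IsOpen E.naturalSpace)
    (hmono : StrictMonoOn E.mean E.naturalSpace) {y θ c : ℝ} (hy : y ∈ closure E.meanSpace)
    (hθ : θ ∈ E.naturalSpace) (hyθ : y ≤ E.mean θ)
    (hc : ∀ θ₁ ∈ E.naturalSpace, θ₁ ≤ θ → E.klNat θ₁ θ ≤ c) :
    E.klExt y (E.mean θ) ≤ ENNReal.ofReal c := by
  have key : ∀ m ∈ E.meanSpace, m ≤ E.mean θ → E.klMean m (E.mean θ) ≤ ENNReal.ofReal c := by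
    rintro _ ⟨θ₁, h₁, rfl⟩ hm
    rw [klMean_mean hreg hmono h₁ hθ]
    exact ENNReal.ofReal_le_ofReal (hc _ h₁ ((hmono.le_iff_le h₁ hθ).1 hm))
  rcases hyθ.eq_or_lt with rfl | hlt
  · rw [klExt_mean hreg hmono hθ hθ]
    exact ENNReal.ofReal_le_ofReal (hc _ hθ le_rfl)
  · have := neBot_nhdsWithin_meanSpace hy
    refine le_of_tendsto (tendsto_klMean_klExt hreg hmono hy (mean_mem_meanSpace hθ)) ?_
    filter_upwards [self_mem_nhdsWithin, mem_nhdsWithin_of_mem_nhds (Iio_mem_nhds hlt)]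
      with m hm hmθ using key m hm (le_of_lt hmθ)

/-- A bound for `KL(·, ν)` on the mean space above `ν` also holds at the upper boundary. -/
theorem klExt_le_of_forall_ge (hreg : IsOpen E.naturalSpace)
    (hmono : StrictMonoOn E.mean E.naturalSpace) {y θ c : ℝ} (hy : y ∈ closure E.meanSpace)
    (hθ : θ ∈ E.naturalSpace) (hyθ : E.mean θ ≤ y)
    (hc : ∀ θ₁ ∈ E.naturalSpace, θ ≤ θ₁ → E.klNat θ₁ θ ≤ c) :
    E.klExt y (E.mean θ) ≤ ENNReal.ofReal c := by
  have key : ∀ m ∈ E.meanSpace, E.mean θ ≤ m → E.klMean m (E.mean θ) ≤ ENNReal.ofReal c := by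
    rintro _ ⟨θ₁, h₁, rfl⟩ hm
    rw [klMean_mean hreg hmono h₁ hθ]
    exact ENNReal.ofReal_le_ofReal (hc _ h₁ ((hmono.le_iff_le hθ h₁).1 hm))
  rcases hyθ.eq_or_lt with rfl | hlt
  · rw [klExt_mean hreg hmono hθ hθ]
    exact ENNReal.ofReal_le_ofReal (hc _ hθ le_rfl)
  · have := neBot_nhdsWithin_meanSpace hy
    refine le_of_tendsto (tendsto_klMean_klExt hreg hmono hy (mean_mem_meanSpace hθ)) ?_
    filter_upwards [self_mem_nhdsWithin, mem_nhdsWithin_of_mem_nhds (Ioi_mem_nhds hlt)]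
      with m hm hmθ using key m hm (le_of_lt hmθ)

/-- Below `ν` the divergence `KL(·, ν)` keeps the monotonicity of `KL` up to the boundary of the
mean space, and trivially beyond it. -/
theorem klNat_le_klExt (hreg : IsOpen E.naturalSpace)
    (hmono : StrictMonoOn E.mean E.naturalSpace) {y ν θ₁ θ₂ : ℝ} (h₁ : θ₁ ∈ E.naturalSpace)
    (h₂ : θ₂ ∈ E.naturalSpace) (hν : ν ∈ E.meanSpace) (hy : y < E.mean θ₁) (h₁₂ : θ₁ ≤ θ₂)
    (h₂ν : E.mean θ₂ ≤ ν) :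
    ENNReal.ofReal (E.klNat θ₁ θ₂) ≤ E.klExt y ν := by
  by_cases hyc : y ∈ closure E.meanSpace
  · have := neBot_nhdsWithin_meanSpace hyc
    refine ge_of_tendsto (tendsto_klMean_klExt hreg hmono hyc hν) ?_
    filter_upwards [self_mem_nhdsWithin, mem_nhdsWithin_of_mem_nhds (Iio_mem_nhds hy)] with m hm hm1
    rw [← klMean_mean hreg hmono h₁ h₂]
    exact klMean_le_of_le hreg hmono hm (mean_mem_meanSpace h₁) (mean_mem_meanSpace h₂) hν
      (le_of_lt hm1) (hmono.monotoneOn h₁ h₂ h₁₂) h₂ν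
  · rw [klExt, if_neg hyc]
    exact le_top

/-! ### The statistic takes its values in the closure of the mean space -/

/-- If the domain of the moment generating function is open, then the variable is almost surely
bounded by any bound of the derivative of its cumulant generating function: the bound keeps the
moment generating function finite on the whole half-line, and Chernoff's inequality applies there.
-/
theorem measure_ge_eq_zero_of_deriv_cgf_le {Ω : Type*} [MeasurableSpace Ω] {P : Measure Ω}
    [IsProbabilityMeasure P] {X : Ω → ℝ} (hX : Measurable X)
    (hopen : IsOpen (integrableExpSet X P)) {c c' : ℝ} (hcc : c' < c)
    (hder : ∀ t ∈ integrableExpSet X P, deriv (cgf X P) t ≤ c') :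
    P {ω | c ≤ X ω} = 0 := by
  set S := integrableExpSet X P with hS
  have h0 : (0 : ℝ) ∈ S := by simp [hS, integrableExpSet]
  have hint : interior S = S := hopen.interior_eq
  have hSo : S.OrdConnected := convex_integrableExpSet.ordConnected
  have hcgf : ∀ t ∈ S, 0 ≤ t → cgf X P t ≤ c' * t := by
    intro t ht ht0
    have hsub : Set.Icc 0 t ⊆ S := hSo.out h0 ht
    have h := Convex.image_sub_le_mul_sub_of_deriv_le (convex_Icc (0 : ℝ) t) (f := cgf X P)
      (fun x hx => (analyticAt_cgf
        (by rw [← hS, hint]; exact hsub hx)).continuousAt.continuousWithinAt)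
      (fun x hx => ((analyticAt_cgf (by
        rw [← hS, hint]; exact hsub (interior_subset hx))).differentiableAt).differentiableWithinAt)
      (C := c') (fun x hx => hder x (hsub (interior_subset hx)))
      0 (by simp [ht0]) t (by simp [ht0]) ht0
    simpa using h
  have hall : Set.Ici (0 : ℝ) ⊆ S := by
    refine isPreconnected_Ici.subset_of_closure_inter_subset hopen ⟨0, by simp, h0⟩ ?_
    rintro t ⟨htc, ht0⟩
    -- at a limit point of the domain the moment generating function is finite by Fatou's lemma
    rcases (show (0:ℝ) ≤ t from ht0).eq_or_lt with rfl | htpos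
    · exact h0
    obtain ⟨u, huS, hut⟩ := mem_closure_iff_seq_limit.1 htc
    have hev : ∀ᶠ n in atTop, 0 ≤ u n ∧ u n ≤ t + 1 :=
      (hut.eventually (lt_mem_nhds htpos)).mp ((hut.eventually (gt_mem_nhds (lt_add_one t))).mono
        fun n h1 h2 => ⟨le_of_lt h2, le_of_lt h1⟩)
    have hb : ∀ᶠ n in atTop, ∫⁻ ω, ENNReal.ofReal (Real.exp (u n * X ω)) ∂P ≤
        ENNReal.ofReal (Real.exp (|c'| * (t + 1))) := by
      filter_upwards [hev] with n hn
      have hi : Integrable (fun ω => Real.exp (u n * X ω)) P := huS n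
      rw [← ofReal_integral_eq_lintegral_ofReal hi
        (Eventually.of_forall fun ω => (Real.exp_pos _).le)]
      refine ENNReal.ofReal_le_ofReal ?_
      have : ∫ ω, Real.exp (u n * X ω) ∂P = Real.exp (cgf X P (u n)) := (exp_cgf hi).symm
      rw [this]
      refine Real.exp_le_exp.2 ((hcgf _ (huS n) hn.1).trans ?_)
      exact (mul_le_mul_of_nonneg_right (le_abs_self c') hn.1).trans
        (mul_le_mul_of_nonneg_left hn.2 (abs_nonneg _))
    have hF := lintegral_liminf_le (μ := P) (u := atTop)
      (f := fun n ω => ENNReal.ofReal (Real.exp (u n * X ω))) (fun n => by fun_prop)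
    have hlim : ∀ ω, liminf (fun n => ENNReal.ofReal (Real.exp (u n * X ω))) atTop =
        ENNReal.ofReal (Real.exp (t * X ω)) := by
      intro ω
      refine Tendsto.liminf_eq ?_
      exact (ENNReal.continuous_ofReal.tendsto (Real.exp (t * X ω))).comp
        ((Real.continuous_exp.tendsto (t * X ω)).comp (hut.mul_const (X ω)))
    simp only [hlim] at hF
    have hfin : ∫⁻ ω, ENNReal.ofReal (Real.exp (t * X ω)) ∂P < ∞ := by
      refine hF.trans_lt (lt_of_le_of_lt (liminf_le_of_frequently_le' hb.frequently) ?_)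
      exact ENNReal.ofReal_lt_top
    refine ⟨by fun_prop, ?_⟩
    rw [hasFiniteIntegral_iff_ofReal (Eventually.of_forall fun ω => (Real.exp_pos _).le)]
    exact hfin
  have hch : ∀ t : ℝ, 0 ≤ t → P.real {ω | c ≤ X ω} ≤ Real.exp (-(c - c') * t) := by
    intro t ht
    have h := measure_ge_le_exp_cgf (μ := P) (X := X) c ht (hall ht)
    refine h.trans (Real.exp_le_exp.2 ?_)
    have := hcgf t (hall ht) ht
    linarith
  have hlim : Tendsto (fun t : ℝ => Real.exp (-(c - c') * t)) atTop (𝓝 0) :=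
    Real.tendsto_exp_atBot.comp (tendsto_id.const_mul_atTop_of_neg (by linarith))
  have h0' : P.real {ω | c ≤ X ω} ≤ 0 :=
    ge_of_tendsto hlim ((eventually_ge_atTop 0).mono fun t ht => hch t ht)
  exact (measureReal_eq_zero_iff).1 (le_antisymm h0' measureReal_nonneg)

/-- Almost surely the rewards do not exceed any rational bound of the mean space; together these
bounds describe the closure of the mean space, which is an interval. -/
theorem ae_mem_closure_meanSpace (hreg : IsOpen E.naturalSpace) (θ : ℝ) :
    ∀ᵐ x ∂E.law θ, E.f x ∈ closure E.meanSpace := by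
  have hopen : IsOpen (integrableExpSet E.f E.carrier) := by rwa [← naturalSpace_eq]
  have hac : E.law θ ≪ E.carrier := by
    have h0 : E.law 0 = E.carrier := by
      rw [law_eq_tilted E.zero_mem_naturalSpace]
      simp only [zero_mul]
      exact tilted_const _ 0
    rw [← h0]
    exact law_absolutelyContinuous 0 θ
  have hup : ∀ q : ℚ × ℚ, ∀ᵐ x ∂E.carrier, (q.1 : ℝ) < q.2 →
      (∀ m ∈ E.meanSpace, m ≤ (q.1 : ℝ)) → E.f x < q.2 := by
    rintro ⟨q, r⟩
    by_cases h : (q : ℝ) < r ∧ ∀ m ∈ E.meanSpace, m ≤ (q : ℝ)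
    · have h0 := measure_ge_eq_zero_of_deriv_cgf_le E.measurable_f hopen h.1 fun t ht => by
        rw [← naturalSpace_eq] at ht
        rw [← logMGF_eq, ← mean_eq_deriv hreg ht]
        exact h.2 _ (mean_mem_meanSpace ht)
      filter_upwards [measure_eq_zero_iff_ae_notMem.1 h0] with x hx _ _ using not_le.1 hx
    · exact Eventually.of_forall fun x h1 h2 => absurd ⟨h1, h2⟩ h
  have hlow : ∀ q : ℚ × ℚ, ∀ᵐ x ∂E.carrier, (q.2 : ℝ) < q.1 →
      (∀ m ∈ E.meanSpace, (q.1 : ℝ) ≤ m) → (q.2 : ℝ) < E.f x := by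
    rintro ⟨q, r⟩
    by_cases h : (r : ℝ) < q ∧ ∀ m ∈ E.meanSpace, (q : ℝ) ≤ m
    · have hset : integrableExpSet (fun x => -E.f x) E.carrier =
          (fun t => -t) ⁻¹' integrableExpSet E.f E.carrier := by
        ext t
        simp [integrableExpSet]
      have h0 := measure_ge_eq_zero_of_deriv_cgf_le (P := E.carrier) (X := fun x => -E.f x)
        E.measurable_f.neg (by rw [hset]; exact hopen.preimage continuous_neg) (c := -r) (c' := -q)
        (by linarith [h.1]) fun t ht => by
        rw [hset, Set.mem_preimage, ← naturalSpace_eq] at ht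
        have : cgf (fun x => -E.f x) E.carrier = fun t => E.logMGF (-t) := by
          funext t
          rw [logMGF_eq]
          exact cgf_neg
        rw [this, deriv_comp_neg, ← mean_eq_deriv hreg ht]
        exact neg_le_neg (h.2 _ (mean_mem_meanSpace ht))
      filter_upwards [measure_eq_zero_iff_ae_notMem.1 h0] with x hx _ _
      have hx' : ¬ (-(r : ℝ) ≤ -E.f x) := hx
      linarith [not_le.1 hx']
    · exact Eventually.of_forall fun x h1 h2 => absurd ⟨h1, h2⟩ h
  refine hac.ae_le ?_
  filter_upwards [ae_all_iff.2 hup, ae_all_iff.2 hlow] with x hx1 hx2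
  by_contra hx
  obtain ⟨ε, hε, hball⟩ := Metric.mem_nhds_iff.1 (isClosed_closure.isOpen_compl.mem_nhds hx)
  have hxM : E.f x ∉ E.meanSpace := fun h => hx (subset_closure h)
  have hfar : ∀ m ∈ E.meanSpace, ε ≤ |m - E.f x| := by
    intro m hm
    by_contra! hlt
    exact hball (by rwa [Metric.mem_ball, Real.dist_eq]) (subset_closure hm)
  rcases meanSpace_gt_or_lt hreg hxM with hlt | hlt
  · obtain ⟨r, hr1, hr2⟩ := exists_rat_btwn (show E.f x < E.f x + ε by linarith)
    obtain ⟨q, hq1, hq2⟩ := exists_rat_btwn hr2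
    refine absurd (hx2 (q, r) hq1 fun m hm => ?_) (not_lt.2 hr1.le)
    have := hfar m hm
    rw [abs_of_pos (sub_pos.2 (hlt m hm))] at this
    linarith
  · obtain ⟨r, hr1, hr2⟩ := exists_rat_btwn (show E.f x - ε < E.f x by linarith)
    obtain ⟨q, hq1, hq2⟩ := exists_rat_btwn hr1
    refine absurd (hx1 (q, r) hq2 fun m hm => ?_) (not_lt.2 hr2.le)
    have := hfar m hm
    rw [abs_of_neg (sub_neg.2 (hlt m hm))] at this
    linarith

end ExpFamily

open ProbabilityTheory

/-! ### Product measures -/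

section Product

variable {ι : Type*} {X : ι → Type*} [∀ i, MeasurableSpace (X i)]

/-- Changing finitely many factors of a product of probability measures by densities changes the
product by the product of the densities. -/
theorem infinitePi_eq_withDensity {P P' : ∀ i, Measure (X i)} [∀ i, IsProbabilityMeasure (P i)]
    [∀ i, IsProbabilityMeasure (P' i)] {F : Finset ι} {l : ∀ i, X i → ℝ≥0∞}
    (hl : ∀ i, Measurable (l i)) (hF : ∀ i ∈ F, P' i = (P i).withDensity (l i))
    (hF' : ∀ i ∉ F, P' i = P i) :
    Measure.infinitePi P' =
      (Measure.infinitePi P).withDensity fun ω => ∏ i ∈ F, l i (ω i) := by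
  classical
  refine (Measure.eq_infinitePi P' fun s t ht => ?_).symm
  have hmeas : MeasurableSet (Set.pi (s : Set ι) t) :=
    MeasurableSet.pi s.countable_toSet fun i _ => ht i
  set u : ∀ i, X i → ℝ≥0∞ := fun i => Set.indicator (if i ∈ s then t i else Set.univ)
    (if i ∈ F then l i else fun _ => 1) with hu
  have htm : ∀ i, MeasurableSet (if i ∈ s then t i else Set.univ) := fun i => by
    split_ifs
    · exact ht i
    · exact MeasurableSet.univ
  have hum : ∀ i, Measurable (u i) := fun i => by
    refine Measurable.indicator ?_ (htm i)
    split_ifs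
    · exact hl i
    · exact measurable_const
  have hint : ∀ i, ∫⁻ x, u i x ∂(P i) = P' i (if i ∈ s then t i else Set.univ) := by
    intro i
    rw [hu, lintegral_indicator (htm i)]
    by_cases hi : i ∈ F
    · rw [hF i hi, withDensity_apply _ (htm i), if_pos hi]
    · rw [hF' i hi, if_neg hi, setLIntegral_const, one_mul]
  have hprod : ∀ ω, Set.indicator (Set.pi (s : Set ι) t) (fun ω => ∏ i ∈ F, l i (ω i)) ω =
      ∏ i ∈ s ∪ F, u i (ω i) := by
    intro ω
    by_cases hω : ω ∈ Set.pi (s : Set ι) t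
    · rw [Set.indicator_of_mem hω, ← Finset.prod_subset (Finset.subset_union_right (s₁ := s))]
      · refine Finset.prod_congr rfl fun i hi => ?_
        have : ω i ∈ (if i ∈ s then t i else Set.univ) := by
          split_ifs with his
          · exact hω i his
          · trivial
        rw [hu]
        simp only
        rw [Set.indicator_of_mem this, if_pos hi]
      · intro i _ hi
        have : ω i ∈ (if i ∈ s then t i else Set.univ) := by
          split_ifs with his
          · exact hω i his
          · trivial
        rw [hu]
        simp only
        rw [Set.indicator_of_mem this, if_neg hi]
    · rw [Set.indicator_of_notMem hω]
      simp only [Set.mem_pi, not_forall] at hω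
      obtain ⟨i, his, hi⟩ := hω
      refine (Finset.prod_eq_zero (Finset.mem_union_left F his) ?_).symm
      rw [hu]
      simp only
      rw [Set.indicator_of_notMem]
      rwa [if_pos (show i ∈ s from his)]
  have hindep : iIndepFun (fun i (ω : ∀ i, X i) => u i (ω i)) (Measure.infinitePi P) :=
    iIndepFun_infinitePi hum
  have heval : ∀ i, ∫⁻ ω, u i (ω i) ∂(Measure.infinitePi P) = ∫⁻ x, u i x ∂(P i) := fun i => by
    rw [← Measure.infinitePi_map_eval P i, lintegral_map (hum i) (measurable_pi_apply i)]
  rw [withDensity_apply _ hmeas, ← lintegral_indicator hmeas, lintegral_congr hprod,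
    lintegral_prod_eq_prod_lintegral_of_indepFun _ _ hindep
      fun i => (hum i).comp (measurable_pi_apply i)]
  simp only [heval, hint]
  rw [← Finset.prod_subset (Finset.subset_union_left (s₂ := F))]
  · exact Finset.prod_congr rfl fun i hi => by rw [if_pos hi]
  · intro i _ hi
    rw [if_neg hi, measure_univ]

/-- The set `A` depends only on the coordinates in `J`. -/
def DependsOnCoords (J : Set ι) (A : Set (∀ i, X i)) : Prop :=
  ∀ ω ω' : ∀ i, X i, (∀ i ∈ J, ω i = ω' i) → ω ∈ A → ω' ∈ A

theorem DependsOnCoords.exists_preimage {J : Set ι} {A : Set (∀ i, X i)} (hA : DependsOnCoords J A)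
    (hAm : MeasurableSet A) :
    ∃ A' : Set (∀ i : J, X i), MeasurableSet A' ∧ A = J.domRestrict ⁻¹' A' := by
  classical
  rcases A.eq_empty_or_nonempty with rfl | ⟨ω₀, -⟩
  · exact ⟨∅, MeasurableSet.empty, by simp⟩
  let e : (∀ i : J, X i) → ∀ i, X i := fun y i => if h : i ∈ J then y ⟨i, h⟩ else ω₀ i
  have he : Measurable e := measurable_pi_iff.2 fun i => by
    by_cases h : i ∈ J
    · simpa only [e, dif_pos h] using measurable_pi_apply (⟨i, h⟩ : J)
    · simpa only [e, dif_neg h] using measurable_const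
  refine ⟨e ⁻¹' A, he hAm, ?_⟩
  have key : ∀ ω : ∀ i, X i, ∀ i ∈ J, ω i = e (J.domRestrict ω) i := fun ω i hi => by
    simp only [e, dif_pos hi]
    rfl
  ext ω
  exact ⟨fun h => hA _ _ (key ω) h, fun h => hA _ _ (fun i hi => (key ω i hi).symm) h⟩

theorem infinitePi_congr_of_dependsOnCoords {P P' : ∀ i, Measure (X i)}
    [∀ i, IsProbabilityMeasure (P i)] [∀ i, IsProbabilityMeasure (P' i)] {J : Set ι}
    (hPP : ∀ i ∈ J, P i = P' i) {A : Set (∀ i, X i)} (hA : DependsOnCoords J A)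
    (hAm : MeasurableSet A) : Measure.infinitePi P A = Measure.infinitePi P' A := by
  obtain ⟨A', hA', rfl⟩ := hA.exists_preimage hAm
  have hr : Measurable (J.domRestrict : (∀ i, X i) → ∀ i : J, X i) :=
    measurable_pi_iff.2 fun i => measurable_pi_apply _
  rw [← Measure.map_apply hr hA', ← Measure.map_apply hr hA', Measure.infinitePi_map_restrict',
    Measure.infinitePi_map_restrict']
  congr 2
  funext i
  exact hPP i i.2

end Product

namespace ExpFamily

variable {𝒳 : Type*} [MeasurableSpace 𝒳] {E : ExpFamily 𝒳} {K : ℕ}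

/-! ### Change of measure for one arm -/

variable (E) in
/-- The average of the first `n` rewards of arm `a`. -/
def sampleMean (a : Fin K) (n : ℕ) (ω : Sample 𝒳 K) : ℝ := (∑ k ∈ Finset.Icc 1 n, E.Y a k ω) / n

@[fun_prop]
theorem measurable_Y (a : Fin K) (n : ℕ) : Measurable (E.Y a n) :=
  E.measurable_f.comp (measurable_pi_apply _)

@[fun_prop]
theorem measurable_sampleMean (a : Fin K) (n : ℕ) : Measurable (E.sampleMean a n) := by
  unfold sampleMean
  fun_prop

theorem natCast_mul_sampleMean (a : Fin K) {n : ℕ} (hn : 1 ≤ n) (ω : Sample 𝒳 K) :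
    (n : ℝ) * E.sampleMean a n ω = ∑ k ∈ Finset.Icc 1 n, E.Y a k ω := by
  rw [sampleMean, mul_div_cancel₀ _ (by positivity)]

theorem isProbabilityMeasure_banditLaw {θ : Fin K → ℝ} (hθ : ∀ a, θ a ∈ E.naturalSpace) :
    IsProbabilityMeasure (E.banditLaw θ) := by
  have : ∀ i : Fin K × ℕ, IsProbabilityMeasure (E.law (θ i.1)) :=
    fun i => E.isProbabilityMeasure_law (hθ i.1)
  unfold banditLaw
  infer_instance

/-- The coordinates that are known when at most the first `n` observations of arm `b` are known. -/
def coordsUpTo (b : Fin K) (n : ℕ) : Set (Fin K × ℕ) := {i | i.1 = b → i.2 ∈ Finset.Icc 1 n}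

/-- For an event that involves at most the first `n` observations of arm `b`, changing the
parameter of this arm amounts to the likelihood ratio of these `n` observations. -/
theorem banditLaw_eq_setLIntegral {θ θ' : Fin K → ℝ} (hθ : ∀ a, θ a ∈ E.naturalSpace)
    (hθ' : ∀ a, θ' a ∈ E.naturalSpace) {b : Fin K} (hb : ∀ a, a ≠ b → θ' a = θ a) {n : ℕ}
    {A : Set (Sample 𝒳 K)} (hA : DependsOnCoords (coordsUpTo b n) A) (hAm : MeasurableSet A) :
    E.banditLaw θ' A = ∫⁻ ω in A, ENNReal.ofReal (Real.exp ((θ' b - θ b) *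
      ∑ k ∈ Finset.Icc 1 n, E.Y b k ω - n * (E.logMGF (θ' b) - E.logMGF (θ b))))
      ∂(E.banditLaw θ) := by
  classical
  have hf := E.measurable_f
  have i1 : ∀ i : Fin K × ℕ, IsProbabilityMeasure (E.law (θ i.1)) :=
    fun i => E.isProbabilityMeasure_law (hθ i.1)
  have i2 : ∀ i : Fin K × ℕ, IsProbabilityMeasure (E.law (θ' i.1)) :=
    fun i => E.isProbabilityMeasure_law (hθ' i.1)
  set F : Finset (Fin K × ℕ) := {b} ×ˢ Finset.Icc 1 n with hF
  set P' : Fin K × ℕ → Measure 𝒳 := fun i => if i ∈ F then E.law (θ' i.1) else E.law (θ i.1)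
    with hP'
  have i3 : ∀ i : Fin K × ℕ, IsProbabilityMeasure (P' i) := fun i => by
    rw [hP']
    simp only
    split_ifs
    · exact i2 i
    · exact i1 i
  have h1 : E.banditLaw θ' A = Measure.infinitePi P' A := by
    refine infinitePi_congr_of_dependsOnCoords (fun i hi => ?_) hA hAm
    by_cases hib : i.1 = b
    · have : i ∈ F := Finset.mem_product.2 ⟨by simp [hib], hi hib⟩
      rw [hP']
      simp only [if_pos this]
    · have : i ∉ F := fun h => hib (by simpa using (Finset.mem_product.1 h).1)
      rw [hP']
      simp only [if_neg this, hb i.1 hib]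
  have h2 := infinitePi_eq_withDensity (P := fun i : Fin K × ℕ => E.law (θ i.1)) (P' := P')
    (F := F) (l := fun i x => ENNReal.ofReal (Real.exp ((θ' i.1 - θ i.1) * E.f x -
      (E.logMGF (θ' i.1) - E.logMGF (θ i.1))))) (fun i => by fun_prop)
    (fun i hi => by
      rw [hP']
      simp only [if_pos hi]
      exact law_eq_withDensity _ _)
    (fun i hi => by
      rw [hP']
      simp only [if_neg hi])
  rw [h1, h2, withDensity_apply _ hAm]
  refine lintegral_congr fun ω => ?_
  rw [hF, Finset.prod_product, Finset.prod_singleton,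
    ← ENNReal.ofReal_prod_of_nonneg fun _ _ => (Real.exp_pos _).le, ← Real.exp_sum,
    Finset.sum_sub_distrib]
  simp [Y, Finset.mul_sum, mul_sub]

/-- A maximal inequality for the likelihood ratio martingale of one arm, by a change of measure at
the first passage. -/
theorem banditLaw_exists_le_log_likelihood {θ : Fin K → ℝ} (hθ : ∀ a, θ a ∈ E.naturalSpace)
    (b : Fin K) {θ₁ : ℝ} (h₁ : θ₁ ∈ E.naturalSpace) (N : ℕ) (y : ℝ) :
    E.banditLaw θ {ω | ∃ n ∈ Finset.Icc 1 N, y ≤ (θ₁ - θ b) * ∑ k ∈ Finset.Icc 1 n, E.Y b k ω -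
      n * (E.logMGF θ₁ - E.logMGF (θ b))} ≤ ENNReal.ofReal (Real.exp (-y)) := by
  classical
  set Z : ℕ → Sample 𝒳 K → ℝ := fun n ω => (θ₁ - θ b) * ∑ k ∈ Finset.Icc 1 n, E.Y b k ω -
      n * (E.logMGF θ₁ - E.logMGF (θ b)) with hZ
  have hZm : ∀ n, Measurable (Z n) := fun n => by rw [hZ]; fun_prop
  set θ' : Fin K → ℝ := Function.update θ b θ₁ with hθ'def
  have hθ' : ∀ a, θ' a ∈ E.naturalSpace := fun a => by
    by_cases h : a = b
    · rw [h, hθ'def, Function.update_self]; exact h₁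
    · rw [hθ'def, Function.update_of_ne h]; exact hθ a
  have := isProbabilityMeasure_banditLaw hθ'
  set A : ℕ → Set (Sample 𝒳 K) := fun n => {ω | y ≤ Z n ω ∧ ∀ k ∈ Finset.Ico 1 n, Z k ω < y}
    with hA
  have hAm : ∀ n, MeasurableSet (A n) := fun n => by
    have : A n = {ω | y ≤ Z n ω} ∩ ⋂ k ∈ Finset.Ico 1 n, {ω | Z k ω < y} := by
      ext ω; simp [hA]
    rw [this]
    exact (measurableSet_le measurable_const (hZm n)).inter
      (Finset.measurableSet_biInter _ fun k _ => measurableSet_lt (hZm k) measurable_const)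
  have hAd : ∀ n, DependsOnCoords (coordsUpTo b n) (A n) := by
    intro n ω ω' h hω
    have hY : ∀ k ∈ Finset.Icc 1 n, E.Y b k ω = E.Y b k ω' := fun k hk => by
      rw [Y, Y, h (b, k) fun _ => hk]
    have hZe : ∀ k ≤ n, Z k ω = Z k ω' := by
      intro k hk
      rw [hZ]
      simp only
      rw [Finset.sum_congr rfl fun j hj => hY j (Finset.Icc_subset_Icc_right hk hj)]
    exact ⟨by rw [← hZe n le_rfl]; exact hω.1, fun k hk => by
      rw [← hZe k (Finset.mem_Ico.1 hk).2.le]; exact hω.2 k hk⟩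
  have hbound : ∀ n, E.banditLaw θ (A n) ≤
      ENNReal.ofReal (Real.exp (-y)) * E.banditLaw θ' (A n) := by
    intro n
    rw [banditLaw_eq_setLIntegral hθ hθ' (fun a ha => Function.update_of_ne ha _ _) (hAd n) (hAm n),
      ← lintegral_const_mul _ (by fun_prop), ← setLIntegral_one]
    refine setLIntegral_mono (by fun_prop) fun ω hω => ?_
    rw [← ENNReal.ofReal_mul (Real.exp_pos _).le, ← Real.exp_add, ← ENNReal.ofReal_one]
    refine ENNReal.ofReal_le_ofReal (Real.one_le_exp ?_)
    have h : y ≤ Z n ω := hω.1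
    rw [hθ'def, Function.update_self]
    simp only [hZ] at h
    linarith
  have hcover : {ω | ∃ n ∈ Finset.Icc 1 N, y ≤ Z n ω} ⊆ ⋃ n ∈ Finset.Icc 1 N, A n := by
    rintro ω ⟨n, hn, hy⟩
    have hex : ∃ n, 1 ≤ n ∧ y ≤ Z n ω := ⟨n, (Finset.mem_Icc.1 hn).1, hy⟩
    refine Set.mem_iUnion₂.2 ⟨Nat.find hex, Finset.mem_Icc.2 ⟨(Nat.find_spec hex).1,
      (Nat.find_min' hex ⟨(Finset.mem_Icc.1 hn).1, hy⟩).trans (Finset.mem_Icc.1 hn).2⟩,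
      (Nat.find_spec hex).2, fun k hk => ?_⟩
    have := Nat.find_min hex (Finset.mem_Ico.1 hk).2
    by_contra! hle
    exact this ⟨(Finset.mem_Ico.1 hk).1, hle⟩
  have hdisj : Set.PairwiseDisjoint (↑(Finset.Icc 1 N)) A := by
    intro m hm n hn hne
    refine Set.disjoint_left.2 fun ω h1 h2 => ?_
    rcases lt_or_gt_of_ne hne with h | h
    · exact absurd h1.1 (not_le.2 (h2.2 m (Finset.mem_Ico.2 ⟨(Finset.mem_Icc.1 hm).1, h⟩)))
    · exact absurd h2.1 (not_le.2 (h1.2 n (Finset.mem_Ico.2 ⟨(Finset.mem_Icc.1 hn).1, h⟩)))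
  calc E.banditLaw θ {ω | ∃ n ∈ Finset.Icc 1 N, y ≤ Z n ω}
      ≤ ∑ n ∈ Finset.Icc 1 N, E.banditLaw θ (A n) :=
        (measure_mono hcover).trans (measure_biUnion_finset_le _ _)
    _ ≤ ∑ n ∈ Finset.Icc 1 N, ENNReal.ofReal (Real.exp (-y)) * E.banditLaw θ' (A n) :=
        Finset.sum_le_sum fun n _ => hbound n
    _ = ENNReal.ofReal (Real.exp (-y)) * E.banditLaw θ' (⋃ n ∈ Finset.Icc 1 N, A n) := by
        rw [← Finset.mul_sum, measure_biUnion_finset hdisj fun n _ => hAm n]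
    _ ≤ ENNReal.ofReal (Real.exp (-y)) * 1 := by gcongr; exact prob_le_one
    _ = _ := mul_one _

/-! ### Deviations of the sample means -/

/-- Chernoff's inequality, with a tilt so small that the tilted mean stays below the deviation. -/
theorem exists_banditLaw_add_le_sampleMean_le (hreg : IsOpen E.naturalSpace) {θ : Fin K → ℝ}
    (hθ : ∀ a, θ a ∈ E.naturalSpace) (b : Fin K) {η : ℝ} (hη : 0 < η) :
    ∃ c : ℝ, 0 < c ∧ ∀ n : ℕ, 1 ≤ n →
      E.banditLaw θ {ω | E.mean (θ b) + η ≤ E.sampleMean b n ω} ≤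
        ENNReal.ofReal (Real.exp (-(c * n))) := by
  have hc := (hasDerivAt_mean hreg (hθ b)).continuousAt
  obtain ⟨θ₁, hlt, h₁, hm⟩ : ∃ θ₁, θ b < θ₁ ∧ (θ₁ ∈ E.naturalSpace ∧
      ∀ x ∈ Set.Icc (θ b) θ₁, E.mean x < E.mean (θ b) + η) := by
    have hev : ∀ᶠ x in 𝓝 (θ b), x ∈ E.naturalSpace ∧ E.mean x < E.mean (θ b) + η :=
      (hreg.eventually_mem (hθ b)).and (hc.eventually (gt_mem_nhds (by linarith)))
    obtain ⟨ε, hε, hball⟩ := Metric.eventually_nhds_iff.1 hev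
    have hin : ∀ x ∈ Set.Icc (θ b) (θ b + ε / 2), dist x (θ b) < ε := fun x hx => by
      rw [Real.dist_eq, abs_of_nonneg (by linarith [hx.1])]
      linarith [hx.2]
    exact ⟨θ b + ε / 2, by linarith, (hball (hin _ ⟨by linarith, le_rfl⟩)).1,
      fun x hx => (hball (hin x hx)).2⟩
  obtain ⟨c, hcm, hcd⟩ := exists_klNat_eq hreg (hθ b) h₁ hlt
  have hcη := hm c (Set.Ioo_subset_Icc_self hcm)
  refine ⟨(θ₁ - θ b) * (E.mean (θ b) + η) - (E.logMGF θ₁ - E.logMGF (θ b)), ?_, fun n hn => ?_⟩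
  · rw [hcd, ← mul_sub]
    exact mul_pos (by linarith) (by linarith)
  · refine (measure_mono ?_).trans (banditLaw_exists_le_log_likelihood hθ b h₁ n _)
    intro ω hω
    refine ⟨n, Finset.mem_Icc.2 ⟨hn, le_rfl⟩, ?_⟩
    rw [← natCast_mul_sampleMean b hn]
    have h : E.mean (θ b) + η ≤ E.sampleMean b n ω := hω
    have := mul_le_mul_of_nonneg_left h
      (mul_nonneg (by linarith : 0 ≤ θ₁ - θ b) (Nat.cast_nonneg (α := ℝ) n))
    linarith

theorem exists_banditLaw_sampleMean_le_sub_le (hreg : IsOpen E.naturalSpace) {θ : Fin K → ℝ}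
    (hθ : ∀ a, θ a ∈ E.naturalSpace) (b : Fin K) {η : ℝ} (hη : 0 < η) :
    ∃ c : ℝ, 0 < c ∧ ∀ n : ℕ, 1 ≤ n →
      E.banditLaw θ {ω | E.sampleMean b n ω ≤ E.mean (θ b) - η} ≤
        ENNReal.ofReal (Real.exp (-(c * n))) := by
  have hc := (hasDerivAt_mean hreg (hθ b)).continuousAt
  obtain ⟨θ₁, hlt, h₁, hm⟩ : ∃ θ₁, θ₁ < θ b ∧ (θ₁ ∈ E.naturalSpace ∧
      ∀ x ∈ Set.Icc θ₁ (θ b), E.mean (θ b) - η < E.mean x) := by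
    have hev : ∀ᶠ x in 𝓝 (θ b), x ∈ E.naturalSpace ∧ E.mean (θ b) - η < E.mean x :=
      (hreg.eventually_mem (hθ b)).and (hc.eventually (lt_mem_nhds (by linarith)))
    obtain ⟨ε, hε, hball⟩ := Metric.eventually_nhds_iff.1 hev
    have hin : ∀ x ∈ Set.Icc (θ b - ε / 2) (θ b), dist x (θ b) < ε := fun x hx => by
      rw [Real.dist_eq, abs_of_nonpos (by linarith [hx.2])]
      linarith [hx.1]
    exact ⟨θ b - ε / 2, by linarith, (hball (hin _ ⟨le_rfl, by linarith⟩)).1,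
      fun x hx => (hball (hin x hx)).2⟩
  obtain ⟨c, hcm, hcd⟩ := exists_klNat_eq hreg h₁ (hθ b) hlt
  have hcη := hm c (Set.Ioo_subset_Icc_self hcm)
  refine ⟨(θ₁ - θ b) * (E.mean (θ b) - η) - (E.logMGF θ₁ - E.logMGF (θ b)), ?_, fun n hn => ?_⟩
  · have : (θ₁ - θ b) * (E.mean (θ b) - η) - (E.logMGF θ₁ - E.logMGF (θ b)) =
      (θ b - θ₁) * (E.mean c - (E.mean (θ b) - η)) := by linarith
    rw [this]
    exact mul_pos (by linarith) (by linarith)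
  · refine (measure_mono ?_).trans (banditLaw_exists_le_log_likelihood hθ b h₁ n _)
    intro ω hω
    refine ⟨n, Finset.mem_Icc.2 ⟨hn, le_rfl⟩, ?_⟩
    rw [← natCast_mul_sampleMean b hn]
    have h : E.sampleMean b n ω ≤ E.mean (θ b) - η := hω
    have := mul_le_mul_of_nonneg_left h
      (mul_nonneg (by linarith : 0 ≤ θ b - θ₁) (Nat.cast_nonneg (α := ℝ) n))
    linarith

theorem exists_banditLaw_abs_sampleMean_sub_le (hreg : IsOpen E.naturalSpace) {θ : Fin K → ℝ}
    (hθ : ∀ a, θ a ∈ E.naturalSpace) {η : ℝ} (hη : 0 < η) :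
    ∃ c : ℝ, 0 < c ∧ ∀ b : Fin K, ∀ n : ℕ, 1 ≤ n →
      E.banditLaw θ {ω | η ≤ |E.sampleMean b n ω - E.mean (θ b)|} ≤
        ENNReal.ofReal (2 * Real.exp (-(c * n))) := by
  have hone : ∀ b : Fin K, ∃ c : ℝ, 0 < c ∧ ∀ n : ℕ, 1 ≤ n →
      E.banditLaw θ {ω | η ≤ |E.sampleMean b n ω - E.mean (θ b)|} ≤
        ENNReal.ofReal (2 * Real.exp (-(c * n))) := by
    intro b
    obtain ⟨c₁, hc₁, h₁⟩ := exists_banditLaw_add_le_sampleMean_le hreg hθ b hη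
    obtain ⟨c₂, hc₂, h₂⟩ := exists_banditLaw_sampleMean_le_sub_le hreg hθ b hη
    refine ⟨min c₁ c₂, lt_min hc₁ hc₂, fun n hn => ?_⟩
    have hsub : {ω | η ≤ |E.sampleMean b n ω - E.mean (θ b)|} ⊆
        {ω | E.mean (θ b) + η ≤ E.sampleMean b n ω} ∪
          {ω | E.sampleMean b n ω ≤ E.mean (θ b) - η} := by
      intro ω hω
      rcases le_abs'.1 (show η ≤ |_| from hω) with h | h
      · exact Or.inr (by rw [Set.mem_ofPred_eq]; linarith)
      · exact Or.inl (by rw [Set.mem_ofPred_eq]; linarith)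
    refine (measure_mono hsub).trans ((measure_union_le _ _).trans ?_)
    rw [two_mul, ENNReal.ofReal_add (Real.exp_pos _).le (Real.exp_pos _).le]
    refine add_le_add ((h₁ n hn).trans ?_) ((h₂ n hn).trans ?_)
    · gcongr
      exact min_le_left _ _
    · gcongr
      exact min_le_right _ _
  choose c hc h using hone
  rcases (Finset.univ : Finset (Fin K)).eq_empty_or_nonempty with he | hne
  · exact ⟨1, one_pos, fun b => absurd (Finset.mem_univ b) (by simp [he])⟩
  · refine ⟨Finset.univ.inf' hne c, (Finset.lt_inf'_iff hne).2 fun b _ => hc b, fun b n hn =>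
      (h b n hn).trans ?_⟩
    gcongr
    exact Finset.inf'_le _ (Finset.mem_univ b)

theorem ae_sampleMean_mem_closure (hreg : IsOpen E.naturalSpace) {θ : Fin K → ℝ}
    (hθ : ∀ a, θ a ∈ E.naturalSpace) (b : Fin K) :
    ∀ᵐ ω ∂E.banditLaw θ, ∀ n, 1 ≤ n → E.sampleMean b n ω ∈ closure E.meanSpace := by
  have i1 : ∀ i : Fin K × ℕ, IsProbabilityMeasure (E.law (θ i.1)) :=
    fun i => E.isProbabilityMeasure_law (hθ i.1)
  have hY : ∀ᵐ ω ∂E.banditLaw θ, ∀ k, E.Y b k ω ∈ closure E.meanSpace := by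
    refine ae_all_iff.2 fun k => ?_
    exact (measurePreserving_eval_infinitePi (fun i : Fin K × ℕ => E.law (θ i.1))
      (b, k)).quasiMeasurePreserving.ae (ae_mem_closure_meanSpace hreg (θ b))
  filter_upwards [hY] with ω hω n hn
  have hconv : Convex ℝ (closure E.meanSpace) := (ordConnected_meanSpace hreg).convex.closure
  have h := hconv.sum_mem (t := Finset.Icc 1 n) (w := fun _ => (n : ℝ)⁻¹)
    (z := fun k => E.Y b k ω) (fun _ _ => by positivity)
    (by simp [mul_inv_cancel₀ (show (n : ℝ) ≠ 0 by positivity)]) fun k _ => hω k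
  rw [sampleMean, div_eq_inv_mul, Finset.mul_sum]
  simpa using h

end ExpFamily

namespace ExpFamily

variable {𝒳 : Type*} [MeasurableSpace 𝒳] {E : ExpFamily 𝒳} {K : ℕ}

/-! ### The self-normalized deviation inequality -/

/-- The lower half of the deviation inequality for sample sizes between `n₀` and `n₁`. If `KL(·, μ)`
takes the value `x / n₁` below the mean `μ`, say at the natural parameter `θ₁`, then the deviation
forces the log-likelihood ratio of `θ₁` to be large, and otherwise the deviation cannot happen. -/
theorem exists_lower_deviation_event (hreg : IsOpen E.naturalSpace)
    (hmono : StrictMonoOn E.mean E.naturalSpace) {θ : Fin K → ℝ} (hθ : ∀ a, θ a ∈ E.naturalSpace)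
    (b : Fin K) (N : ℕ) {x n₀ n₁ : ℝ} (hx : 0 ≤ x) (hn₁ : 0 < n₁) :
    ∃ B : Set (Sample 𝒳 K), E.banditLaw θ B ≤ ENNReal.ofReal (Real.exp (-(x * (n₀ / n₁)))) ∧
      ∀ ω, ∀ n ∈ Finset.Icc 1 N, n₀ ≤ (n : ℝ) → (n : ℝ) ≤ n₁ →
        E.sampleMean b n ω ∈ closure E.meanSpace → E.sampleMean b n ω ≤ E.mean (θ b) →
        ENNReal.ofReal (x / n) < E.klExt (E.sampleMean b n ω) (E.mean (θ b)) → ω ∈ B := by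
  have hy0 : 0 ≤ x / n₁ := by positivity
  have hxn : ∀ n ∈ Finset.Icc 1 N, (n : ℝ) ≤ n₁ → x / n₁ ≤ x / n := fun n hn hle =>
    div_le_div_of_nonneg_left hx (by exact_mod_cast (Finset.mem_Icc.1 hn).1) hle
  by_cases hex : ∃ θ₁ ∈ E.naturalSpace, θ₁ ≤ θ b ∧ E.klNat θ₁ (θ b) = x / n₁
  · obtain ⟨θ₁, h₁, hle, hkl⟩ := hex
    refine ⟨_, (banditLaw_exists_le_log_likelihood hθ b h₁ N (n₀ * (x / n₁))).trans_eq
      (by congr 3; ring), fun ω n hn hn0 hn1 _ hYle hlt => ⟨n, hn, ?_⟩⟩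
    have hn1' : 1 ≤ n := (Finset.mem_Icc.1 hn).1
    have hY : E.sampleMean b n ω ≤ E.mean θ₁ := by
      by_contra! hcon
      obtain ⟨θ₂, h₂, he⟩ : E.sampleMean b n ω ∈ E.meanSpace :=
        (ordConnected_meanSpace hreg).out (mean_mem_meanSpace h₁) (mean_mem_meanSpace (hθ b))
          ⟨hcon.le, hYle⟩
      rw [← he] at hcon hYle hlt
      rw [klExt_mean hreg hmono h₂ (hθ b)] at hlt
      refine absurd hlt (not_lt.2 (ENNReal.ofReal_le_ofReal ?_))
      exact (klNat_le_of_le hreg hmono h₁ h₂ (hθ b) (hθ b) ((hmono.lt_iff_lt h₁ h₂).1 hcon).le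
        ((hmono.le_iff_le h₂ (hθ b)).1 hYle) le_rfl).trans (hkl.trans_le (hxn n hn hn1))
    rw [← natCast_mul_sampleMean b hn1']
    have h1 := mul_le_mul_of_nonneg_left hY
      (mul_nonneg (by linarith : 0 ≤ θ b - θ₁) (Nat.cast_nonneg (α := ℝ) n))
    have h2 := mul_le_mul_of_nonneg_right hn0 hy0
    have h3 : (n : ℝ) * (x / n₁) =
        n * ((θ₁ - θ b) * E.mean θ₁ - (E.logMGF θ₁ - E.logMGF (θ b))) := by rw [← hkl, klNat]
    linarith
  · refine ⟨∅, by simp, fun ω n hn _ hn1 hYc hYle hlt => absurd hlt (not_lt.2 ?_)⟩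
    refine (klExt_le_of_forall_le hreg hmono hYc (hθ b) hYle (c := x / n₁)
      fun θ₁ h₁ hle => ?_).trans (ENNReal.ofReal_le_ofReal (hxn n hn hn1))
    by_contra! hcon
    have hsub : Set.Icc θ₁ (θ b) ⊆ E.naturalSpace := E.ordConnected_naturalSpace.out h₁ (hθ b)
    obtain ⟨θ₂, h₂, he⟩ := intermediate_value_Icc' hle
      ((continuousOn_klNat_left hreg (θ b)).mono hsub)
      (show x / n₁ ∈ Set.Icc _ _ from ⟨by simpa only [klNat_self] using hy0, hcon.le⟩)
    exact hex ⟨θ₂, hsub h₂, h₂.2, he⟩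

/-- The upper half of the deviation inequality for sample sizes between `n₀` and `n₁`, the mirror
image of `exists_lower_deviation_event`. -/
theorem exists_upper_deviation_event (hreg : IsOpen E.naturalSpace)
    (hmono : StrictMonoOn E.mean E.naturalSpace) {θ : Fin K → ℝ} (hθ : ∀ a, θ a ∈ E.naturalSpace)
    (b : Fin K) (N : ℕ) {x n₀ n₁ : ℝ} (hx : 0 ≤ x) (hn₁ : 0 < n₁) :
    ∃ B : Set (Sample 𝒳 K), E.banditLaw θ B ≤ ENNReal.ofReal (Real.exp (-(x * (n₀ / n₁)))) ∧
      ∀ ω, ∀ n ∈ Finset.Icc 1 N, n₀ ≤ (n : ℝ) → (n : ℝ) ≤ n₁ →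
        E.sampleMean b n ω ∈ closure E.meanSpace → E.mean (θ b) ≤ E.sampleMean b n ω →
        ENNReal.ofReal (x / n) < E.klExt (E.sampleMean b n ω) (E.mean (θ b)) → ω ∈ B := by
  have hy0 : 0 ≤ x / n₁ := by positivity
  have hxn : ∀ n ∈ Finset.Icc 1 N, (n : ℝ) ≤ n₁ → x / n₁ ≤ x / n := fun n hn hle =>
    div_le_div_of_nonneg_left hx (by exact_mod_cast (Finset.mem_Icc.1 hn).1) hle
  by_cases hex : ∃ θ₁ ∈ E.naturalSpace, θ b ≤ θ₁ ∧ E.klNat θ₁ (θ b) = x / n₁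
  · obtain ⟨θ₁, h₁, hle, hkl⟩ := hex
    refine ⟨_, (banditLaw_exists_le_log_likelihood hθ b h₁ N (n₀ * (x / n₁))).trans_eq
      (by congr 3; ring), fun ω n hn hn0 hn1 _ hYle hlt => ⟨n, hn, ?_⟩⟩
    have hn1' : 1 ≤ n := (Finset.mem_Icc.1 hn).1
    have hY : E.mean θ₁ ≤ E.sampleMean b n ω := by
      by_contra! hcon
      obtain ⟨θ₂, h₂, he⟩ : E.sampleMean b n ω ∈ E.meanSpace :=
        (ordConnected_meanSpace hreg).out (mean_mem_meanSpace (hθ b)) (mean_mem_meanSpace h₁)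
          ⟨hYle, hcon.le⟩
      rw [← he] at hcon hYle hlt
      rw [klExt_mean hreg hmono h₂ (hθ b)] at hlt
      refine absurd hlt (not_lt.2 (ENNReal.ofReal_le_ofReal ?_))
      exact (klNat_le_of_ge hreg hmono h₁ h₂ (hθ b) (hθ b) ((hmono.lt_iff_lt h₂ h₁).1 hcon).le
        ((hmono.le_iff_le (hθ b) h₂).1 hYle) le_rfl).trans (hkl.trans_le (hxn n hn hn1))
    rw [← natCast_mul_sampleMean b hn1']
    have h1 := mul_le_mul_of_nonneg_left hY
      (mul_nonneg (by linarith : 0 ≤ θ₁ - θ b) (Nat.cast_nonneg (α := ℝ) n))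
    have h2 := mul_le_mul_of_nonneg_right hn0 hy0
    have h3 : (n : ℝ) * (x / n₁) =
        n * ((θ₁ - θ b) * E.mean θ₁ - (E.logMGF θ₁ - E.logMGF (θ b))) := by rw [← hkl, klNat]
    linarith
  · refine ⟨∅, by simp, fun ω n hn _ hn1 hYc hYle hlt => absurd hlt (not_lt.2 ?_)⟩
    refine (klExt_le_of_forall_ge hreg hmono hYc (hθ b) hYle (c := x / n₁)
      fun θ₁ h₁ hle => ?_).trans (ENNReal.ofReal_le_ofReal (hxn n hn hn1))
    by_contra! hcon
    have hsub : Set.Icc (θ b) θ₁ ⊆ E.naturalSpace := E.ordConnected_naturalSpace.out (hθ b) h₁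
    obtain ⟨θ₂, h₂, he⟩ := intermediate_value_Icc hle
      ((continuousOn_klNat_left hreg (θ b)).mono hsub)
      (show x / n₁ ∈ Set.Icc _ _ from ⟨by simpa only [klNat_self] using hy0, hcon.le⟩)
    exact hex ⟨θ₂, hsub h₂, h₂.1, he⟩

/-- The deviation inequality behind the upper confidence bounds, by peeling: the sample sizes up to
`N` are cut into slices whose end points have the ratio `x / (x - 1)`. -/
theorem banditLaw_exists_lt_klExt_le (hreg : IsOpen E.naturalSpace)
    (hmono : StrictMonoOn E.mean E.naturalSpace) {θ : Fin K → ℝ} (hθ : ∀ a, θ a ∈ E.naturalSpace)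
    (b : Fin K) (N : ℕ) {x : ℝ} (hx : 1 < x) :
    E.banditLaw θ {ω | ∃ n ∈ Finset.Icc 1 N,
        ENNReal.ofReal (x / n) < E.klExt (E.sampleMean b n ω) (E.mean (θ b))} ≤
      ENNReal.ofReal ((x * Real.log N + 1) * (2 * Real.exp (1 - x))) := by
  set β : ℝ := x / (x - 1) with hβ
  have hx1 : 0 < x - 1 := by linarith
  have hβ1 : 1 < β := (one_lt_div hx1).2 (by linarith)
  have hβ0 : 0 < β := by linarith
  have hlogβ : 1 / x ≤ Real.log β := by
    have := Real.one_sub_inv_le_log_of_pos hβ0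
    refine le_trans (le_of_eq ?_) this
    rw [hβ, inv_div]
    field_simp
    ring
  have hratio : ∀ k : ℕ, x * (β ^ k / β ^ (k + 1)) = x - 1 := by
    intro k
    have : β ^ k / β ^ (k + 1) = β⁻¹ := by
      rw [pow_succ]
      field_simp
    rw [this, hβ, inv_div]
    field_simp
  choose B₁ hB₁ hB₁' using fun k : ℕ => exists_lower_deviation_event hreg hmono hθ b N
    (x := x) (n₀ := β ^ k) (n₁ := β ^ (k + 1)) (by linarith) (by positivity)
  choose B₂ hB₂ hB₂' using fun k : ℕ => exists_upper_deviation_event hreg hmono hθ b N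
    (x := x) (n₀ := β ^ k) (n₁ := β ^ (k + 1)) (by linarith) (by positivity)
  set k₀ : ℕ := ⌊x * Real.log N⌋₊ with hk₀
  have hlogN : 0 ≤ Real.log N := Real.log_natCast_nonneg N
  have hsub : ∀ᵐ ω ∂E.banditLaw θ, ω ∈ {ω | ∃ n ∈ Finset.Icc 1 N,
      ENNReal.ofReal (x / n) < E.klExt (E.sampleMean b n ω) (E.mean (θ b))} →
      ω ∈ ⋃ k ∈ Finset.range (k₀ + 1), (B₁ k ∪ B₂ k) := by
    filter_upwards [ae_sampleMean_mem_closure hreg hθ b] with ω hω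
    rintro ⟨n, hn, hlt⟩
    have hn' := Finset.mem_Icc.1 hn
    obtain ⟨k, hk1, hk2⟩ := exists_nat_pow_near (show (1 : ℝ) ≤ n by exact_mod_cast hn'.1) hβ1
    have hk : k ∈ Finset.range (k₀ + 1) := by
      refine Finset.mem_range.2 (Nat.lt_succ_of_le (Nat.le_floor ?_))
      have h1 : (k : ℝ) * Real.log β ≤ Real.log N := by
        rw [← Real.log_pow]
        exact Real.log_le_log (by positivity) (hk1.trans (by exact_mod_cast hn'.2))
      have h2 : (k : ℝ) * (1 / x) ≤ Real.log N :=
        (mul_le_mul_of_nonneg_left hlogβ (Nat.cast_nonneg k)).trans h1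
      rw [mul_one_div, div_le_iff₀ (by linarith)] at h2
      linarith
    refine Set.mem_iUnion₂.2 ⟨k, hk, ?_⟩
    rcases le_total (E.sampleMean b n ω) (E.mean (θ b)) with hle | hle
    · exact Or.inl (hB₁' k ω n hn hk1 hk2.le (hω n hn'.1) hle hlt)
    · exact Or.inr (hB₂' k ω n hn hk1 hk2.le (hω n hn'.1) hle hlt)
  calc _ ≤ E.banditLaw θ (⋃ k ∈ Finset.range (k₀ + 1), (B₁ k ∪ B₂ k)) := measure_mono_ae hsub
    _ ≤ ∑ k ∈ Finset.range (k₀ + 1), ENNReal.ofReal (2 * Real.exp (1 - x)) := by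
        refine (measure_biUnion_finset_le _ _).trans (Finset.sum_le_sum fun k _ => ?_)
        refine (measure_union_le _ _).trans ?_
        rw [two_mul, ENNReal.ofReal_add (Real.exp_pos _).le (Real.exp_pos _).le]
        have h1 := hB₁ k
        have h2 := hB₂ k
        rw [hratio k, neg_sub] at h1 h2
        exact add_le_add h1 h2
    _ = ENNReal.ofReal ((k₀ + 1 : ℕ) * (2 * Real.exp (1 - x))) := by
        rw [Finset.sum_const, Finset.card_range, nsmul_eq_mul,
          ENNReal.ofReal_mul (Nat.cast_nonneg _), ENNReal.ofReal_natCast]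
    _ ≤ _ := by
        refine ENNReal.ofReal_le_ofReal (mul_le_mul_of_nonneg_right ?_ (by positivity))
        push_cast
        gcongr
        exact Nat.floor_le (by positivity)

end ExpFamily

/-! ### The gap of a set of arms to the best set of arms -/

/-- `v m` is the `M`-th largest entry of `v`. -/
structure IsThreshold {K : ℕ} (M : ℕ) (v : Fin K → ℝ) (m : Fin K) : Prop where
  card_gt : (Finset.univ.filter fun a => v m < v a).card < M
  card_ge : M ≤ (Finset.univ.filter fun a => v m ≤ v a).card

theorem exists_isThreshold {K M : ℕ} (hM : 1 ≤ M) (hMK : M ≤ K) (v : Fin K → ℝ) :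
    ∃ m, IsThreshold M v m := by
  classical
  have : Nonempty (Fin K) := ⟨⟨0, by omega⟩⟩
  set S := Finset.univ.filter fun c : Fin K => M ≤ (Finset.univ.filter fun a => v c ≤ v a).card
    with hS
  have hne : S.Nonempty := by
    obtain ⟨c, -, hc⟩ := Finset.exists_min_image Finset.univ v Finset.univ_nonempty
    refine ⟨c, Finset.mem_filter.2 ⟨Finset.mem_univ _, ?_⟩⟩
    rw [Finset.filter_true_of_mem fun a _ => hc a (Finset.mem_univ a), Finset.card_univ,
      Fintype.card_fin]
    exact hMK
  obtain ⟨m, hm, hmax⟩ := Finset.exists_max_image S v hne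
  refine ⟨m, ?_, (Finset.mem_filter.1 hm).2⟩
  by_contra! hle
  have hne' : (Finset.univ.filter fun a => v m < v a).Nonempty :=
    Finset.card_pos.1 (by omega)
  obtain ⟨c, hc, hmin⟩ := Finset.exists_min_image _ v hne'
  have hc' := (Finset.mem_filter.1 hc).2
  refine absurd (hmax c (Finset.mem_filter.2 ⟨Finset.mem_univ _, hle.trans
    (Finset.card_le_card fun a ha => ?_)⟩)) (not_le.2 hc')
  exact Finset.mem_filter.2 ⟨Finset.mem_univ _, hmin a ha⟩

/-- The loss of the set `A` of arms with respect to the best `M` arms, see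
`topSum_sub_sum_eq_gap`. -/
def gap {K : ℕ} (v : Fin K → ℝ) (m : Fin K) (A : Finset (Fin K)) : ℝ :=
  ∑ a ∈ Finset.univ.filter (fun a => v m < v a), (v a - v m) * (if a ∈ A then 0 else 1) +
    ∑ b ∈ Finset.univ.filter (fun b => v b < v m), (v m - v b) * (if b ∈ A then 1 else 0)

theorem gap_nonneg {K : ℕ} (v : Fin K → ℝ) (m : Fin K) (A : Finset (Fin K)) : 0 ≤ gap v m A := by
  refine add_nonneg (Finset.sum_nonneg fun a ha => mul_nonneg ?_ ?_)
    (Finset.sum_nonneg fun a ha => mul_nonneg ?_ ?_)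
  · linarith [(Finset.mem_filter.1 ha).2]
  · split_ifs <;> norm_num
  · linarith [(Finset.mem_filter.1 ha).2]
  · split_ifs <;> norm_num

theorem sum_add_gap {K M : ℕ} (v : Fin K → ℝ) (m : Fin K) {A : Finset (Fin K)} (hA : A.card = M) :
    ∑ a ∈ A, v a + gap v m A =
      M * v m + ∑ a ∈ Finset.univ.filter (fun a => v m < v a), (v a - v m) := by
  have h1 : ∑ a ∈ A, v a = M * v m + ∑ a, (if a ∈ A then v a - v m else 0) := by
    rw [Finset.sum_ite_mem, Finset.univ_inter, Finset.sum_sub_distrib, Finset.sum_const, hA,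
      nsmul_eq_mul]
    ring
  have h2 : ∀ a, (if a ∈ A then v a - v m else 0) =
      (if v m < v a then v a - v m else 0) -
        (if v m < v a then (v a - v m) * (if a ∈ A then 0 else 1) else 0) -
        (if v a < v m then (v m - v a) * (if a ∈ A then 1 else 0) else 0) := by
    intro a
    rcases lt_trichotomy (v a) (v m) with h | h | h
    · rw [if_neg h.not_gt, if_neg h.not_gt, if_pos h]
      split_ifs <;> ring
    · simp [h]
    · rw [if_pos h, if_pos h, if_neg h.not_gt]
      split_ifs <;> ring
  rw [h1, Finset.sum_congr rfl fun a _ => h2 a, Finset.sum_sub_distrib, Finset.sum_sub_distrib, gap]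
  simp only [Finset.sum_filter]
  ring

theorem topSum_sub_sum_eq_gap {K M : ℕ} {v : Fin K → ℝ} {m : Fin K} (hm : IsThreshold M v m)
    {A : Finset (Fin K)} (hA : A.card = M) : topSum M v - ∑ a ∈ A, v a = gap v m A := by
  have hsub : (Finset.univ.filter fun a => v m < v a) ⊆ Finset.univ.filter fun a => v m ≤ v a :=
    fun a ha => Finset.mem_filter.2 ⟨Finset.mem_univ _, (Finset.mem_filter.1 ha).2.le⟩
  obtain ⟨B, hB1, hB2, hBc⟩ := Finset.exists_subsuperset_card_eq hsub hm.card_gt.le hm.card_ge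
  have hB0 : gap v m B = 0 := by
    rw [gap, Finset.sum_eq_zero fun a ha => ?_, Finset.sum_eq_zero fun b hb => ?_, add_zero]
    · have : b ∉ B := fun h =>
        absurd (Finset.mem_filter.1 hb).2 (not_lt.2 (Finset.mem_filter.1 (hB2 h)).2)
      rw [if_neg this, mul_zero]
    · rw [if_pos (hB1 ha), mul_zero]
  have hBs := sum_add_gap v m hBc
  have hgr : IsGreatest ((fun A : Finset (Fin K) => ∑ a ∈ A, v a) '' {A | A.card = M})
      (∑ a ∈ B, v a) := by
    refine ⟨⟨B, hBc, rfl⟩, ?_⟩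
    rintro _ ⟨C, hC, rfl⟩
    have := sum_add_gap v m (show C.card = M from hC)
    have := gap_nonneg v m C
    simp only
    linarith
  have := sum_add_gap v m hA
  rw [topSum, hgr.csSup_eq]
  linarith

/-! ### Events that do not depend on an observation -/

/-- An event that depends only on coordinates in `J` is independent of a coordinate outside `J`. -/
theorem integral_indicator_infinitePi {ι : Type*} {X : ι → Type*} [∀ i, MeasurableSpace (X i)]
    {P : ∀ i, Measure (X i)} [∀ i, IsProbabilityMeasure (P i)] {J : Set ι} {A : Set (∀ i, X i)}
    (hA : DependsOnCoords J A) (hAm : MeasurableSet A) {j : ι} (hj : j ∉ J) {u : X j → ℝ}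
    (hu : Measurable u) :
    ∫ ω, A.indicator (fun ω => u (ω j)) ω ∂(Measure.infinitePi P) =
      (Measure.infinitePi P).real A * ∫ x, u x ∂(P j) := by
  obtain ⟨A', hA', rfl⟩ := hA.exists_preimage hAm
  have hind : iIndepFun (fun i (ω : ∀ i, X i) => ω i) (Measure.infinitePi P) :=
    iIndepFun_infinitePi (X := fun i (x : X i) => x) fun i => measurable_id
  have hle : ∀ i, MeasurableSpace.comap (fun ω : ∀ i, X i => ω i) inferInstance ≤
      MeasurableSpace.pi := fun i => (measurable_pi_apply i).comap_le
  have h1 := indep_iSup_of_disjoint hle hind.iIndep (S := J) (T := {j})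
    (Set.disjoint_singleton_right.2 hj)
  set m₁ : MeasurableSpace (∀ i, X i) :=
    ⨆ i ∈ J, MeasurableSpace.comap (fun ω : ∀ i, X i => ω i) inferInstance with hm₁
  have hr : Measurable[m₁] (J.domRestrict : (∀ i, X i) → ∀ i : J, X i) := by
    refine measurable_pi_iff.2 fun i => ?_
    refine Measurable.mono (comap_measurable (fun ω : ∀ i, X i => ω i.1)) ?_ le_rfl
    exact le_iSup₂ (f := fun i (_ : i ∈ J) =>
      MeasurableSpace.comap (fun ω : ∀ i, X i => ω i) inferInstance) i.1 i.2
  have hAm₁ : MeasurableSet[m₁] (J.domRestrict ⁻¹' A') := hr hA'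
  have hf : Measurable[m₁] ((J.domRestrict ⁻¹' A').indicator fun _ => (1 : ℝ)) :=
    measurable_const.indicator hAm₁
  have hif : IndepFun ((J.domRestrict ⁻¹' A').indicator fun _ => (1 : ℝ)) (fun ω => u (ω j))
      (Measure.infinitePi P) := by
    rw [IndepFun_iff_Indep]
    refine indep_of_indep_of_le h1 hf.comap_le ?_
    have : Measurable[⨆ i ∈ ({j} : Set ι), MeasurableSpace.comap (fun ω : ∀ i, X i => ω i)
        inferInstance] fun ω : ∀ i, X i => u (ω j) := by
      refine hu.comp (Measurable.mono (comap_measurable (fun ω : ∀ i, X i => ω j)) ?_ le_rfl)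
      exact le_iSup₂ (f := fun i (_ : i ∈ ({j} : Set ι)) =>
        MeasurableSpace.comap (fun ω : ∀ i, X i => ω i) inferInstance) j rfl
    exact this.comap_le
  have hmul := hif.integral_fun_mul_eq_mul_integral
    ((measurable_const.indicator hAm).aestronglyMeasurable)
    ((hu.comp (measurable_pi_apply j)).aestronglyMeasurable)
  have heq : (fun ω : ∀ i, X i => (J.domRestrict ⁻¹' A').indicator (fun ω => u (ω j)) ω) =
      fun ω => (J.domRestrict ⁻¹' A').indicator (fun _ => (1 : ℝ)) ω * u (ω j) := by
    funext ω
    by_cases h : ω ∈ J.domRestrict ⁻¹' A'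
    · rw [Set.indicator_of_mem h, Set.indicator_of_mem h, one_mul]
    · rw [Set.indicator_of_notMem h, Set.indicator_of_notMem h, zero_mul]
  rw [heq, hmul, integral_indicator_const _ hAm, smul_eq_mul, mul_one]
  congr 1
  conv_rhs => rw [← Measure.infinitePi_map_eval P j,
    integral_map (measurable_pi_apply j).aemeasurable hu.aestronglyMeasurable]

/-! ### Counting plays -/

section Plays

variable {Ω : Type*} {K : ℕ} {φ : ℕ → Ω → Finset (Fin K)}

theorem plays_succ (a : Fin K) (t : ℕ) (ω : Ω) :
    plays φ a (t + 1) ω = plays φ a t ω + if a ∈ φ (t + 1) ω then 1 else 0 := by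
  have h : Finset.Icc 1 (t + 1) = insert (t + 1) (Finset.Icc 1 t) := by
    ext s; simp only [Finset.mem_insert, Finset.mem_Icc]; omega
  rw [plays, plays, h, Finset.filter_insert]
  split_ifs
  · rw [Finset.card_insert_of_notMem (by simp)]
  · rfl

theorem plays_mono (a : Fin K) (ω : Ω) : Monotone fun t => plays φ a t ω :=
  monotone_nat_of_le_succ fun t => by rw [plays_succ]; omega

theorem plays_le (a : Fin K) (t : ℕ) (ω : Ω) : plays φ a t ω ≤ t := by
  refine (Finset.card_filter_le _ _).trans ?_
  simp

theorem plays_eq_sum (a : Fin K) (t : ℕ) (ω : Ω) :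
    (plays φ a t ω : ℝ) = ∑ s ∈ Finset.Icc 1 t, if a ∈ φ s ω then 1 else 0 := by
  rw [plays, Finset.card_filter]
  push_cast
  rfl

end Plays

namespace ExpFamily

variable {𝒳 : Type*} [MeasurableSpace 𝒳] {E : ExpFamily 𝒳} {K : ℕ}

/-! ### Allocation rules -/

variable {M : ℕ} {φ : ℕ → Sample 𝒳 K → Finset (Fin K)}

theorem Z_eq_sum (t : ℕ) (ht : 1 ≤ t) (a : Fin K) (ω : Sample 𝒳 K) :
    E.Z φ t a ω = ∑ n ∈ Finset.Icc 1 t,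
      {ω | a ∈ φ t ω ∧ plays φ a t ω = n}.indicator (fun ω => E.f (ω (a, n))) ω := by
  by_cases ha : a ∈ φ t ω
  · have hmem : plays φ a t ω ∈ Finset.Icc 1 t := by
      refine Finset.mem_Icc.2 ⟨?_, plays_le a t ω⟩
      obtain ⟨s, rfl⟩ : ∃ s, t = s + 1 := ⟨t - 1, by omega⟩
      rw [plays_succ, if_pos ha]
      omega
    rw [Finset.sum_eq_single (plays φ a t ω)]
    · rw [Set.indicator_apply, if_pos (by exact ⟨ha, rfl⟩), Z, if_pos ha, Y]
    · intro n _ hne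
      exact Set.indicator_of_notMem (fun h => hne h.2.symm) _
    · exact fun h => absurd hmem h
  · rw [Z, if_neg ha, Finset.sum_eq_zero]
    exact fun n _ => Set.indicator_of_notMem (fun h => ha h.1) _

theorem measurableSet_mem_rule {t : ℕ} (a : Fin K) (h : ∀ A, MeasurableSet {ω | φ t ω = A}) :
    MeasurableSet {ω | a ∈ φ t ω} := by
  have : {ω | a ∈ φ t ω} = ⋃ A ∈ Finset.univ.filter (fun A : Finset (Fin K) => a ∈ A),
      {ω | φ t ω = A} := by
    ext ω; simp
  rw [this]
  exact Finset.measurableSet_biUnion _ fun A _ => h A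

theorem measurable_plays {t : ℕ} (a : Fin K)
    (h : ∀ s ∈ Finset.Icc 1 t, ∀ A, MeasurableSet {ω | φ s ω = A}) : Measurable (plays φ a t) := by
  have heq : plays φ a t = fun ω => ∑ s ∈ Finset.Icc 1 t, if a ∈ φ s ω then 1 else 0 := by
    funext ω
    rw [plays, Finset.card_filter]
  rw [heq]
  exact Finset.measurable_fun_sum _ fun s hs =>
    Measurable.ite (measurableSet_mem_rule a (h s hs)) measurable_const measurable_const

theorem history_le (hφ : E.IsAllocationRule M φ) (t : ℕ) : E.history φ t ≤ MeasurableSpace.pi := by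
  induction t using Nat.strong_induction_on with
  | _ t ih =>
    refine iSup₂_le fun s hs => ?_
    have hs' := Finset.mem_Ico.1 hs
    have hA : ∀ r ∈ Finset.Icc 1 s, ∀ A, MeasurableSet {ω | φ r ω = A} := by
      intro r hr A
      have hr' := Finset.mem_Icc.1 hr
      exact ih r (by omega) _ ((hφ r hr'.1).2 A)
    have hAs := hA s (Finset.mem_Icc.2 ⟨hs'.1, le_rfl⟩)
    refine sup_le ?_ ?_
    · rintro _ ⟨B, -, rfl⟩
      have : φ s ⁻¹' B = ⋃ A ∈ B, {ω | φ s ω = A} := by ext ω; simp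
      rw [this]
      exact MeasurableSet.biUnion (Set.to_countable B) fun A _ => hAs A
    · refine Measurable.comap_le (measurable_pi_iff.2 fun a => ?_)
      have heq : (fun ω => E.Z φ s a ω) = fun ω => ∑ n ∈ Finset.Icc 1 s,
          {ω | a ∈ φ s ω ∧ plays φ a s ω = n}.indicator (fun ω => E.f (ω (a, n))) ω := by
        funext ω
        exact Z_eq_sum s hs'.1 a ω
      rw [heq]
      refine Finset.measurable_fun_sum _ fun n _ => ?_
      refine (E.measurable_f.comp (measurable_pi_apply _)).indicator ?_
      exact (measurableSet_mem_rule a hAs).inter (measurable_plays a hA (measurableSet_singleton n))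

theorem measurableSet_rule_eq (hφ : E.IsAllocationRule M φ) {t : ℕ} (ht : 1 ≤ t)
    (A : Finset (Fin K)) : MeasurableSet {ω | φ t ω = A} :=
  history_le hφ t _ ((hφ t ht).2 A)

theorem measurableSet_mem (hφ : E.IsAllocationRule M φ) {t : ℕ} (ht : 1 ≤ t) (a : Fin K) :
    MeasurableSet {ω | a ∈ φ t ω} :=
  measurableSet_mem_rule a (measurableSet_rule_eq hφ ht)

theorem measurable_plays_of_rule (hφ : E.IsAllocationRule M φ) (a : Fin K) (t : ℕ) :
    Measurable (plays φ a t) :=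
  measurable_plays a fun _ hs A => measurableSet_rule_eq hφ (Finset.mem_Icc.1 hs).1 A

/-- Events of the history do not distinguish between sample points with the same plays and the same
observed rewards. -/
theorem mem_iff_of_history {t : ℕ} {A : Set (Sample 𝒳 K)} (hA : MeasurableSet[E.history φ t] A)
    {ω ω' : Sample 𝒳 K}
    (h : ∀ s ∈ Finset.Ico 1 t, φ s ω = φ s ω' ∧ ∀ a, E.Z φ s a ω = E.Z φ s a ω') :
    ω ∈ A ↔ ω' ∈ A := by
  let m₀ : MeasurableSpace (Sample 𝒳 K) :=
    { MeasurableSet' := fun A => ω ∈ A ↔ ω' ∈ A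
      measurableSet_empty := by simp
      measurableSet_compl := fun A hA => not_congr hA
      measurableSet_iUnion := fun A hA => by
        simp only [Set.mem_iUnion]
        exact exists_congr hA }
  have hle : E.history φ t ≤ m₀ := by
    refine iSup₂_le fun s hs => sup_le ?_ ?_
    · rintro _ ⟨B, -, rfl⟩
      change φ s ω ∈ B ↔ φ s ω' ∈ B
      rw [(h s hs).1]
    · rintro _ ⟨B, -, rfl⟩
      change (fun a => E.Z φ s a ω) ∈ B ↔ (fun a => E.Z φ s a ω') ∈ B
      rw [funext (h s hs).2]
  exact hle A hA

/-- Up to and including the round after `T`, the plays depend only on the observations that were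
made in the rounds up to `T`. -/
theorem rule_eq_of_agree (hφ : E.IsAllocationRule M φ) {b : Fin K} {n T : ℕ} {ω ω' : Sample 𝒳 K}
    (hω : ∀ i ∈ coordsUpTo b n, ω i = ω' i) (hn : plays φ b T ω ≤ n) :
    ∀ s, 1 ≤ s → s ≤ T + 1 → φ s ω = φ s ω' := by
  have key : ∀ s, s ≤ T → ∀ r ∈ Finset.Ico 1 (s + 1),
      φ r ω = φ r ω' ∧ ∀ a, E.Z φ r a ω = E.Z φ r a ω' := by
    intro s
    induction s with
    | zero => intro _ r hr; simp at hr
    | succ s ih =>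
      intro hs r hr
      have ih' := ih (by omega)
      rcases Nat.lt_or_ge r (s + 1) with hlt | hge
      · exact ih' r (Finset.mem_Ico.2 ⟨(Finset.mem_Ico.1 hr).1, hlt⟩)
      · have hrs : r = s + 1 := by have := (Finset.mem_Ico.1 hr).2; omega
        subst hrs
        have hφe : φ (s + 1) ω = φ (s + 1) ω' :=
          ((mem_iff_of_history ((hφ (s + 1) (by omega)).2 (φ (s + 1) ω)) ih').1 rfl).symm
        refine ⟨hφe, fun a => ?_⟩
        have hpl : plays φ a (s + 1) ω = plays φ a (s + 1) ω' := by
          rw [plays, plays]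
          congr 1
          refine Finset.filter_congr fun r hr => ?_
          have hr' := Finset.mem_Icc.1 hr
          rcases Nat.lt_or_ge r (s + 1) with hlt | hge
          · rw [(ih' r (Finset.mem_Ico.2 ⟨hr'.1, hlt⟩)).1]
          · rw [show r = s + 1 by omega, hφe]
        rw [Z, Z, ← hφe]
        split_ifs with ha
        · rw [Y, Y, ← hpl, hω (a, plays φ a (s + 1) ω)]
          intro hab
          have hab' : a = b := hab
          refine Finset.mem_Icc.2 ⟨?_, ?_⟩
          · rw [plays_succ, if_pos ha]
            omega
          · rw [hab']
            exact (plays_mono b ω hs).trans hn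
        · rfl
  intro s hs1 hs2
  have hk := key (s - 1) (by omega)
  rw [show s - 1 + 1 = s by omega] at hk
  exact ((mem_iff_of_history ((hφ s hs1).2 (φ s ω)) hk).1 rfl).symm

theorem plays_eq_of_agree (hφ : E.IsAllocationRule M φ) {b : Fin K} {n T : ℕ} {ω ω' : Sample 𝒳 K}
    (hω : ∀ i ∈ coordsUpTo b n, ω i = ω' i) (hn : plays φ b T ω ≤ n) (a : Fin K) {t : ℕ}
    (ht : t ≤ T + 1) : plays φ a t ω = plays φ a t ω' := by
  rw [plays, plays]
  congr 1
  refine Finset.filter_congr fun s hs => ?_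
  have hs' := Finset.mem_Icc.1 hs
  rw [rule_eq_of_agree hφ hω hn s hs'.1 (by omega)]

theorem dependsOnCoords_plays_le (hφ : E.IsAllocationRule M φ) (b : Fin K) (n T : ℕ) :
    DependsOnCoords (coordsUpTo b n) {ω | plays φ b T ω ≤ n} := by
  intro ω ω' h hω
  rw [Set.mem_ofPred_eq, ← plays_eq_of_agree hφ h hω b (Nat.le_succ T)]
  exact hω

theorem dependsOnCoords_nth_play (hφ : E.IsAllocationRule M φ) (a : Fin K) {n t : ℕ} (hn : 1 ≤ n)
    (ht : 1 ≤ t) :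
    DependsOnCoords (coordsUpTo a (n - 1)) {ω | a ∈ φ t ω ∧ plays φ a t ω = n} := by
  rintro ω ω' h ⟨hω, hωn⟩
  obtain ⟨s, rfl⟩ : ∃ s, t = s + 1 := ⟨t - 1, by omega⟩
  have hle : plays φ a s ω ≤ n - 1 := by
    rw [plays_succ, if_pos hω] at hωn
    omega
  exact ⟨by rw [← rule_eq_of_agree hφ h hle (s + 1) (by omega) le_rfl]; exact hω, by
    rw [← plays_eq_of_agree hφ h hle a le_rfl]; exact hωn⟩

variable {θ : Fin K → ℝ}

theorem integrable_eval (hreg : IsOpen E.naturalSpace) (hθ : ∀ a, θ a ∈ E.naturalSpace)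
    (a : Fin K) (n : ℕ) : Integrable (fun ω : Sample 𝒳 K => E.f (ω (a, n))) (E.banditLaw θ) := by
  have i1 : ∀ i : Fin K × ℕ, IsProbabilityMeasure (E.law (θ i.1)) :=
    fun i => E.isProbabilityMeasure_law (hθ i.1)
  exact (measurePreserving_eval_infinitePi (fun i : Fin K × ℕ => E.law (θ i.1))
    (a, n)).integrable_comp_of_integrable (integrable_f_law hreg (hθ a))

theorem measurableSet_nth_play (hφ : E.IsAllocationRule M φ) (a : Fin K) {t : ℕ} (ht : 1 ≤ t)
    (n : ℕ) : MeasurableSet {ω | a ∈ φ t ω ∧ plays φ a t ω = n} :=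
  (measurableSet_mem hφ ht a).inter (measurable_plays_of_rule hφ a t (measurableSet_singleton n))

theorem integrable_Z (hreg : IsOpen E.naturalSpace) (hθ : ∀ a, θ a ∈ E.naturalSpace)
    (hφ : E.IsAllocationRule M φ) {t : ℕ} (ht : 1 ≤ t) (a : Fin K) :
    Integrable (E.Z φ t a) (E.banditLaw θ) := by
  have heq : E.Z φ t a = fun ω => ∑ n ∈ Finset.Icc 1 t,
      {ω | a ∈ φ t ω ∧ plays φ a t ω = n}.indicator (fun ω => E.f (ω (a, n))) ω := by
    funext ω
    exact Z_eq_sum t ht a ω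
  rw [heq]
  exact integrable_finsetSum _ fun n _ =>
    (integrable_eval hreg hθ a n).indicator (measurableSet_nth_play hφ a ht n)

/-- Wald's identity for one round: whether arm `a` is played is decided before its next reward is
drawn. -/
theorem integral_Z (hreg : IsOpen E.naturalSpace) (hθ : ∀ a, θ a ∈ E.naturalSpace)
    (hφ : E.IsAllocationRule M φ) {t : ℕ} (ht : 1 ≤ t) (a : Fin K) :
    ∫ ω, E.Z φ t a ω ∂(E.banditLaw θ) =
      (E.banditLaw θ).real {ω | a ∈ φ t ω} * E.mean (θ a) := by
  have := isProbabilityMeasure_banditLaw hθ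
  have i1 : ∀ i : Fin K × ℕ, IsProbabilityMeasure (E.law (θ i.1)) :=
    fun i => E.isProbabilityMeasure_law (hθ i.1)
  rw [integral_congr_ae (Eventually.of_forall (Z_eq_sum t ht a)), integral_finsetSum _ fun n _ =>
    (integrable_eval hreg hθ a n).indicator (measurableSet_nth_play hφ a ht n)]
  have h1 : ∀ n ∈ Finset.Icc 1 t,
      ∫ ω, {ω | a ∈ φ t ω ∧ plays φ a t ω = n}.indicator (fun ω => E.f (ω (a, n))) ω
        ∂(E.banditLaw θ) =
      (E.banditLaw θ).real {ω | a ∈ φ t ω ∧ plays φ a t ω = n} * E.mean (θ a) := by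
    intro n hn
    have hn1 := (Finset.mem_Icc.1 hn).1
    have hJ : ((a, n) : Fin K × ℕ) ∉ coordsUpTo a (n - 1) := fun h => by
      have := (Finset.mem_Icc.1 (h rfl)).2
      simp only at this
      omega
    rw [mean_eq_integral_law]
    exact integral_indicator_infinitePi (P := fun i : Fin K × ℕ => E.law (θ i.1))
      (dependsOnCoords_nth_play hφ a hn1 ht) (measurableSet_nth_play hφ a ht n) hJ E.measurable_f
  rw [Finset.sum_congr rfl h1, ← Finset.sum_mul]
  congr 1
  have hU : {ω | a ∈ φ t ω} = ⋃ n ∈ Finset.Icc 1 t, {ω | a ∈ φ t ω ∧ plays φ a t ω = n} := by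
    ext ω
    simp only [Set.mem_iUnion, Set.mem_ofPred_eq, exists_prop, Finset.mem_Icc]
    constructor
    · intro ha
      refine ⟨_, ⟨?_, plays_le a t ω⟩, ha, rfl⟩
      obtain ⟨s, rfl⟩ : ∃ s, t = s + 1 := ⟨t - 1, by omega⟩
      rw [plays_succ, if_pos ha]
      omega
    · rintro ⟨n, -, h, -⟩
      exact h
  rw [hU, measureReal_biUnion_finset]
  · intro m _ n _ hne
    exact Set.disjoint_left.2 fun ω h1 h2 => hne (h1.2.symm.trans h2.2)
  · exact fun n _ => measurableSet_nth_play hφ a ht n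

theorem integrable_plays (hθ : ∀ a, θ a ∈ E.naturalSpace) (hφ : E.IsAllocationRule M φ)
    (a : Fin K) (t : ℕ) : Integrable (fun ω => (plays φ a t ω : ℝ)) (E.banditLaw θ) := by
  have := isProbabilityMeasure_banditLaw hθ
  refine Integrable.of_bound (C := t)
    (measurable_from_top.comp (measurable_plays_of_rule hφ a t)).aestronglyMeasurable
    (Eventually.of_forall fun ω => ?_)
  rw [Real.norm_of_nonneg (Nat.cast_nonneg _)]
  exact_mod_cast plays_le a t ω

/-- The regret is the expected sum of the losses of the sets of arms that are played. -/
theorem regret_eq_integral (hreg : IsOpen E.naturalSpace) (hθ : ∀ a, θ a ∈ E.naturalSpace)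
    (hφ : E.IsAllocationRule M φ) {m : Fin K} (hm : IsThreshold M (fun a => E.mean (θ a)) m)
    (T : ℕ) : E.regret M θ φ T =
      ∑ t ∈ Finset.Icc 1 T, ∫ ω, gap (fun a => E.mean (θ a)) m (φ t ω) ∂(E.banditLaw θ) := by
  have := isProbabilityMeasure_banditLaw hθ
  have h1 : ∀ t ∈ Finset.Icc 1 T, ∫ ω, gap (fun a => E.mean (θ a)) m (φ t ω) ∂(E.banditLaw θ) =
      topSum M (fun a => E.mean (θ a)) - ∑ a, ∫ ω, E.Z φ t a ω ∂(E.banditLaw θ) := by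
    intro t ht
    have ht1 := (Finset.mem_Icc.1 ht).1
    have hgap : ∀ ω, gap (fun a => E.mean (θ a)) m (φ t ω) =
        topSum M (fun a => E.mean (θ a)) -
          ∑ a, {ω | a ∈ φ t ω}.indicator (fun _ => E.mean (θ a)) ω := by
      intro ω
      rw [← topSum_sub_sum_eq_gap hm ((hφ t ht1).1 ω)]
      congr 1
      simp only [Set.indicator_apply, Set.mem_ofPred_eq]
      rw [Finset.sum_ite_mem, Finset.univ_inter]
    have hint : ∀ a, Integrable ({ω | a ∈ φ t ω}.indicator (fun _ => E.mean (θ a)))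
        (E.banditLaw θ) := fun a => (integrable_const _).indicator (measurableSet_mem hφ ht1 a)
    rw [integral_congr_ae (Eventually.of_forall hgap),
      integral_sub (integrable_const _) (integrable_finsetSum _ fun a _ => hint a),
      integral_finsetSum _ fun a _ => hint a]
    simp only [integral_const, probReal_univ, one_smul]
    congr 1
    refine Finset.sum_congr rfl fun a _ => ?_
    rw [integral_indicator_const _ (measurableSet_mem hφ ht1 a), integral_Z hreg hθ hφ ht1,
      smul_eq_mul]
  rw [Finset.sum_congr rfl h1, Finset.sum_sub_distrib, regret]
  simp only [Finset.sum_const, Nat.card_Icc, Nat.add_sub_cancel, nsmul_eq_mul, totalReward]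
  congr 1
  rw [integral_finsetSum _ fun t ht => integrable_finsetSum _ fun a _ =>
    integrable_Z hreg hθ hφ (Finset.mem_Icc.1 ht).1 a]
  refine Finset.sum_congr rfl fun t ht => ?_
  rw [integral_finsetSum _ fun a _ => integrable_Z hreg hθ hφ (Finset.mem_Icc.1 ht).1 a]

theorem regret_nonneg (hreg : IsOpen E.naturalSpace) (hθ : ∀ a, θ a ∈ E.naturalSpace)
    (hφ : E.IsAllocationRule M φ) {m : Fin K} (hm : IsThreshold M (fun a => E.mean (θ a)) m)
    (T : ℕ) : 0 ≤ E.regret M θ φ T := by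
  rw [regret_eq_integral hreg hθ hφ hm]
  exact Finset.sum_nonneg fun t _ => integral_nonneg fun ω => gap_nonneg _ _ _

/-- The regret in terms of the expected numbers of plays: every round without a strictly better arm
and every play of a strictly worse arm is charged with its distance to the threshold arm. -/
theorem regret_eq_sum_plays (hreg : IsOpen E.naturalSpace) (hθ : ∀ a, θ a ∈ E.naturalSpace)
    (hφ : E.IsAllocationRule M φ) {m : Fin K} (hm : IsThreshold M (fun a => E.mean (θ a)) m)
    (T : ℕ) : E.regret M θ φ T =
      ∑ a ∈ Finset.univ.filter (fun a => E.mean (θ m) < E.mean (θ a)),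
        (E.mean (θ a) - E.mean (θ m)) * (T - ∫ ω, (plays φ a T ω : ℝ) ∂(E.banditLaw θ)) +
      ∑ b ∈ Finset.univ.filter (fun b => E.mean (θ b) < E.mean (θ m)),
        (E.mean (θ m) - E.mean (θ b)) * ∫ ω, (plays φ b T ω : ℝ) ∂(E.banditLaw θ) := by
  have := isProbabilityMeasure_banditLaw hθ
  have hmem : ∀ t ∈ Finset.Icc 1 T, ∀ a, MeasurableSet {ω | a ∈ φ t ω} :=
    fun t ht a => measurableSet_mem hφ (Finset.mem_Icc.1 ht).1 a
  have hi1 : ∀ t ∈ Finset.Icc 1 T, ∀ a, Integrable (fun ω => if a ∈ φ t ω then (0 : ℝ) else 1)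
      (E.banditLaw θ) := fun t ht a => Integrable.of_bound (C := 1)
    ((Measurable.ite (hmem t ht a) measurable_const measurable_const).aestronglyMeasurable)
    (Eventually.of_forall fun ω => by split_ifs <;> simp)
  have hi2 : ∀ t ∈ Finset.Icc 1 T, ∀ a, Integrable (fun ω => if a ∈ φ t ω then (1 : ℝ) else 0)
      (E.banditLaw θ) := fun t ht a => Integrable.of_bound (C := 1)
    ((Measurable.ite (hmem t ht a) measurable_const measurable_const).aestronglyMeasurable)
    (Eventually.of_forall fun ω => by split_ifs <;> simp)
  have hp : ∀ a, ∫ ω, (plays φ a T ω : ℝ) ∂(E.banditLaw θ) =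
      ∑ t ∈ Finset.Icc 1 T, ∫ ω, (if a ∈ φ t ω then (1 : ℝ) else 0) ∂(E.banditLaw θ) := by
    intro a
    rw [← integral_finsetSum _ fun t ht => hi2 t ht a]
    exact integral_congr_ae (Eventually.of_forall fun ω => plays_eq_sum a T ω)
  have hq : ∀ a, (T : ℝ) - ∫ ω, (plays φ a T ω : ℝ) ∂(E.banditLaw θ) =
      ∑ t ∈ Finset.Icc 1 T, ∫ ω, (if a ∈ φ t ω then (0 : ℝ) else 1) ∂(E.banditLaw θ) := by
    intro a
    have hT : (T : ℝ) = ∑ t ∈ Finset.Icc 1 T, (1 : ℝ) := by simp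
    rw [hp, hT, ← Finset.sum_sub_distrib]
    refine Finset.sum_congr rfl fun t ht => ?_
    have h1 : (1 : ℝ) = ∫ _, (1 : ℝ) ∂(E.banditLaw θ) := by simp
    rw [h1, ← integral_sub (integrable_const _) (by simpa using hi2 t ht a)]
    refine integral_congr_ae (Eventually.of_forall fun ω => ?_)
    simp only [← h1]
    split_ifs <;> norm_num
  rw [regret_eq_integral hreg hθ hφ hm]
  simp only [hq]
  simp only [hp, gap]
  have : ∀ t ∈ Finset.Icc 1 T, ∫ ω,
      (∑ a ∈ Finset.univ.filter (fun a => E.mean (θ m) < E.mean (θ a)),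
        (E.mean (θ a) - E.mean (θ m)) * (if a ∈ φ t ω then 0 else 1) +
      ∑ b ∈ Finset.univ.filter (fun b => E.mean (θ b) < E.mean (θ m)),
        (E.mean (θ m) - E.mean (θ b)) * (if b ∈ φ t ω then 1 else 0)) ∂(E.banditLaw θ) =
      ∑ a ∈ Finset.univ.filter (fun a => E.mean (θ m) < E.mean (θ a)),
        (E.mean (θ a) - E.mean (θ m)) *
          ∫ ω, (if a ∈ φ t ω then (0 : ℝ) else 1) ∂(E.banditLaw θ) +
      ∑ b ∈ Finset.univ.filter (fun b => E.mean (θ b) < E.mean (θ m)),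
        (E.mean (θ m) - E.mean (θ b)) *
          ∫ ω, (if b ∈ φ t ω then (1 : ℝ) else 0) ∂(E.banditLaw θ) := by
    intro t ht
    rw [integral_add (integrable_finsetSum _ fun a _ => (hi1 t ht a).const_mul _)
      (integrable_finsetSum _ fun a _ => (hi2 t ht a).const_mul _),
      integral_finsetSum _ fun a _ => (hi1 t ht a).const_mul _,
      integral_finsetSum _ fun a _ => (hi2 t ht a).const_mul _]
    simp only [integral_const_mul]
  rw [Finset.sum_congr rfl this, Finset.sum_add_distrib, Finset.sum_comm]
  conv_lhs => rw [add_comm, Finset.sum_comm, add_comm]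
  simp only [Finset.mul_sum]

end ExpFamily

namespace ExpFamily

variable {𝒳 : Type*} [MeasurableSpace 𝒳] {E : ExpFamily 𝒳} {K : ℕ}
variable {M : ℕ} {φ : ℕ → Sample 𝒳 K → Finset (Fin K)} {θ : Fin K → ℝ}

/-! ### The lower bound for uniformly good rules -/

theorem sum_le_topSum (v : Fin K → ℝ) {A : Finset (Fin K)} (hA : A.card = M) :
    ∑ a ∈ A, v a ≤ topSum M v := by
  refine le_csSup ?_ ⟨A, hA, rfl⟩
  exact (Set.toFinite _).bddAbove

/-- If arm `b` is lifted above the threshold arm `m`, then every set of `M` arms without `b` loses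
at least the difference of the means. -/
theorem sum_add_le_topSum_of_lift {v v' : Fin K → ℝ} {m b : Fin K} (hm : IsThreshold M v m)
    (hv : ∀ a, a ≠ b → v' a = v a) {A : Finset (Fin K)} (hA : A.card = M) (hb : b ∉ A) :
    ∑ a ∈ A, v' a + (v' b - v m) ≤ topSum M v' := by
  obtain ⟨c, hcA, hc⟩ : ∃ c ∈ A, v c ≤ v m := by
    by_contra! h
    have := Finset.card_le_card (fun a ha => Finset.mem_filter.2 ⟨Finset.mem_univ a, h a ha⟩ :
      A ⊆ Finset.univ.filter fun a => v m < v a)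
    have := hm.card_gt
    omega
  have hne : c ≠ b := fun h => hb (h ▸ hcA)
  have hbe : b ∉ A.erase c := fun h => hb (Finset.mem_of_mem_erase h)
  have hcard : (insert b (A.erase c)).card = M := by
    rw [Finset.card_insert_of_notMem hbe, Finset.card_erase_of_mem hcA, hA]
    have : 0 < A.card := Finset.card_pos.2 ⟨c, hcA⟩
    omega
  have h1 := sum_le_topSum v' hcard
  rw [Finset.sum_insert hbe] at h1
  have h2 := Finset.sum_erase_add A v' hcA
  have h3 := hv c hne
  linarith

theorem le_gap_of_lift {v v' : Fin K → ℝ} {m m' b : Fin K} (hm : IsThreshold M v m)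
    (hm' : IsThreshold M v' m') (hv : ∀ a, a ≠ b → v' a = v a) {A : Finset (Fin K)}
    (hA : A.card = M) :
    (v' b - v m) * (if b ∈ A then 0 else 1) ≤ gap v' m' A := by
  split_ifs with h
  · rw [mul_zero]
    exact gap_nonneg _ _ _
  · rw [mul_one, ← topSum_sub_sum_eq_gap hm' hA]
    have := sum_add_le_topSum_of_lift hm hv hA h
    linarith

theorem mul_prob_le_regret_of_lift (hreg : IsOpen E.naturalSpace) (hM : 1 ≤ M) (hMK : M ≤ K)
    {θ' : Fin K → ℝ} (hθ' : ∀ a, θ' a ∈ E.naturalSpace) (hφ : E.IsAllocationRule M φ)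
    {m b : Fin K} (hm : IsThreshold M (fun a => E.mean (θ a)) m)
    (hb : ∀ a, a ≠ b → θ' a = θ a) (hmb : E.mean (θ m) < E.mean (θ' b)) (n T : ℕ) :
    (E.mean (θ' b) - E.mean (θ m)) * ((T - n) *
      (E.banditLaw θ').real {ω | plays φ b T ω ≤ n}) ≤ E.regret M θ' φ T := by
  have := isProbabilityMeasure_banditLaw hθ'
  obtain ⟨m', hm'⟩ := exists_isThreshold hM hMK fun a => E.mean (θ' a)
  have hmem : ∀ t ∈ Finset.Icc 1 T, MeasurableSet {ω | b ∈ φ t ω} :=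
    fun t ht => measurableSet_mem hφ (Finset.mem_Icc.1 ht).1 b
  have hi : ∀ t ∈ Finset.Icc 1 T, Integrable (fun ω => if b ∈ φ t ω then (0 : ℝ) else 1)
      (E.banditLaw θ') := fun t ht => Integrable.of_bound (C := 1)
    ((Measurable.ite (hmem t ht) measurable_const measurable_const).aestronglyMeasurable)
    (Eventually.of_forall fun ω => by split_ifs <;> simp)
  have hE : MeasurableSet {ω | plays φ b T ω ≤ n} :=
    measurable_plays_of_rule hφ b T (measurableSet_Iic (a := n))
  have h1 : ∀ t ∈ Finset.Icc 1 T, ∫ ω, (E.mean (θ' b) - E.mean (θ m)) *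
      (if b ∈ φ t ω then (0 : ℝ) else 1) ∂(E.banditLaw θ') ≤
      ∫ ω, gap (fun a => E.mean (θ' a)) m' (φ t ω) ∂(E.banditLaw θ') := by
    intro t ht
    have ht1 := (Finset.mem_Icc.1 ht).1
    refine integral_mono ((hi t ht).const_mul _) ?_ fun ω => le_gap_of_lift hm hm'
      (fun a ha => by rw [hb a ha]) ((hφ t ht1).1 ω)
    unfold gap
    refine (integrable_finsetSum _ fun a _ => Integrable.const_mul ?_ _).add
      (integrable_finsetSum _ fun a _ => Integrable.const_mul ?_ _)
    all_goals
      exact Integrable.of_bound (C := 1) ((Measurable.ite (measurableSet_mem hφ ht1 a)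
        measurable_const measurable_const).aestronglyMeasurable)
        (Eventually.of_forall fun ω => by split_ifs <;> simp)
  rw [regret_eq_integral hreg hθ' hφ hm']
  refine le_trans ?_ (Finset.sum_le_sum h1)
  simp only [integral_const_mul]
  rw [← Finset.mul_sum, ← integral_finsetSum _ fun t ht => hi t ht]
  refine mul_le_mul_of_nonneg_left ?_ (by linarith)
  have h2 : (T - n) * (E.banditLaw θ').real {ω | plays φ b T ω ≤ n} =
      ∫ ω, {ω | plays φ b T ω ≤ n}.indicator (fun _ => (T - n : ℝ)) ω ∂(E.banditLaw θ') := by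
    rw [integral_indicator_const _ hE, smul_eq_mul, mul_comm]
  rw [h2]
  refine integral_mono ((integrable_const _).indicator hE) (integrable_finsetSum _ hi) fun ω => ?_
  have h3 : ∑ t ∈ Finset.Icc 1 T, (if b ∈ φ t ω then (0 : ℝ) else 1) = T - plays φ b T ω := by
    have hT : (T : ℝ) = ∑ t ∈ Finset.Icc 1 T, (1 : ℝ) := by simp
    rw [plays_eq_sum, hT, ← Finset.sum_sub_distrib]
    refine Finset.sum_congr rfl fun t _ => ?_
    split_ifs <;> norm_num
  simp only [h3]
  by_cases h : plays φ b T ω ≤ n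
  · rw [Set.indicator_of_mem (by exact h)]
    have : (plays φ b T ω : ℝ) ≤ n := by exact_mod_cast h
    linarith
  · rw [Set.indicator_of_notMem (by exact h)]
    have : (plays φ b T ω : ℝ) ≤ T := by exact_mod_cast plays_le b T ω
    linarith

/-- Few plays of arm `b` are unlikely under `θ` if they are unlikely under a parameter `θ'` that
differs from `θ` only in arm `b`, as long as the first `n` observations of this arm do not tell
`θ` and `θ'` apart. -/
theorem prob_plays_le_of_change (hθ : ∀ a, θ a ∈ E.naturalSpace)
    {θ' : Fin K → ℝ} (hθ' : ∀ a, θ' a ∈ E.naturalSpace) (hφ : E.IsAllocationRule M φ) {b : Fin K}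
    (hb : ∀ a, a ≠ b → θ' a = θ a) (hlt : θ b ≤ θ' b) {n T : ℕ} (hn : 1 ≤ n) (η : ℝ) :
    (E.banditLaw θ).real {ω | plays φ b T ω ≤ n} ≤
      (E.banditLaw θ).real {ω | E.sampleMean b n ω ≤ E.mean (θ b) - η} +
        Real.exp (n * (E.klNat (θ b) (θ' b) + (θ' b - θ b) * η)) *
          (E.banditLaw θ').real {ω | plays φ b T ω ≤ n} := by
  have := isProbabilityMeasure_banditLaw hθ
  have := isProbabilityMeasure_banditLaw hθ'
  set P := {ω : Sample 𝒳 K | plays φ b T ω ≤ n} with hP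
  set C := {ω : Sample 𝒳 K | E.mean (θ b) - η < E.sampleMean b n ω} with hC
  have hPm : MeasurableSet P := measurable_plays_of_rule hφ b T (measurableSet_Iic (a := n))
  have hCm : MeasurableSet C := measurableSet_lt measurable_const (measurable_sampleMean b n)
  have hdep : DependsOnCoords (coordsUpTo b n) (P ∩ C) := by
    rintro ω ω' h ⟨hω, hω'⟩
    refine ⟨dependsOnCoords_plays_le hφ b n T ω ω' h hω, ?_⟩
    have : E.sampleMean b n ω = E.sampleMean b n ω' := by
      rw [sampleMean, sampleMean]
      congr 1
      exact Finset.sum_congr rfl fun k hk => by rw [Y, Y, h (b, k) fun _ => hk]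
    rw [hC, Set.mem_ofPred_eq, ← this]
    exact hω'
  set D := n * (E.klNat (θ b) (θ' b) + (θ' b - θ b) * η) with hD
  have h1 : ENNReal.ofReal (Real.exp (-D)) * E.banditLaw θ (P ∩ C) ≤ E.banditLaw θ' (P ∩ C) := by
    rw [banditLaw_eq_setLIntegral hθ hθ' hb hdep (hPm.inter hCm), ← setLIntegral_const]
    refine setLIntegral_mono (by fun_prop) fun ω hω => ENNReal.ofReal_le_ofReal
      (Real.exp_le_exp.2 ?_)
    have hω2 : E.mean (θ b) - η < E.sampleMean b n ω := hω.2
    rw [← natCast_mul_sampleMean b hn, hD, klNat]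
    have := mul_le_mul_of_nonneg_left hω2.le
      (mul_nonneg (Nat.cast_nonneg (α := ℝ) n) (by linarith : 0 ≤ θ' b - θ b))
    linarith
  have h2 : Real.exp (-D) * (E.banditLaw θ).real (P ∩ C) ≤ (E.banditLaw θ').real P := by
    have h := ENNReal.toReal_mono (measure_ne_top _ _)
      (h1.trans (measure_mono Set.inter_subset_left))
    rwa [ENNReal.toReal_mul, ENNReal.toReal_ofReal (Real.exp_pos _).le] at h
  have h3 : (E.banditLaw θ).real (P ∩ C) ≤ Real.exp D * (E.banditLaw θ').real P := by
    have := mul_le_mul_of_nonneg_left h2 (Real.exp_pos D).le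
    rwa [← mul_assoc, ← Real.exp_add, add_neg_cancel, Real.exp_zero, one_mul] at this
  have h4 : P ⊆ {ω | E.sampleMean b n ω ≤ E.mean (θ b) - η} ∪ (P ∩ C) := by
    intro ω hω
    rcases le_or_gt (E.sampleMean b n ω) (E.mean (θ b) - η) with h | h
    · exact Or.inl h
    · exact Or.inr ⟨hω, h⟩
  calc (E.banditLaw θ).real P ≤ _ := measureReal_mono h4
    _ ≤ _ := measureReal_union_le _ _
    _ ≤ _ := by gcongr

/-- Under a uniformly good rule a suboptimal arm is played rarely with vanishing probability only:
otherwise the rule would have a large regret when the arm is lifted above the threshold arm. -/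
theorem tendsto_prob_plays_le (hreg : IsOpen E.naturalSpace)
    (hmono : StrictMonoOn E.mean E.naturalSpace) (hM : 1 ≤ M) (hMK : M ≤ K)
    (hθ : ∀ a, θ a ∈ E.naturalSpace) (hφ : E.IsAllocationRule M φ) (hgood : E.IsUniformlyGood M φ)
    {m b : Fin K} (hm : IsThreshold M (fun a => E.mean (θ a)) m) (hbm : θ b < θ m) {θ₁ c : ℝ}
    (h₁ : θ₁ ∈ E.naturalSpace) (hm₁ : θ m < θ₁) (hc : 0 < c) (hck : c * E.klNat (θ b) θ₁ < 1) :
    Tendsto (fun T : ℕ => (E.banditLaw θ).real {ω | plays φ b T ω ≤ ⌊c * Real.log T⌋₊}) atTop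
      (𝓝 0) := by
  have hlt : θ b < θ₁ := hbm.trans hm₁
  set θ' : Fin K → ℝ := Function.update θ b θ₁ with hθ'def
  have hb1 : θ' b = θ₁ := Function.update_self _ _ _
  have hb : ∀ a, a ≠ b → θ' a = θ a := fun a ha => Function.update_of_ne ha _ _
  have hθ' : ∀ a, θ' a ∈ E.naturalSpace := fun a => by
    by_cases h : a = b
    · rw [h, hb1]; exact h₁
    · rw [hb a h]; exact hθ a
  have := isProbabilityMeasure_banditLaw hθ
  have := isProbabilityMeasure_banditLaw hθ'
  set d := E.klNat (θ b) θ₁ with hd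
  set l := θ₁ - θ b with hl
  have hl0 : 0 < l := by rw [hl]; linarith
  -- the slack in `c * d < 1` leaves room for deviations `η` of the log-likelihood ratio
  set η := (1 - c * d) / (2 * c * l) with hη
  have hη0 : 0 < η := div_pos (by linarith) (by positivity)
  set r := c * (d + l * η) with hr
  have hr' : r = (1 + c * d) / 2 := by
    rw [hr, hη]
    field_simp
    ring
  have hd0 : 0 < d := klNat_pos hreg hmono (hθ b) h₁ hlt.ne
  set α := (1 - r) / 2 with hα
  have hα0 : 0 < α := by rw [hα, hr']; linarith
  set Δ := E.mean θ₁ - E.mean (θ m) with hΔ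
  have hΔ0 : 0 < Δ := sub_pos.2 (hmono (hθ m) h₁ hm₁)
  obtain ⟨κ, hκ, hdev⟩ := exists_banditLaw_sampleMean_le_sub_le hreg hθ b hη0
  set n : ℕ → ℕ := fun T => ⌊c * Real.log T⌋₊ with hn
  have hlog : Tendsto (fun T : ℕ => Real.log T) atTop atTop :=
    Real.tendsto_log_atTop.comp tendsto_natCast_atTop_atTop
  have hclog : Tendsto (fun T : ℕ => c * Real.log T) atTop atTop := hlog.const_mul_atTop hc
  have hntop : Tendsto n atTop atTop := tendsto_nat_floor_atTop.comp hclog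
  have hsmall : ∀ᶠ T : ℕ in atTop, c * Real.log T ≤ T / 2 := by
    have h := (Real.isLittleO_log_id_atTop.comp_tendsto tendsto_natCast_atTop_atTop).bound
      (show 0 < 1 / (2 * c) by positivity)
    filter_upwards [h] with T hT
    simp only [Function.comp_apply, id_eq, Real.norm_natCast] at hT
    have := (le_abs_self (Real.log T)).trans hT
    have := mul_le_mul_of_nonneg_left this hc.le
    refine this.trans (le_of_eq ?_)
    field_simp
  have hbound : ∀ᶠ T : ℕ in atTop,
      (E.banditLaw θ).real {ω | plays φ b T ω ≤ n T} ≤ Real.exp (-(κ * n T)) +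
        2 / Δ * ((T : ℝ) ^ (-α) * (E.regret M θ' φ T / (T : ℝ) ^ α)) := by
    filter_upwards [hntop.eventually_ge_atTop 1, hsmall, eventually_ge_atTop 1,
      hclog.eventually_ge_atTop 0] with T hT1 hT2 hT3 hT4
    have hTpos : (0 : ℝ) < T := by exact_mod_cast hT3
    have hnle : (n T : ℝ) ≤ c * Real.log T := Nat.floor_le hT4
    have hch := prob_plays_le_of_change hθ hθ' hφ hb (by rw [hb1]; exact hlt.le) (T := T) hT1 η
    rw [hb1, ← hd, ← hl] at hch
    have hlift := mul_prob_le_regret_of_lift hreg hM hMK hθ' hφ hm hb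
      (by rw [hb1]; exact hmono (hθ m) h₁ hm₁) (n T) T
    rw [hb1, ← hΔ] at hlift
    set p := (E.banditLaw θ').real {ω | plays φ b T ω ≤ n T} with hp
    have hp0 : 0 ≤ p := measureReal_nonneg
    have hpR : p ≤ 2 / Δ * (E.regret M θ' φ T / T) := by
      have h1 : Δ * (T / 2 * p) ≤ E.regret M θ' φ T := by
        refine le_trans ?_ hlift
        gcongr
        linarith
      rw [div_mul_div_comm, le_div_iff₀ (by positivity)]
      linarith
    have hR0 : 0 ≤ 2 / Δ * (E.regret M θ' φ T / T) := hp0.trans hpR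
    have hexp : Real.exp (n T * (d + l * η)) ≤ (T : ℝ) ^ r := by
      rw [Real.rpow_def_of_pos hTpos, hr]
      refine Real.exp_le_exp.2 ?_
      have := mul_le_mul_of_nonneg_right hnle (by positivity : 0 ≤ d + l * η)
      linarith
    have hdevR : (E.banditLaw θ).real {ω | E.sampleMean b (n T) ω ≤ E.mean (θ b) - η} ≤
        Real.exp (-(κ * n T)) :=
      ENNReal.toReal_le_of_le_ofReal (Real.exp_pos _).le (hdev (n T) hT1)
    refine hch.trans (add_le_add hdevR ?_)
    calc Real.exp (n T * (d + l * η)) * p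
        ≤ (T : ℝ) ^ r * (2 / Δ * (E.regret M θ' φ T / T)) := by gcongr
      _ = 2 / Δ * ((T : ℝ) ^ (-α) * (E.regret M θ' φ T / (T : ℝ) ^ α)) := by
        have h1 : (T : ℝ) ^ r / T = (T : ℝ) ^ (-α) / (T : ℝ) ^ α := by
          rw [← Real.rpow_sub_one hTpos.ne', ← Real.rpow_sub hTpos]
          congr 1
          rw [hα]
          ring
        calc _ = 2 / Δ * E.regret M θ' φ T * ((T : ℝ) ^ r / T) := by ring
          _ = _ := by rw [h1]; ring
  have hlim : Tendsto (fun T : ℕ => Real.exp (-(κ * n T)) +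
      2 / Δ * ((T : ℝ) ^ (-α) * (E.regret M θ' φ T / (T : ℝ) ^ α))) atTop (𝓝 0) := by
    have h1 : Tendsto (fun T : ℕ => Real.exp (-(κ * n T))) atTop (𝓝 0) :=
      Real.tendsto_exp_neg_atTop_nhds_zero.comp
        ((tendsto_natCast_atTop_atTop.comp hntop).const_mul_atTop hκ)
    have h2 : Tendsto (fun T : ℕ => (T : ℝ) ^ (-α)) atTop (𝓝 0) :=
      (tendsto_rpow_neg_atTop hα0).comp tendsto_natCast_atTop_atTop
    have h3 : Tendsto (fun T : ℕ => E.regret M θ' φ T / (T : ℝ) ^ α) atTop (𝓝 0) :=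
      (hgood θ' hθ' α hα0).tendsto_div_nhds_zero
    have h4 := h1.add ((h2.mul h3).const_mul (2 / Δ))
    simpa using h4
  exact tendsto_of_tendsto_of_tendsto_of_le_of_le' tendsto_const_nhds hlim
    (Eventually.of_forall fun T => measureReal_nonneg) hbound

theorem eventually_mul_log_le_plays (hreg : IsOpen E.naturalSpace)
    (hmono : StrictMonoOn E.mean E.naturalSpace) (hM : 1 ≤ M) (hMK : M ≤ K)
    (hθ : ∀ a, θ a ∈ E.naturalSpace) (hφ : E.IsAllocationRule M φ) (hgood : E.IsUniformlyGood M φ)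
    {m b : Fin K} (hm : IsThreshold M (fun a => E.mean (θ a)) m) (hbm : θ b < θ m) {c : ℝ}
    (hc : c < 1 / E.klNat (θ b) (θ m)) :
    ∀ᶠ T : ℕ in atTop, c * Real.log T ≤ ∫ ω, (plays φ b T ω : ℝ) ∂(E.banditLaw θ) := by
  have := isProbabilityMeasure_banditLaw hθ
  have hd0 : 0 < E.klNat (θ b) (θ m) := klNat_pos hreg hmono (hθ b) (hθ m) hbm.ne
  rcases le_or_gt c 0 with hc0 | hc0
  · refine Eventually.of_forall fun T => ?_
    exact (mul_nonpos_of_nonpos_of_nonneg hc0 (Real.log_natCast_nonneg T)).trans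
      (integral_nonneg fun ω => Nat.cast_nonneg _)
  obtain ⟨c₁, hcc₁, hc₁⟩ := exists_between hc
  have hc₁0 : 0 < c₁ := hc0.trans hcc₁
  have hc₁d : c₁ * E.klNat (θ b) (θ m) < 1 := (lt_div_iff₀ hd0).1 hc₁
  obtain ⟨θ₁, ⟨hm₁, hk₁⟩, h₁⟩ : ∃ θ₁, (θ m < θ₁ ∧ c₁ * E.klNat (θ b) θ₁ < 1) ∧
      θ₁ ∈ E.naturalSpace := by
    have hcont : ContinuousAt (fun x => c₁ * E.klNat (θ b) x) (θ m) :=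
      continuousAt_const.mul ((continuousOn_klNat_right hreg (θ b)).continuousAt
        (hreg.mem_nhds (hθ m)))
    have hev := (hcont.eventually (gt_mem_nhds hc₁d)).and (hreg.eventually_mem (hθ m))
    obtain ⟨x, hx⟩ := ((eventually_nhdsWithin_of_eventually_nhds hev).and
      (self_mem_nhdsWithin : Set.Ioi (θ m) ∈ 𝓝[>] (θ m))).exists
    exact ⟨x, ⟨hx.2, hx.1.1⟩, hx.1.2⟩
  have hlim := tendsto_prob_plays_le hreg hmono hM hMK hθ hφ hgood hm hbm h₁ hm₁ hc₁0 hk₁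
  have hev := hlim.eventually (gt_mem_nhds (show 0 < 1 - c / c₁ from
    sub_pos.2 ((div_lt_one hc₁0).2 hcc₁)))
  filter_upwards [hev] with T hT
  set n := ⌊c₁ * Real.log T⌋₊ with hn
  have hlog : 0 ≤ Real.log T := Real.log_natCast_nonneg T
  have hEm : MeasurableSet {ω | plays φ b T ω ≤ n} :=
    measurable_plays_of_rule hφ b T (measurableSet_Iic (a := n))
  have h1 : c₁ * Real.log T * (E.banditLaw θ).real {ω | plays φ b T ω ≤ n}ᶜ ≤
      ∫ ω, (plays φ b T ω : ℝ) ∂(E.banditLaw θ) := by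
    have : c₁ * Real.log T * (E.banditLaw θ).real {ω | plays φ b T ω ≤ n}ᶜ =
        ∫ ω, {ω | plays φ b T ω ≤ n}ᶜ.indicator (fun _ => c₁ * Real.log T) ω ∂(E.banditLaw θ) := by
      rw [integral_indicator_const _ hEm.compl, smul_eq_mul, mul_comm]
    rw [this]
    refine integral_mono ((integrable_const _).indicator hEm.compl) (integrable_plays hθ hφ b T)
      fun ω => ?_
    by_cases h : plays φ b T ω ≤ n
    · rw [Set.indicator_of_notMem (Set.notMem_compl_iff.2 (by exact h))]
      positivity
    · rw [Set.indicator_of_mem (by exact h)]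
      exact (Nat.lt_of_floor_lt (not_le.1 h)).le
  rw [probReal_compl_eq_one_sub hEm] at h1
  refine le_trans ?_ h1
  have h2 : c / c₁ ≤ 1 - (E.banditLaw θ).real {ω | plays φ b T ω ≤ n} := by linarith
  have h3 := mul_le_mul_of_nonneg_left h2 (mul_nonneg hc₁0.le hlog)
  refine le_trans (le_of_eq ?_) h3
  field_simp

theorem integral_plays_le (hθ : ∀ a, θ a ∈ E.naturalSpace) (hφ : E.IsAllocationRule M φ)
    (a : Fin K) (T : ℕ) : ∫ ω, (plays φ a T ω : ℝ) ∂(E.banditLaw θ) ≤ T := by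
  have := isProbabilityMeasure_banditLaw hθ
  have h : ∫ _, (T : ℝ) ∂(E.banditLaw θ) = T := by simp
  rw [← h]
  exact integral_mono (integrable_plays hθ hφ a T) (integrable_const _)
    fun ω => Nat.cast_le.2 (plays_le (φ := φ) a T ω)

/-- The asymptotic lower bound for the regret of a uniformly good rule. -/
theorem eventually_mul_log_le_regret (hreg : IsOpen E.naturalSpace)
    (hmono : StrictMonoOn E.mean E.naturalSpace) (hM : 1 ≤ M) (hMK : M ≤ K)
    (hθ : ∀ a, θ a ∈ E.naturalSpace) (hφ : E.IsAllocationRule M φ) (hgood : E.IsUniformlyGood M φ)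
    {m : Fin K} (hm : IsThreshold M (fun a => E.mean (θ a)) m) {c : ℝ}
    (hc : c < ∑ b ∈ Finset.univ.filter (fun b => E.mean (θ b) < E.mean (θ m)),
      (E.mean (θ m) - E.mean (θ b)) / E.klNat (θ b) (θ m)) :
    ∀ᶠ T : ℕ in atTop, c * Real.log T ≤ E.regret M θ φ T := by
  set B := Finset.univ.filter (fun b => E.mean (θ b) < E.mean (θ m)) with hB
  have hBm : ∀ b ∈ B, E.mean (θ b) < E.mean (θ m) := fun b hb => (Finset.mem_filter.1 hb).2
  set D := ∑ b ∈ B, (E.mean (θ m) - E.mean (θ b)) with hD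
  have hD0 : 0 ≤ D := Finset.sum_nonneg fun b hb => by linarith [hBm b hb]
  set S := ∑ b ∈ B, (E.mean (θ m) - E.mean (θ b)) / E.klNat (θ b) (θ m) with hS
  set ζ := (S - c) / (D + 1) with hζ
  have hζ0 : 0 < ζ := div_pos (by linarith) (by linarith)
  have hζD : ζ * D ≤ S - c := by
    have : ζ * (D + 1) = S - c := div_mul_cancel₀ _ (by linarith)
    linarith
  have hev : ∀ᶠ T : ℕ in atTop, ∀ b ∈ B, (1 / E.klNat (θ b) (θ m) - ζ) * Real.log T ≤
      ∫ ω, (plays φ b T ω : ℝ) ∂(E.banditLaw θ) :=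
    (eventually_all_finset B).2 fun b hb => eventually_mul_log_le_plays hreg hmono hM hMK hθ hφ
      hgood hm ((hmono.lt_iff_lt (hθ b) (hθ m)).1 (hBm b hb)) (by linarith)
  filter_upwards [hev] with T hT
  have hlog : 0 ≤ Real.log T := Real.log_natCast_nonneg T
  rw [regret_eq_sum_plays hreg hθ hφ hm]
  have h1 : 0 ≤ ∑ a ∈ Finset.univ.filter (fun a => E.mean (θ m) < E.mean (θ a)),
      (E.mean (θ a) - E.mean (θ m)) * (T - ∫ ω, (plays φ a T ω : ℝ) ∂(E.banditLaw θ)) :=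
    Finset.sum_nonneg fun a ha => mul_nonneg (by linarith [(Finset.mem_filter.1 ha).2])
      (sub_nonneg.2 (integral_plays_le hθ hφ a T))
  have h2 : ∑ b ∈ B, (E.mean (θ m) - E.mean (θ b)) *
      ((1 / E.klNat (θ b) (θ m) - ζ) * Real.log T) ≤
      ∑ b ∈ B, (E.mean (θ m) - E.mean (θ b)) * ∫ ω, (plays φ b T ω : ℝ) ∂(E.banditLaw θ) :=
    Finset.sum_le_sum fun b hb => mul_le_mul_of_nonneg_left (hT b hb) (by linarith [hBm b hb])
  have h3 : ∑ b ∈ B, (E.mean (θ m) - E.mean (θ b)) *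
      ((1 / E.klNat (θ b) (θ m) - ζ) * Real.log T) = (S - ζ * D) * Real.log T := by
    rw [hS, hD, Finset.mul_sum, ← Finset.sum_sub_distrib, Finset.sum_mul]
    exact Finset.sum_congr rfl fun b _ => by ring
  have h4 : c * Real.log T ≤ (S - ζ * D) * Real.log T := by gcongr; linarith
  linarith

end ExpFamily

namespace ExpFamily

/-! ### The algorithm on a fixed sample path -/

/-- An arm that is played whenever it is the candidate is played once in `K` rounds. -/
theorem plays_add_div_le {Ω : Type*} {K : ℕ} {φ : ℕ → Ω → Finset (Fin K)} {ω : Ω} (hK : 0 < K)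
    {a : Fin K} {s t : ℕ} (hst : s ≤ t)
    (h : ∀ u, s ≤ u → u < t → (a : ℕ) + 1 ≡ u + 1 [MOD K] → a ∈ φ (u + 1) ω) :
    plays φ a s ω + (t - s) / K ≤ plays φ a t ω := by
  have key : ∀ k, s + k * K ≤ t → plays φ a s ω + k ≤ plays φ a (s + k * K) ω := by
    intro k
    induction k with
    | zero => intro _; simp
    | succ k ih =>
      intro hk
      have hk' : s + k * K + K ≤ t := by rw [Nat.succ_mul] at hk; omega
      have ih' := ih (by omega)
      -- the round of the next block in which `a` is the candidate
      obtain ⟨u, hu1, hu2, hu3⟩ : ∃ u, s + k * K ≤ u ∧ u < s + k * K + K ∧ (a : ℕ) ≡ u [MOD K] := by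
        set r := s + k * K
        refine ⟨r + ((a : ℕ) + (K - r % K)) % K, by omega,
          by have := Nat.mod_lt ((a : ℕ) + (K - r % K)) hK; omega, ?_⟩
        have hrK : r % K ≤ K := (Nat.mod_lt r hK).le
        have h1 : r + ((a : ℕ) + (K - r % K)) % K ≡ r % K + ((a : ℕ) + (K - r % K)) [MOD K] :=
          (Nat.mod_modEq r K).symm.add (Nat.mod_modEq _ K)
        have h2 : r % K + ((a : ℕ) + (K - r % K)) = a + K := by omega
        rw [h2] at h1
        exact (h1.trans (by simp [Nat.ModEq])).symm
      have hmem := h u (by omega) (by omega) (hu3.add_right 1)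
      have h1 := plays_succ (φ := φ) a u ω
      rw [if_pos hmem] at h1
      have h2 : plays φ a (s + k * K) ω ≤ plays φ a u ω := plays_mono a ω hu1
      have h3 : plays φ a (u + 1) ω ≤ plays φ a (s + (k + 1) * K) ω :=
        plays_mono a ω (by rw [Nat.succ_mul]; omega)
      omega
  have hdiv : (t - s) / K * K ≤ t - s := Nat.div_mul_le_self _ _
  exact (key ((t - s) / K) (by omega)).trans (plays_mono a ω (by omega))

theorem mem_wellSampled_iff {𝒳 : Type*} {K : ℕ} {δ : ℝ} {φ : ℕ → Sample 𝒳 K → Finset (Fin K)}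
    {ω : Sample 𝒳 K} {a : Fin K} {t : ℕ} :
    a ∈ wellSampled δ φ t ω ↔ δ * t ≤ plays φ a t ω := by
  simp [wellSampled]

variable {𝒳 : Type*} [MeasurableSpace 𝒳] {E : ExpFamily 𝒳} {K : ℕ}
variable {M : ℕ} {δ : ℝ} {g : ℕ → ℝ} {φ : ℕ → Sample 𝒳 K → Finset (Fin K)} {θ : Fin K → ℝ}
variable {ω : Sample 𝒳 K} {m : Fin K} {η : ℝ}

/-- At time `t` the sample means of the well-sampled arms are `η`-accurate. -/
def AccurateAt (E : ExpFamily 𝒳) (δ : ℝ) (φ : ℕ → Sample 𝒳 K → Finset (Fin K)) (θ : Fin K → ℝ)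
    (η : ℝ) (t : ℕ) (ω : Sample 𝒳 K) : Prop :=
  ∀ a ∈ wellSampled δ φ t ω, |E.empMean φ a t ω - E.mean (θ a)| < η

/-- At time `t` the index of every arm that is at least as good as arm `m` is a true upper bound of
its mean. -/
def OptimisticAt (E : ExpFamily 𝒳) (g : ℕ → ℝ) (φ : ℕ → Sample 𝒳 K → Finset (Fin K))
    (θ : Fin K → ℝ) (m : Fin K) (t : ℕ) (ω : Sample 𝒳 K) : Prop :=
  ∀ a, E.mean (θ m) ≤ E.mean (θ a) → (E.mean (θ a) : EReal) ≤ E.ucb g φ a t ω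

/-- The means that differ from the one of arm `m` do so by at least `2 η`. -/
def IsSeparated (E : ExpFamily 𝒳) (θ : Fin K → ℝ) (m : Fin K) (η : ℝ) : Prop :=
  ∀ a, E.mean (θ a) ≠ E.mean (θ m) → 2 * η ≤ |E.mean (θ a) - E.mean (θ m)|

theorem IsSeparated.le_of_lt (h : E.IsSeparated θ m η) {a : Fin K}
    (ha : E.mean (θ m) - 2 * η < E.mean (θ a)) : E.mean (θ m) ≤ E.mean (θ a) := by
  by_contra! hlt
  have := h a hlt.ne
  rw [abs_of_neg (by linarith)] at this
  linarith

theorem IsSeparated.le_sub (h : E.IsSeparated θ m η) {a : Fin K}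
    (ha : E.mean (θ a) < E.mean (θ m)) : E.mean (θ a) ≤ E.mean (θ m) - 2 * η := by
  have := h a ha.ne
  rw [abs_of_neg (by linarith)] at this
  linarith

theorem IsSeparated.add_le (h : E.IsSeparated θ m η) {a : Fin K}
    (ha : E.mean (θ m) < E.mean (θ a)) : E.mean (θ m) + 2 * η ≤ E.mean (θ a) := by
  have := h a ha.ne'
  rw [abs_of_pos (by linarith)] at this
  linarith

theorem not_forall_mem_gt {v : Fin K → ℝ} (hm : IsThreshold M v m) {A : Finset (Fin K)}
    (hA : A.card = M) : ¬ ∀ a ∈ A, v m < v a := fun h => by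
  have := Finset.card_le_card (fun a ha => Finset.mem_filter.2 ⟨Finset.mem_univ a, h a ha⟩ :
    A ⊆ Finset.univ.filter fun a => v m < v a)
  have := hm.card_gt
  omega

variable (K) in
theorem exists_candidate (hK : 0 < K) (t : ℕ) : ∃ b : Fin K, (b : ℕ) + 1 ≡ t + 1 [MOD K] :=
  ⟨⟨t % K, Nat.mod_lt _ hK⟩, (Nat.mod_modEq t K).add_right 1⟩

/-- A well-sampled arm that is better than the threshold arm is played. -/
theorem mem_of_wellSampled (hK : 0 < K) (halg : E.IsRoundRobinKLUCB M δ g φ)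
    (hm : IsThreshold M (fun a => E.mean (θ a)) m) (hsep : E.IsSeparated θ m η) {t : ℕ} (ht : K ≤ t)
    (hacc : E.AccurateAt δ φ θ η t ω) {a : Fin K} (ha : E.mean (θ m) < E.mean (θ a))
    (haW : a ∈ wellSampled δ φ t ω) : a ∈ φ (t + 1) ω := by
  obtain ⟨L, hLW, hLc, hLmax, hstep⟩ := halg.step ω t ht
  have hgap := hsep.add_le ha
  have haa := abs_lt.1 (hacc a haW)
  have hno : ¬ ∀ c ∈ L, E.empMean φ a t ω ≤ E.empMean φ c t ω := fun h => by
    refine not_forall_mem_gt hm hLc fun c hc => ?_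
    have h1 := abs_lt.1 (hacc c (hLW hc))
    have h2 := h c hc
    change E.mean (θ m) < E.mean (θ c)
    linarith
  have haL : a ∈ L := by
    by_contra h
    exact hno fun c hc => hLmax c hc a (Finset.mem_sdiff.2 ⟨haW, h⟩)
  obtain ⟨b, hb⟩ := exists_candidate K hK t
  by_cases hcase : b ∈ L ∨ ∀ a ∈ L, E.ucb g φ b t ω ≤ (E.empMean φ a t ω : EReal)
  · rw [(hstep b hb).1 hcase]
    exact haL
  · obtain ⟨c, hcL, hcmin, hφ⟩ := (hstep b hb).2 hcase
    rw [hφ]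
    refine Finset.mem_insert_of_mem (Finset.mem_erase.2 ⟨fun h => hno ?_, haL⟩)
    rw [h]
    exact hcmin

/-- If a good candidate is not played, then this is because the leaders look better. -/
theorem of_candidate_notMem (halg : E.IsRoundRobinKLUCB M δ g φ) {t : ℕ} (ht : K ≤ t)
    (hacc : E.AccurateAt δ φ θ η t ω) (hopt : E.OptimisticAt g φ θ m t ω) {a : Fin K}
    (ha : E.mean (θ m) ≤ E.mean (θ a)) (hat : (a : ℕ) + 1 ≡ t + 1 [MOD K])
    (hnot : a ∉ φ (t + 1) ω) :
    ∀ c ∈ φ (t + 1) ω, c ∈ wellSampled δ φ t ω ∧ E.mean (θ a) - η < E.mean (θ c) := by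
  obtain ⟨L, hLW, hLc, hLmax, hstep⟩ := halg.step ω t ht
  by_cases hcase : a ∈ L ∨ ∀ c ∈ L, E.ucb g φ a t ω ≤ (E.empMean φ c t ω : EReal)
  · have hφ := (hstep a hat).1 hcase
    rw [hφ] at hnot ⊢
    intro c hc
    refine ⟨hLW hc, ?_⟩
    have h1 := (hopt a ha).trans ((hcase.resolve_left hnot) c hc)
    have h2 : E.mean (θ a) ≤ E.empMean φ c t ω := by exact_mod_cast h1
    have h3 := abs_lt.1 (hacc c (hLW hc))
    linarith
  · obtain ⟨c, -, -, hφ⟩ := (hstep a hat).2 hcase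
    rw [hφ] at hnot
    exact absurd (Finset.mem_insert_self a _) hnot

/-- After a sufficiently long time with accurate sample means and optimistic indices, the arms that
are better than the threshold arm are well-sampled, and so are `M` arms that are at least as good.
For the latter the last time matters at which a good candidate was not played: the arms played
then were well-sampled, and since then they have been played at least once in `K` rounds, which
keeps them well-sampled because of `δ ≤ 1 / K`. -/
theorem wellSampled_of_window (hK : 0 < K) (hδK : δ ≤ 1 / K) (hη : 0 < η)
    (hcard : ∀ t, 1 ≤ t → (φ t ω).card = M)
    (halg : E.IsRoundRobinKLUCB M δ g φ) (hm : IsThreshold M (fun a => E.mean (θ a)) m)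
    (hsep : E.IsSeparated θ m η) {s t : ℕ} (hs : K ≤ s) (hst : s ≤ t)
    (hacc : ∀ u, s ≤ u → u < t → E.AccurateAt δ φ θ η u ω)
    (hopt : ∀ u, s ≤ u → u < t → E.OptimisticAt g φ θ m u ω)
    (hlong : δ * t ≤ ((t - s) / K : ℕ)) :
    (∀ a, E.mean (θ m) < E.mean (θ a) → a ∈ wellSampled δ φ t ω) ∧
      M ≤ ((wellSampled δ φ t ω).filter fun a => E.mean (θ m) ≤ E.mean (θ a)).card := by
  classical
  have hwell : ∀ a : Fin K, (∀ u, s ≤ u → u < t → (a : ℕ) + 1 ≡ u + 1 [MOD K] → a ∈ φ (u + 1) ω) →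
      a ∈ wellSampled δ φ t ω := by
    intro a h
    have := plays_add_div_le hK hst h
    refine mem_wellSampled_iff.2 (hlong.trans ?_)
    exact_mod_cast (Nat.le_add_left _ _).trans this
  refine ⟨fun a ha => hwell a fun u hu1 hu2 hau => ?_, ?_⟩
  · by_contra hnot
    have h := of_candidate_notMem halg (hs.trans hu1) (hacc u hu1 hu2) (hopt u hu1 hu2) ha.le hau
      hnot
    refine not_forall_mem_gt hm (hcard (u + 1) (by omega)) fun c hc => ?_
    have h1 := (h c hc).2
    have h2 := hsep.add_le ha
    change E.mean (θ m) < E.mean (θ c)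
    linarith
  · set Q := (Finset.Ico s t).filter fun u => ∃ a : Fin K, E.mean (θ m) ≤ E.mean (θ a) ∧
      (a : ℕ) + 1 ≡ u + 1 [MOD K] ∧ a ∉ φ (u + 1) ω with hQ
    rcases Q.eq_empty_or_nonempty with he | hne
    · refine hm.card_ge.trans (Finset.card_le_card fun a ha => ?_)
      have ha' := (Finset.mem_filter.1 ha).2
      refine Finset.mem_filter.2 ⟨hwell a fun u hu1 hu2 hau => ?_, ha'⟩
      by_contra hnot
      have : u ∈ Q := Finset.mem_filter.2 ⟨Finset.mem_Ico.2 ⟨hu1, hu2⟩, a, ha', hau, hnot⟩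
      rw [he] at this
      exact absurd this (Finset.notMem_empty u)
    · set u := Q.max' hne with hu
      obtain ⟨huI, a, ha, hau, hnot⟩ := Finset.mem_filter.1 (Q.max'_mem hne)
      rw [← hu] at huI hau hnot
      have huI' := Finset.mem_Ico.1 huI
      have h := of_candidate_notMem halg (hs.trans huI'.1) (hacc u huI'.1 huI'.2)
        (hopt u huI'.1 huI'.2) ha hau hnot
      rw [← hcard (u + 1) (by omega)]
      refine Finset.card_le_card fun c hc => ?_
      have hcG : E.mean (θ m) ≤ E.mean (θ c) :=
        hsep.le_of_lt (by linarith [(h c hc).2])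
      refine Finset.mem_filter.2 ⟨mem_wellSampled_iff.2 ?_, hcG⟩
      have h1 := plays_add_div_le (φ := φ) (ω := ω) hK (a := c) (s := u + 1) (t := t) (by omega)
        fun w hw1 hw2 hcw => by
          by_contra hcn
          have hwQ : w ∈ Q := Finset.mem_filter.2
            ⟨Finset.mem_Ico.2 ⟨by omega, hw2⟩, c, hcG, hcw, hcn⟩
          have := Q.le_max' w hwQ
          omega
      rw [plays_succ, if_pos hc] at h1
      have h2 := mem_wellSampled_iff.1 (h c hc).1
      have h3 : t - u ≤ (1 + (t - (u + 1)) / K) * K := by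
        have := Nat.lt_div_mul_add (a := t - (u + 1)) hK
        rw [add_mul, one_mul]
        omega
      have h4 : ((t : ℝ) - u) / K ≤ 1 + ((t - (u + 1)) / K : ℕ) := by
        rw [div_le_iff₀ (by exact_mod_cast hK), ← Nat.cast_sub huI'.2.le]
        exact_mod_cast h3
      have h5 : δ * (t - u) ≤ (t - u) / K := by
        have : (0 : ℝ) ≤ t - u := sub_nonneg.2 (by exact_mod_cast huI'.2.le)
        calc δ * (t - u) ≤ 1 / K * (t - u) := mul_le_mul_of_nonneg_right hδK this
          _ = _ := by ring
      have h6 : (plays φ c u ω : ℝ) + 1 + ((t - (u + 1)) / K : ℕ) ≤ plays φ c t ω := by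
        exact_mod_cast h1
      linarith

/-- If enough good arms are well-sampled, then a bad arm can only be played as the candidate whose
index exceeds the sample mean of a good arm. -/
theorem exists_klExt_le_of_mem (hK : 0 < K) (halg : E.IsRoundRobinKLUCB M δ g φ)
    (hsep : E.IsSeparated θ m η) {t : ℕ} (ht : K ≤ t) (hacc : E.AccurateAt δ φ θ η t ω)
    (hgood : M ≤ ((wellSampled δ φ t ω).filter fun a => E.mean (θ m) ≤ E.mean (θ a)).card)
    {b : Fin K} (hb : E.mean (θ b) < E.mean (θ m)) (hbφ : b ∈ φ (t + 1) ω) :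
    ∃ ν ∈ E.meanSpace, E.mean (θ m) - η < ν ∧
      E.klExt (E.empMean φ b t ω) ν ≤ ENNReal.ofReal (g t / plays φ b t ω) := by
  obtain ⟨L, hLW, hLc, hLmax, hstep⟩ := halg.step ω t ht
  have hLG : ∀ c ∈ L, E.mean (θ m) ≤ E.mean (θ c) := by
    intro c hc
    by_contra! hcB
    have hcB' := hsep.le_sub hcB
    have h1 := abs_lt.1 (hacc c (hLW hc))
    have hsub : insert c ((wellSampled δ φ t ω).filter fun a => E.mean (θ m) ≤ E.mean (θ a)) ⊆
        L := by
      intro d hd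
      rcases Finset.mem_insert.1 hd with rfl | hd
      · exact hc
      · obtain ⟨hdW, hdG⟩ := Finset.mem_filter.1 hd
        by_contra hdL
        have h2 := hLmax c hc d (Finset.mem_sdiff.2 ⟨hdW, hdL⟩)
        have h3 := abs_lt.1 (hacc d hdW)
        linarith
    have h4 := Finset.card_le_card hsub
    have hcn : c ∉ (wellSampled δ φ t ω).filter fun a => E.mean (θ m) ≤ E.mean (θ a) :=
      fun h => absurd (Finset.mem_filter.1 h).2 (not_le.2 hcB)
    rw [Finset.card_insert_of_notMem hcn] at h4
    omega
  have hbL : b ∉ L := fun h => absurd (hLG b h) (not_le.2 hb)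
  obtain ⟨b', hb'⟩ := exists_candidate K hK t
  by_cases hcase : b' ∈ L ∨ ∀ a ∈ L, E.ucb g φ b' t ω ≤ (E.empMean φ a t ω : EReal)
  · rw [(hstep b' hb').1 hcase] at hbφ
    exact absurd hbφ hbL
  · obtain ⟨c, -, -, hφ⟩ := (hstep b' hb').2 hcase
    rw [hφ] at hbφ
    have hbb : b = b' := by
      rcases Finset.mem_insert.1 hbφ with h | h
      · exact h
      · exact absurd (Finset.mem_of_mem_erase h) hbL
    rw [← hbb] at hcase
    push Not at hcase
    obtain ⟨-, d, hdL, hd⟩ := hcase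
    obtain ⟨_, ⟨ν, ⟨hν, hkl⟩, rfl⟩, hlt⟩ := lt_sSup_iff.1 hd
    have h1 := abs_lt.1 (hacc d (hLW hdL))
    have h2 := hLG d hdL
    have h3 : E.empMean φ d t ω < ν := EReal.coe_lt_coe_iff.1 hlt
    refine ⟨ν, hν, by linarith, ?_⟩
    rw [← EReal.coe_ennreal_le_coe_ennreal_iff, EReal.coe_ennreal_ofReal]
    exact hkl.trans (by exact_mod_cast le_max_left _ _)

end ExpFamily

/-! ### The exploration function and two estimates of analysis -/

/-- The exploration function `log t + 3 log log t`. -/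
def exploration (t : ℕ) : ℝ := Real.log t + 3 * Real.log (Real.log t)

theorem one_lt_log {t : ℕ} (ht : 3 ≤ t) : 1 < Real.log t := by
  have h3 : (3 : ℝ) ≤ t := by exact_mod_cast ht
  rw [Real.lt_log_iff_exp_lt (by linarith)]
  linarith [Real.exp_one_lt_d9]

theorem log_log_nonneg {t : ℕ} (ht : 3 ≤ t) : 0 ≤ Real.log (Real.log t) :=
  Real.log_nonneg (one_lt_log ht).le

theorem one_lt_exploration {t : ℕ} (ht : 3 ≤ t) : 1 < exploration t := by
  have := one_lt_log ht
  have := log_log_nonneg ht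
  rw [exploration]
  linarith

theorem exploration_mono {s t : ℕ} (hs : 3 ≤ s) (hst : s ≤ t) : exploration s ≤ exploration t := by
  have h1 : Real.log s ≤ Real.log t :=
    Real.log_le_log (by positivity) (by exact_mod_cast hst)
  have h2 : Real.log (Real.log s) ≤ Real.log (Real.log t) :=
    Real.log_le_log (by linarith [one_lt_log hs]) h1
  rw [exploration, exploration]
  linarith

theorem exp_neg_exploration {t : ℕ} (ht : 3 ≤ t) :
    Real.exp (-exploration t) = 1 / (t * Real.log t ^ 3) := by
  have h1 := one_lt_log ht
  have ht0 : (0 : ℝ) < t := by positivity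
  rw [exploration, Real.exp_neg, Real.exp_add, Real.exp_log ht0, mul_comm (3 : ℝ),
    Real.exp_mul, Real.exp_log (by linarith), one_div]
  norm_cast

theorem sum_inv_mul_log_le {T : ℕ} (hT : 2 ≤ T) :
    ∑ t ∈ Finset.Ico 3 (T + 1), 1 / ((t : ℝ) * Real.log t) ≤
      Real.log (Real.log T) - Real.log (Real.log 2) := by
  induction T, hT using Nat.le_induction with
  | base => simp
  | succ T hT ih =>
    rw [Finset.sum_Ico_succ_top (by omega)]
    have hT2 : (2 : ℝ) ≤ T := by exact_mod_cast hT
    have hlog : 0 < Real.log T := Real.log_pos (by linarith)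
    have hlog' : 1 < Real.log (T + 1 : ℕ) := one_lt_log (by omega)
    have h1 : 1 / ((T + 1 : ℕ) : ℝ) ≤ Real.log (T + 1 : ℕ) - Real.log T := by
      have h := Real.one_sub_inv_le_log_of_pos
        (show (0 : ℝ) < ((T + 1 : ℕ) : ℝ) / T by positivity)
      rw [Real.log_div (by positivity) (by positivity)] at h
      refine le_trans (le_of_eq ?_) h
      push_cast
      field_simp
      ring
    have h2 := Real.one_sub_inv_le_log_of_pos (show 0 < Real.log (T + 1 : ℕ) / Real.log T by
      exact div_pos (by linarith) hlog)
    rw [Real.log_div (by linarith) hlog.ne', inv_div] at h2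
    have h3 : 1 / (((T + 1 : ℕ) : ℝ) * Real.log (T + 1 : ℕ)) ≤
        1 - Real.log T / Real.log (T + 1 : ℕ) := by
      rw [one_div, mul_inv, ← div_eq_mul_inv, one_sub_div (by linarith)]
      rw [one_div] at h1
      gcongr
    linarith

namespace ExpFamily

variable {𝒳 : Type*} [MeasurableSpace 𝒳] {E : ExpFamily 𝒳} {K : ℕ}
variable {M : ℕ} {δ : ℝ} {φ : ℕ → Sample 𝒳 K → Finset (Fin K)} {θ : Fin K → ℝ}

/-! ### The probability of a bad event -/

variable (E) in
/-- A sample mean of at least `δ s` rewards is not `η`-accurate. -/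
def inaccurateEvent (θ : Fin K → ℝ) (δ η : ℝ) (s : ℕ) : Set (Sample 𝒳 K) :=
  {ω | ∃ a, ∃ n : ℕ, 1 ≤ n ∧ δ * s ≤ n ∧ η ≤ |E.sampleMean a n ω - E.mean (θ a)|}

variable (E) in
/-- A sample mean of at most `t` rewards has a large divergence from the true mean, as measured with
the exploration function at time `s`. -/
def deviationEvent (θ : Fin K → ℝ) (s t : ℕ) : Set (Sample 𝒳 K) :=
  {ω | ∃ a, ∃ n ∈ Finset.Icc 1 t,
    ENNReal.ofReal (exploration s / n) < E.klExt (E.sampleMean a n ω) (E.mean (θ a))}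

theorem exists_banditLaw_inaccurateEvent_le (hreg : IsOpen E.naturalSpace)
    (hθ : ∀ a, θ a ∈ E.naturalSpace) {η : ℝ} (hη : 0 < η) (hδ : 0 < δ) :
    ∃ C κ : ℝ, 0 ≤ C ∧ 0 < κ ∧ ∀ s : ℕ, E.banditLaw θ (E.inaccurateEvent θ δ η s) ≤
      ENNReal.ofReal (C * Real.exp (-(κ * s))) := by
  obtain ⟨c, hc, hdev⟩ := exists_banditLaw_abs_sampleMean_sub_le hreg hθ hη
  have hr0 : 0 ≤ Real.exp (-c) := (Real.exp_pos _).le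
  have hr1 : Real.exp (-c) < 1 := Real.exp_lt_one_iff.2 (by linarith)
  have hr1' : 0 < 1 - Real.exp (-c) := by linarith
  refine ⟨K * (2 * (1 - Real.exp (-c))⁻¹), c * δ, by positivity, by positivity, fun s => ?_⟩
  set n₀ := max 1 ⌈δ * s⌉₊ with hn₀
  have hsub : E.inaccurateEvent θ δ η s ⊆
      ⋃ a : Fin K, ⋃ k : ℕ, {ω | η ≤ |E.sampleMean a (n₀ + k) ω - E.mean (θ a)|} := by
    rintro ω ⟨a, n, hn1, hnδ, h⟩
    have hle : n₀ ≤ n := max_le hn1 (Nat.ceil_le.2 hnδ)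
    refine Set.mem_iUnion.2 ⟨a, Set.mem_iUnion.2 ⟨n - n₀, ?_⟩⟩
    rw [Set.mem_ofPred_eq, Nat.add_sub_cancel' hle]
    exact h
  have hterm : ∀ a : Fin K, ∀ k : ℕ,
      E.banditLaw θ {ω | η ≤ |E.sampleMean a (n₀ + k) ω - E.mean (θ a)|} ≤
        ENNReal.ofReal (2 * Real.exp (-(c * δ * s)) * Real.exp (-c) ^ k) := by
    intro a k
    refine (hdev a (n₀ + k) (by omega)).trans (ENNReal.ofReal_le_ofReal ?_)
    rw [mul_assoc, ← Real.exp_nat_mul, ← Real.exp_add]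
    gcongr
    have h1 : δ * s ≤ n₀ := (Nat.le_ceil _).trans (by exact_mod_cast le_max_right _ _)
    have := mul_le_mul_of_nonneg_left h1 hc.le
    push_cast
    linarith
  have hsum : Summable fun k : ℕ => 2 * Real.exp (-(c * δ * s)) * Real.exp (-c) ^ k :=
    (summable_geometric_of_lt_one hr0 hr1).mul_left _
  calc E.banditLaw θ (E.inaccurateEvent θ δ η s)
      ≤ ∑ a : Fin K, ∑' k : ℕ,
        E.banditLaw θ {ω | η ≤ |E.sampleMean a (n₀ + k) ω - E.mean (θ a)|} :=
        (measure_mono hsub).trans ((measure_iUnion_fintype_le _ _).trans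
          (Finset.sum_le_sum fun a _ => measure_iUnion_le _))
    _ ≤ ∑ _a : Fin K, ∑' k : ℕ,
        ENNReal.ofReal (2 * Real.exp (-(c * δ * s)) * Real.exp (-c) ^ k) :=
        Finset.sum_le_sum fun a _ => ENNReal.tsum_le_tsum fun k => hterm a k
    _ = _ := by
        rw [← ENNReal.ofReal_tsum_of_nonneg (fun k => by positivity) hsum, tsum_mul_left,
          tsum_geometric_of_lt_one hr0 hr1, Finset.sum_const, Finset.card_univ, Fintype.card_fin,
          nsmul_eq_mul, ← ENNReal.ofReal_natCast, ← ENNReal.ofReal_mul (Nat.cast_nonneg _)]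
        congr 1
        ring

theorem banditLaw_deviationEvent_le (hreg : IsOpen E.naturalSpace)
    (hmono : StrictMonoOn E.mean E.naturalSpace) (hθ : ∀ a, θ a ∈ E.naturalSpace) {s : ℕ}
    (hs : 3 ≤ s) (t : ℕ) : E.banditLaw θ (E.deviationEvent θ s t) ≤
      ENNReal.ofReal
        (K * ((exploration s * Real.log t + 1) * (2 * Real.exp (1 - exploration s)))) := by
  have hsub : E.deviationEvent θ s t ⊆ ⋃ a : Fin K, {ω | ∃ n ∈ Finset.Icc 1 t,
      ENNReal.ofReal (exploration s / n) < E.klExt (E.sampleMean a n ω) (E.mean (θ a))} := by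
    rintro ω ⟨a, h⟩
    exact Set.mem_iUnion.2 ⟨a, h⟩
  refine (measure_mono hsub).trans ((measure_iUnion_fintype_le _ _).trans
    ((Finset.sum_le_sum fun a _ => banditLaw_exists_lt_klExt_le hreg hmono hθ a t
      (one_lt_exploration hs)).trans_eq ?_))
  rw [Finset.sum_const, Finset.card_univ, Fintype.card_fin, nsmul_eq_mul, ← ENNReal.ofReal_natCast,
    ← ENNReal.ofReal_mul (Nat.cast_nonneg _)]

/-- The bad event at time `t`: something goes wrong between the times `⌈c t⌉` and `t`. -/
def badEvent (E : ExpFamily 𝒳) (θ : Fin K → ℝ) (δ η c : ℝ) (t : ℕ) : Set (Sample 𝒳 K) :=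
  E.inaccurateEvent θ δ η ⌈c * t⌉₊ ∪ E.deviationEvent θ ⌈c * t⌉₊ t

/-- The bad event at time `t` has a probability of the order `1 / (t log t)`; here the term
`3 log log t` of the exploration function beats the number of slices of the peeling. -/
theorem exists_banditLaw_badEvent_le (hreg : IsOpen E.naturalSpace)
    (hmono : StrictMonoOn E.mean E.naturalSpace) (hθ : ∀ a, θ a ∈ E.naturalSpace) {η c : ℝ}
    (hη : 0 < η) (hδ : 0 < δ) (hc : 0 < c) (hc1 : c ≤ 1) :
    ∃ C : ℝ, 0 ≤ C ∧ ∀ᶠ t : ℕ in atTop, E.banditLaw θ (E.badEvent θ δ η c t) ≤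
      ENNReal.ofReal (C * (1 / (t * Real.log t))) := by
  obtain ⟨C₁, κ, hC₁, hκ, h₁⟩ := exists_banditLaw_inaccurateEvent_le hreg hθ hη hδ
  refine ⟨C₁ * (2 / (κ * c) ^ 2) + K * (5 * (2 * (Real.exp 1 * (8 / c)))), by positivity, ?_⟩
  have hbig : ∀ᶠ t : ℕ in atTop, 3 / c ≤ (t : ℝ) ∧ (1 / c) ^ 2 ≤ (t : ℝ) :=
    (tendsto_natCast_atTop_atTop.eventually_ge_atTop _).and
      (tendsto_natCast_atTop_atTop.eventually_ge_atTop _)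
  filter_upwards [hbig, eventually_ge_atTop 3] with t ⟨ht1, ht2⟩ ht3
  set s := ⌈c * (t : ℝ)⌉₊ with hs
  have ht0 : (0 : ℝ) < t := by positivity
  have hsc : c * t ≤ s := Nat.le_ceil _
  have hs3 : 3 ≤ s := by
    have : (3 : ℝ) ≤ s := by
      rw [div_le_iff₀ hc] at ht1
      linarith
    exact_mod_cast this
  have hst : s ≤ t := Nat.ceil_le.2 (mul_le_of_le_one_left ht0.le hc1)
  have hlt : 1 < Real.log t := one_lt_log ht3
  have hls : 1 < Real.log s := one_lt_log hs3
  have hlst : Real.log s ≤ Real.log t :=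
    Real.log_le_log (by positivity) (by exact_mod_cast hst)
  have hhalf : Real.log t / 2 ≤ Real.log s := by
    have h : (t : ℝ) ≤ (c * t) ^ 2 := by
      rw [div_pow, one_pow, div_le_iff₀ (by positivity)] at ht2
      nlinarith
    have h2 := Real.log_le_log ht0 (h.trans (pow_le_pow_left₀ (by positivity) hsc 2))
    rw [Real.log_pow] at h2
    push_cast at h2
    linarith
  have hI : C₁ * Real.exp (-(κ * s)) ≤ C₁ * (2 / (κ * c) ^ 2) * (1 / (t * Real.log t)) := by
    rw [mul_assoc]
    refine mul_le_mul_of_nonneg_left ?_ hC₁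
    have h1 : Real.exp (-(κ * s)) ≤ Real.exp (-(κ * c * t)) := by
      refine Real.exp_le_exp.2 ?_
      have := mul_le_mul_of_nonneg_left hsc hκ.le
      linarith
    have h2 : (κ * c * t) ^ 2 / 2 ≤ Real.exp (κ * c * t) := by
      have := Real.quadratic_le_exp_of_nonneg (show 0 ≤ κ * c * t by positivity)
      have : 0 ≤ κ * c * t := by positivity
      linarith
    have h3 : Real.log t ≤ t := (Real.log_le_sub_one_of_pos ht0).trans (by linarith)
    calc Real.exp (-(κ * s)) ≤ Real.exp (-(κ * c * t)) := h1
      _ = (Real.exp (κ * c * t))⁻¹ := Real.exp_neg _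
      _ ≤ ((κ * c * t) ^ 2 / 2)⁻¹ := inv_anti₀ (by positivity) h2
      _ = 2 / (κ * c) ^ 2 * (1 / (t * t)) := by field_simp
      _ ≤ _ := by gcongr
  have hD : K * ((exploration s * Real.log t + 1) * (2 * Real.exp (1 - exploration s))) ≤
      K * (5 * (2 * (Real.exp 1 * (8 / c)))) * (1 / (t * Real.log t)) := by
    rw [mul_assoc]
    refine mul_le_mul_of_nonneg_left ?_ (Nat.cast_nonneg _)
    have h1 : exploration s ≤ 4 * Real.log t := by
      have := Real.log_le_sub_one_of_pos (show 0 < Real.log s by linarith)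
      rw [exploration]
      linarith
    have h2 : exploration s * Real.log t + 1 ≤ 5 * Real.log t ^ 2 := by nlinarith
    have h3 : Real.exp (1 - exploration s) ≤ Real.exp 1 * (8 / c) * (1 / (t * Real.log t ^ 3)) := by
      rw [sub_eq_add_neg, Real.exp_add, exp_neg_exploration hs3, mul_assoc]
      refine mul_le_mul_of_nonneg_left ?_ (Real.exp_pos _).le
      have h4 : c * t * (Real.log t / 2) ^ 3 ≤ s * Real.log s ^ 3 := by
        gcongr
      calc 1 / ((s : ℝ) * Real.log s ^ 3) ≤ 1 / (c * t * (Real.log t / 2) ^ 3) :=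
            one_div_le_one_div_of_le (by positivity) h4
        _ = _ := by field_simp; norm_num
    calc (exploration s * Real.log t + 1) * (2 * Real.exp (1 - exploration s))
        ≤ (5 * Real.log t ^ 2) *
          (2 * (Real.exp 1 * (8 / c) * (1 / (t * Real.log t ^ 3)))) := by gcongr
      _ = _ := by field_simp
  calc E.banditLaw θ (E.badEvent θ δ η c t)
      ≤ ENNReal.ofReal (C₁ * Real.exp (-(κ * s))) + ENNReal.ofReal
        (K * ((exploration s * Real.log t + 1) * (2 * Real.exp (1 - exploration s)))) :=
        (measure_union_le _ _).trans (add_le_add (h₁ s)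
          (banditLaw_deviationEvent_le hreg hmono hθ hs3 t))
    _ ≤ _ := by
        rw [add_mul (C₁ * _), ENNReal.ofReal_add (by positivity) (by positivity)]
        exact add_le_add (ENNReal.ofReal_le_ofReal hI) (ENNReal.ofReal_le_ofReal hD)

end ExpFamily

/-! ### Counting the plays of the algorithm -/

/-- A counter with increments in `{0, 1}` is bounded by its initial segment, the number of
exceptional times, and the number of exceptional values that it leaves. -/
theorem counter_le {p : ℕ → ℕ} {T₀ : ℕ} (h₀ : ∀ t, p t ≤ t) {B F : ℕ → ℝ} (hB : ∀ t, 0 ≤ B t)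
    (hF : ∀ n, 0 ≤ F n) {T : ℕ}
    (h : ∀ t, T₀ ≤ t → t < T → p (t + 1) = p t ∨ p (t + 1) = p t + 1 ∧ 1 ≤ B t + F (p t)) :
    (p T : ℝ) ≤ T₀ + ∑ t ∈ Finset.Ico T₀ T, B t + ∑ n ∈ Finset.range (p T), F n := by
  have hF' : ∀ n, 0 ≤ ∑ k ∈ Finset.range n, F k := fun n => Finset.sum_nonneg fun k _ => hF k
  rcases le_total T T₀ with hT | hT
  · have h1 : (p T : ℝ) ≤ T₀ := by exact_mod_cast (h₀ T).trans hT
    have := hF' (p T)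
    have := Finset.sum_nonneg fun t (_ : t ∈ Finset.Ico T₀ T) => hB t
    linarith
  · induction T, hT using Nat.le_induction with
    | base =>
      have h1 : (p T₀ : ℝ) ≤ T₀ := by exact_mod_cast h₀ T₀
      have := hF' (p T₀)
      simp only [Finset.Ico_self, Finset.sum_empty]
      linarith
    | succ T hT ih =>
      have ih' := ih fun t h1 h2 => h t h1 (by omega)
      rw [Finset.sum_Ico_succ_top hT]
      rcases h T hT (by omega) with h1 | ⟨h1, h2⟩
      · rw [h1]
        have := hB T
        linarith
      · rw [h1, Finset.sum_range_succ]
        push_cast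
        linarith

theorem sum_range_indicator_le {x : ℝ} (hx : 0 ≤ x) (T : ℕ) :
    ∑ n ∈ Finset.range T, (if (n : ℝ) ≤ x then (1 : ℝ) else 0) ≤ x + 1 := by
  rw [Finset.sum_boole]
  have hsub : ((Finset.range T).filter fun n : ℕ => (n : ℝ) ≤ x) ⊆ Finset.range (⌊x⌋₊ + 1) :=
    fun n hn => Finset.mem_range.2 (Nat.lt_succ_of_le (Nat.le_floor (Finset.mem_filter.1 hn).2))
  have h1 := Finset.card_le_card hsub
  rw [Finset.card_range] at h1
  calc (((Finset.range T).filter fun n : ℕ => (n : ℝ) ≤ x).card : ℝ) ≤ (⌊x⌋₊ + 1 : ℕ) := by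
        exact_mod_cast h1
    _ ≤ x + 1 := by
        push_cast
        linarith [Nat.floor_le hx]

namespace ExpFamily

/-- The time between `⌈c t⌉` and `t` suffices for the round-robin schedule to make arms
well-sampled. -/
theorem eventually_window {K : ℕ} (hK : 0 < K) {δ : ℝ} (hδ : 0 < δ) (hδK : δ < 1 / K) :
    ∃ c : ℝ, 0 < c ∧ c ≤ 1 ∧ ∀ᶠ t : ℕ in atTop, 3 ≤ ⌈c * t⌉₊ ∧ K ≤ ⌈c * t⌉₊ ∧ ⌈c * t⌉₊ ≤ t ∧
      δ * t ≤ ((t - ⌈c * t⌉₊) / K : ℕ) := by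
  have hK0 : (0 : ℝ) < K := by exact_mod_cast hK
  have hδK' : δ * K < 1 := (lt_div_iff₀ hK0).1 hδK
  have hδK0 : 0 < δ * K := by positivity
  -- `K δ t` rounds are needed, and `c t` more absorb the rounding
  refine ⟨(1 - δ * K) / 2, by linarith, by linarith, ?_⟩
  set c := (1 - δ * K) / 2 with hc
  have hc0 : 0 < c := by linarith
  filter_upwards [tendsto_natCast_atTop_atTop.eventually_ge_atTop (3 / c),
    tendsto_natCast_atTop_atTop.eventually_ge_atTop ((K + 1) / c)] with t h3 hKt
  rw [div_le_iff₀ hc0] at h3 hKt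
  have hle := Nat.le_ceil (c * (t : ℝ))
  have hlt := Nat.ceil_lt_add_one (show 0 ≤ c * (t : ℝ) by positivity)
  set s := ⌈c * (t : ℝ)⌉₊ with hs
  have hst : s ≤ t := Nat.ceil_le.2 (mul_le_of_le_one_left (Nat.cast_nonneg _) (by linarith))
  refine ⟨?_, ?_, hst, ?_⟩
  · have : (3 : ℝ) ≤ s := by linarith
    exact_mod_cast this
  · have : (K : ℝ) ≤ s := by linarith
    exact_mod_cast this
  · have h1 : ((t - s : ℕ) : ℝ) ≤ ((t - s) / K : ℕ) * K + K := by
      exact_mod_cast (Nat.lt_div_mul_add (a := t - s) hK).le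
    rw [Nat.cast_sub hst] at h1
    refine le_of_mul_le_mul_right ?_ hK0
    have h2 : δ * K = 1 - 2 * c := by rw [hc]; ring
    have h3 : δ * t * K = t - 2 * (t * c) := by
      rw [mul_right_comm, h2]
      ring
    linarith

variable {𝒳 : Type*} [MeasurableSpace 𝒳] {E : ExpFamily 𝒳} {K : ℕ}
variable {M : ℕ} {δ : ℝ} {φ : ℕ → Sample 𝒳 K → Finset (Fin K)} {θ : Fin K → ℝ}
variable {ω : Sample 𝒳 K} {m : Fin K} {η : ℝ}

theorem one_le_plays {g : ℕ → ℝ} (hM : 1 ≤ M) (halg : E.IsRoundRobinKLUCB M δ g φ) (a : Fin K)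
    {t : ℕ} (ht : K ≤ t) : 1 ≤ plays φ a t ω :=
  (hM.trans_eq (halg.init ω a).symm).trans (plays_mono a ω ht)

/-- Outside of the bad event at time `t`, the better arms are played, and a bad arm is played only
if its index exceeds the mean of the threshold arm, up to `η`. -/
theorem of_notMem_badEvent (hM : 1 ≤ M) (hK : 0 < K) (hδ : 0 < δ) (hδK : δ ≤ 1 / K) (hη : 0 < η)
    (hθ : ∀ a, θ a ∈ E.naturalSpace) (hcard : ∀ t, 1 ≤ t → (φ t ω).card = M)
    (halg : E.IsRoundRobinKLUCB M δ exploration φ) (hm : IsThreshold M (fun a => E.mean (θ a)) m)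
    (hsep : E.IsSeparated θ m η) {c : ℝ} {t : ℕ} (hs3 : 3 ≤ ⌈c * t⌉₊) (hKs : K ≤ ⌈c * t⌉₊)
    (hst : ⌈c * t⌉₊ ≤ t) (hlong : δ * t ≤ ((t - ⌈c * t⌉₊) / K : ℕ))
    (hω : ω ∉ E.badEvent θ δ η c t) :
    (∀ a, E.mean (θ m) < E.mean (θ a) → a ∈ φ (t + 1) ω) ∧
      ∀ b, E.mean (θ b) < E.mean (θ m) → b ∈ φ (t + 1) ω → ∃ ν ∈ E.meanSpace,
        E.mean (θ m) - η < ν ∧ E.klExt (E.sampleMean b (plays φ b t ω) ω) ν ≤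
          ENNReal.ofReal (exploration t / plays φ b t ω) := by
  set s := ⌈c * (t : ℝ)⌉₊ with hs
  have hinacc : ω ∉ E.inaccurateEvent θ δ η s := fun h => hω (Or.inl h)
  have hdev : ω ∉ E.deviationEvent θ s t := fun h => hω (Or.inr h)
  have hacc : ∀ u, s ≤ u → u ≤ t → E.AccurateAt δ φ θ η u ω := by
    intro u hu1 _ a ha
    by_contra! hge
    refine hinacc ⟨a, plays φ a u ω, one_le_plays hM halg a (hKs.trans hu1), ?_, hge⟩
    have hsu : (s : ℝ) ≤ u := by exact_mod_cast hu1
    exact (mul_le_mul_of_nonneg_left hsu hδ.le).trans (mem_wellSampled_iff.1 ha)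
  have hopt : ∀ u, s ≤ u → u < t → E.OptimisticAt exploration φ θ m u ω := by
    intro u hu1 hu2 a _
    refine le_sSup ⟨E.mean (θ a), ⟨mean_mem_meanSpace (hθ a), ?_⟩, rfl⟩
    have h1 : E.klExt (E.sampleMean a (plays φ a u ω) ω) (E.mean (θ a)) ≤
        ENNReal.ofReal (exploration s / plays φ a u ω) := by
      by_contra! hlt
      exact hdev ⟨a, plays φ a u ω, Finset.mem_Icc.2
        ⟨one_le_plays hM halg a (hKs.trans hu1), (plays_le a u ω).trans hu2.le⟩, hlt⟩
    have hmono := exploration_mono hs3 hu1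
    have h2 : exploration s / plays φ a u ω ≤ exploration u / plays φ a u ω := by gcongr
    have h3 : 0 ≤ exploration u / plays φ a u ω :=
      div_nonneg (by linarith [one_lt_exploration hs3]) (Nat.cast_nonneg _)
    have h4 := EReal.coe_ennreal_le_coe_ennreal_iff.2 (h1.trans (ENNReal.ofReal_le_ofReal h2))
    rwa [EReal.coe_ennreal_ofReal, max_eq_left h3] at h4
  obtain ⟨hG, hgood⟩ := wellSampled_of_window hK hδK hη hcard halg hm hsep hKs hst
    (fun u h1 h2 => hacc u h1 h2.le) hopt hlong
  exact ⟨fun a ha => mem_of_wellSampled hK halg hm hsep (hKs.trans hst) (hacc t hst le_rfl) ha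
    (hG a ha), fun b hb hbφ => exists_klExt_le_of_mem hK halg hsep (hKs.trans hst)
      (hacc t hst le_rfl) hgood hb hbφ⟩

/-- Up to a multiple of `log log T`, a bad arm is played at most `g(T) / κ` times, where `κ` is
below the divergence of slight perturbations of its parameter and of the threshold parameter; and
the better arms are not played only in `O(log log T)` rounds. The constant does not depend on the
rule. -/
theorem exists_integral_plays_le (hreg : IsOpen E.naturalSpace)
    (hmono : StrictMonoOn E.mean E.naturalSpace) (hM : 1 ≤ M) (hδ : 0 < δ) (hδK : δ < 1 / K)
    (hη : 0 < η) (hθ : ∀ a, θ a ∈ E.naturalSpace) (hm : IsThreshold M (fun a => E.mean (θ a)) m)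
    (hsep : E.IsSeparated θ m η) :
    ∃ C : ℝ, 0 ≤ C ∧ ∀ φ : ℕ → Sample 𝒳 K → Finset (Fin K), E.IsAllocationRule M φ →
      E.IsRoundRobinKLUCB M δ exploration φ → ∀ T : ℕ, 3 ≤ T →
      (∀ a, E.mean (θ m) < E.mean (θ a) →
        T - ∫ ω, (plays φ a T ω : ℝ) ∂(E.banditLaw θ) ≤ C * (Real.log (Real.log T) + 1)) ∧
      ∀ b, E.mean (θ b) < E.mean (θ m) → ∀ κ θ₁ θ₂ : ℝ, 0 < κ → θ₁ ∈ E.naturalSpace →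
        θ₂ ∈ E.naturalSpace → θ₁ ≤ θ₂ → E.mean (θ b) + η ≤ E.mean θ₁ →
        E.mean θ₂ ≤ E.mean (θ m) - η → κ < klNat E θ₁ θ₂ →
        ∫ ω, (plays φ b T ω : ℝ) ∂(E.banditLaw θ) ≤
          exploration T / κ + C * (Real.log (Real.log T) + 1) := by
  have hK0 : 0 < K := m.pos
  have := isProbabilityMeasure_banditLaw hθ
  set P := E.banditLaw θ with hP
  obtain ⟨c, hc0, hc1, hwin⟩ := eventually_window hK0 hδ hδK
  obtain ⟨C₀, hC₀, hprob⟩ := exists_banditLaw_badEvent_le hreg hmono hθ hη hδ hc0 hc1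
  choose d hd hdev using fun b => exists_banditLaw_add_le_sampleMean_le hreg hθ b hη
  obtain ⟨T₀, hT₀⟩ := eventually_atTop.1 ((hwin.and hprob).and (eventually_ge_atTop 3))
  -- the measurability of the bad events is not known, as they involve `klExt`
  set B : ℕ → Set (Sample 𝒳 K) := fun t => toMeasurable P (E.badEvent θ δ η c t) with hB
  have hBm : ∀ t, MeasurableSet (B t) := fun t => measurableSet_toMeasurable _ _
  set l := -Real.log (Real.log 2) with hl
  have hl0 : 0 ≤ l := by
    have h1 : Real.log (Real.log 2) ≤ 0 :=
      Real.log_nonpos (Real.log_nonneg (by norm_num)) (by linarith [Real.log_two_lt_d9])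
    linarith
  set D := ∑ b, (1 - Real.exp (-d b))⁻¹ with hD
  have hr1 : ∀ b, Real.exp (-d b) < 1 := fun b => Real.exp_lt_one_iff.2 (by linarith [hd b])
  have hD0 : ∀ b, 0 ≤ (1 - Real.exp (-d b))⁻¹ := fun b => inv_nonneg.2 (by linarith [hr1 b])
  have hD0' : 0 ≤ D := Finset.sum_nonneg fun b _ => hD0 b
  have hsumB : ∀ T : ℕ, 3 ≤ T → ∑ t ∈ Finset.Ico T₀ T, P.real (B t) ≤
      C₀ * (Real.log (Real.log T) + l) := by
    intro T hT
    calc ∑ t ∈ Finset.Ico T₀ T, P.real (B t)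
        ≤ ∑ t ∈ Finset.Ico T₀ T, C₀ * (1 / (t * Real.log t)) := by
          refine Finset.sum_le_sum fun t ht => ?_
          have h3 := (hT₀ t (Finset.mem_Ico.1 ht).1).2
          have hlog := one_lt_log h3
          refine ENNReal.toReal_le_of_le_ofReal (by positivity) ?_
          rw [hB, measure_toMeasurable]
          exact (hT₀ t (Finset.mem_Ico.1 ht).1).1.2
      _ = C₀ * ∑ t ∈ Finset.Ico T₀ T, 1 / (t * Real.log t) := by rw [Finset.mul_sum]
      _ ≤ C₀ * ∑ t ∈ Finset.Ico 3 (T + 1), 1 / (t * Real.log t) := by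
          refine mul_le_mul_of_nonneg_left (Finset.sum_le_sum_of_subset_of_nonneg ?_ ?_) hC₀
          · intro t ht
            have h3 := (hT₀ t (Finset.mem_Ico.1 ht).1).2
            have := Finset.mem_Ico.1 ht
            exact Finset.mem_Ico.2 ⟨h3, by omega⟩
          · intro t ht _
            have := one_lt_log (Finset.mem_Ico.1 ht).1
            positivity
      _ ≤ C₀ * (Real.log (Real.log T) + l) :=
          mul_le_mul_of_nonneg_left (by rw [hl, ← sub_eq_add_neg]
                                        exact sum_inv_mul_log_le (by omega)) hC₀
  have hsumD : ∀ (b : Fin K) (T : ℕ), ∑ n ∈ Finset.range T,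
      P.real {ω | E.mean (θ b) + η ≤ E.sampleMean b n ω} ≤ D := by
    intro b T
    calc ∑ n ∈ Finset.range T, P.real {ω | E.mean (θ b) + η ≤ E.sampleMean b n ω}
        ≤ ∑ n ∈ Finset.range T, Real.exp (-d b) ^ n := by
          refine Finset.sum_le_sum fun n _ => ?_
          rcases Nat.eq_zero_or_pos n with rfl | hn
          · rw [pow_zero]
            exact measureReal_le_one
          · rw [← Real.exp_nat_mul]
            refine ENNReal.toReal_le_of_le_ofReal (Real.exp_pos _).le ((hdev b n hn).trans_eq ?_)
            congr 2
            ring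
      _ ≤ (1 - Real.exp (-d b))⁻¹ := by
          rw [← tsum_geometric_of_lt_one (Real.exp_pos _).le (hr1 b)]
          exact (summable_geometric_of_lt_one (Real.exp_pos _).le (hr1 b)).sum_le_tsum _
            fun n _ => by positivity
      _ ≤ D := Finset.single_le_sum (fun b _ => hD0 b) (Finset.mem_univ b)
  have hint : ∀ (I : Finset ℕ) (A : ℕ → Set (Sample 𝒳 K)), (∀ t, MeasurableSet (A t)) →
      Integrable (fun ω => ∑ t ∈ I, (A t).indicator (fun _ => (1 : ℝ)) ω) P ∧
      ∫ ω, ∑ t ∈ I, (A t).indicator (fun _ => (1 : ℝ)) ω ∂P = ∑ t ∈ I, P.real (A t) := by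
    intro I A hA
    have h1 : ∀ t ∈ I, Integrable ((A t).indicator (fun _ => (1 : ℝ))) P := fun t _ =>
      (integrable_const 1).indicator (hA t)
    refine ⟨integrable_finsetSum _ h1, ?_⟩
    rw [integral_finsetSum _ h1]
    refine Finset.sum_congr rfl fun t _ => ?_
    rw [integral_indicator_const _ (hA t), smul_eq_mul, mul_one]
  refine ⟨T₀ + C₀ * (1 + l) + 1 + D, by positivity, fun φ hφ halg T hT => ?_⟩
  have hll := log_log_nonneg hT
  have hconst : T₀ + C₀ * (Real.log (Real.log T) + l) + 1 + D ≤
      (T₀ + C₀ * (1 + l) + 1 + D) * (Real.log (Real.log T) + 1) := by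
    have h1 : 0 ≤ (T₀ + C₀ * l + 1 + D) * Real.log (Real.log T) := by positivity
    linarith
  have hpath : ∀ ω t, T₀ ≤ t → ω ∉ B t → _ := fun ω t ht hω =>
    of_notMem_badEvent hM hK0 hδ hδK.le hη hθ (fun t ht => (hφ t ht).1 ω) halg hm hsep
      (hT₀ t ht).1.1.1 (hT₀ t ht).1.1.2.1 (hT₀ t ht).1.1.2.2.1 (hT₀ t ht).1.1.2.2.2
      fun h => hω (subset_toMeasurable _ _ h)
  have hind : ∀ (A : Set (Sample 𝒳 K)) ω, 0 ≤ A.indicator (fun _ => (1 : ℝ)) ω := fun A ω =>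
    Set.indicator_nonneg (fun _ _ => zero_le_one) ω
  refine ⟨fun a ha => ?_, fun b hb κ θ₁ θ₂ hκ h₁ h₂ h₁₂ hb₁ h₂m hκlt => ?_⟩
  · have hcount : ∀ ω, (T : ℝ) - plays φ a T ω ≤
        T₀ + ∑ t ∈ Finset.Ico T₀ T, (B t).indicator (fun _ => (1 : ℝ)) ω := by
      intro ω
      have h := counter_le (p := fun t => t - plays φ a t ω) (T₀ := T₀) (fun t => Nat.sub_le _ _)
        (B := fun t => (B t).indicator (fun _ => (1 : ℝ)) ω) (F := fun _ => 0)
        (fun t => hind _ _) (fun _ => le_rfl) (T := T) (fun t ht _ => by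
          have hle := plays_le (φ := φ) a t ω
          by_cases hω : ω ∈ B t
          · rw [plays_succ, Set.indicator_of_mem hω]
            split_ifs
            · left; omega
            · right
              exact ⟨by omega, by norm_num⟩
          · left
            rw [plays_succ, if_pos ((hpath ω t ht hω).1 a ha)]
            omega)
      simpa [Nat.cast_sub (plays_le a T ω)] using h
    have hpi := integrable_plays hθ hφ a T
    have h1 : (T : ℝ) - ∫ ω, (plays φ a T ω : ℝ) ∂P = ∫ ω, ((T : ℝ) - plays φ a T ω) ∂P := by
      rw [integral_sub (integrable_const _) hpi, integral_const, probReal_univ, one_smul]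
    obtain ⟨hi, hie⟩ := hint (Finset.Ico T₀ T) B hBm
    have h2 := integral_mono ((integrable_const _).sub hpi) ((integrable_const _).add hi) hcount
    have h3 : ∫ ω, ((T₀ : ℝ) + ∑ t ∈ Finset.Ico T₀ T, (B t).indicator (fun _ => (1 : ℝ)) ω) ∂P =
        T₀ + ∑ t ∈ Finset.Ico T₀ T, P.real (B t) := by
      rw [integral_add (integrable_const _) hi, integral_const, probReal_univ, one_smul, hie]
    rw [h1]
    have h4 := hsumB T hT
    refine le_trans h2 (le_trans h3.le ?_)
    linarith
  · set Dev : ℕ → Set (Sample 𝒳 K) := fun n => {ω | E.mean (θ b) + η ≤ E.sampleMean b n ω} with hDev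
    have hDevm : ∀ n, MeasurableSet (Dev n) := fun n =>
      measurableSet_le measurable_const (measurable_sampleMean b n)
    have hg0 : 0 ≤ exploration T / κ := div_nonneg (by linarith [one_lt_exploration hT]) hκ.le
    have hcount : ∀ ω, (plays φ b T ω : ℝ) ≤
        (T₀ + exploration T / κ + 1) +
          (∑ t ∈ Finset.Ico T₀ T, (B t).indicator (fun _ => (1 : ℝ)) ω +
          ∑ n ∈ Finset.range T, (Dev n).indicator (fun _ => (1 : ℝ)) ω) := by
      intro ω
      set F : ℕ → ℝ := fun n => (if (n : ℝ) ≤ exploration T / κ then (1 : ℝ) else 0) +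
        (Dev n).indicator (fun _ => (1 : ℝ)) ω with hF
      have hif : ∀ n : ℕ, (0 : ℝ) ≤ if (n : ℝ) ≤ exploration T / κ then (1 : ℝ) else 0 := by
        intro n
        split_ifs <;> norm_num
      have hF0 : ∀ n, 0 ≤ F n := fun n => add_nonneg (hif n) (hind _ _)
      -- a play outside of the bad events happens at a sample size that is small or deviating
      have h := counter_le (p := fun t => plays φ b t ω) (T₀ := T₀) (fun t => plays_le b t ω)
        (B := fun t => (B t).indicator (fun _ => (1 : ℝ)) ω) (F := F) (fun t => hind _ _) hF0
        (T := T) (fun t ht htT => by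
          rw [plays_succ]
          split_ifs with hbt
          · refine Or.inr ⟨rfl, ?_⟩
            by_cases hω : ω ∈ B t
            · rw [Set.indicator_of_mem hω]
              linarith [hF0 (plays φ b t ω)]
            · rw [Set.indicator_of_notMem hω, zero_add]
              by_cases hdv : ω ∈ Dev (plays φ b t ω)
              · rw [hF]
                simp only
                rw [Set.indicator_of_mem hdv]
                linarith [hif (plays φ b t ω)]
              -- an accurate sample mean: the index of `b` exceeds the threshold only if
              -- `KL` is at most `g(T) / n` there
              · obtain ⟨ν, hν, hmν, hle⟩ := (hpath ω t ht hω).2 b hb hbt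
                have hlt : E.sampleMean b (plays φ b t ω) ω < E.mean θ₁ :=
                  (not_le.1 hdv).trans_le hb₁
                have h1 := (klNat_le_klExt hreg hmono h₁ h₂ hν hlt h₁₂ (by linarith)).trans hle
                have h3 := (hT₀ t ht).2
                have hn : (0 : ℝ) < plays φ b t ω := by
                  exact_mod_cast one_le_plays hM halg b
                    ((hT₀ t ht).1.1.2.1.trans (hT₀ t ht).1.1.2.2.1)
                have h2 := (ENNReal.ofReal_le_ofReal_iff (div_nonneg
                  (by linarith [one_lt_exploration h3]) hn.le)).1 h1
                have h4 : (plays φ b t ω : ℝ) ≤ exploration T / κ := by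
                  rw [le_div_iff₀ hκ, mul_comm, ← le_div_iff₀ hn]
                  have := exploration_mono h3 htT.le
                  calc κ ≤ exploration t / plays φ b t ω := hκlt.le.trans h2
                    _ ≤ _ := by gcongr
                rw [hF]
                simp only
                rw [if_pos h4]
                linarith [hind (Dev (plays φ b t ω)) ω]
          · exact Or.inl rfl)
      have h5 : ∑ n ∈ Finset.range (plays φ b T ω), F n ≤ ∑ n ∈ Finset.range T, F n :=
        Finset.sum_le_sum_of_subset_of_nonneg
          (Finset.range_subset_range.2 (plays_le b T ω)) fun n _ _ => hF0 n
      have h6 : ∑ n ∈ Finset.range T, F n ≤ exploration T / κ + 1 +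
          ∑ n ∈ Finset.range T, (Dev n).indicator (fun _ => (1 : ℝ)) ω := by
        rw [hF, Finset.sum_add_distrib]
        linarith [sum_range_indicator_le hg0 T]
      linarith
    obtain ⟨hi, hie⟩ := hint (Finset.Ico T₀ T) B hBm
    obtain ⟨hi', hie'⟩ := hint (Finset.range T) Dev hDevm
    have h2 := integral_mono (integrable_plays hθ hφ b T)
      ((integrable_const _).add (hi.add hi')) hcount
    refine h2.trans ?_
    have h3 := integral_add (μ := P) (integrable_const (T₀ + exploration T / κ + 1)) (hi.add hi')
    have h4 := integral_add hi hi'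
    rw [integral_const, probReal_univ, one_smul] at h3
    simp only [Pi.add_apply] at h3 h4 ⊢
    rw [h3, h4, hie, hie']
    have h5 := hsumB T hT
    have h6 := hsumD b T
    linarith

end ExpFamily

/-! ### The regret of the algorithm -/

theorem tendsto_log_log_add_one_div_log :
    Tendsto (fun T : ℕ => (Real.log (Real.log T) + 1) / Real.log T) atTop (𝓝 0) := by
  have h1 : Tendsto (fun T : ℕ => Real.log T) atTop atTop :=
    Real.tendsto_log_atTop.comp tendsto_natCast_atTop_atTop
  have h2 := (Real.isLittleO_log_id_atTop.tendsto_div_nhds_zero).comp h1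
  have h3 := h2.add (tendsto_inv_atTop_zero.comp h1)
  rw [add_zero] at h3
  refine h3.congr fun T => ?_
  simp [add_div]

namespace ExpFamily

variable {𝒳 : Type*} [MeasurableSpace 𝒳] {E : ExpFamily 𝒳} {K : ℕ}
variable {M : ℕ} {δ : ℝ} {φ : ℕ → Sample 𝒳 K → Finset (Fin K)} {θ : Fin K → ℝ} {m : Fin K}

/-- Two parameters can be moved slightly towards each other, keeping their divergence above any
smaller number. -/
theorem exists_perturbation (hreg : IsOpen E.naturalSpace)
    (hmono : StrictMonoOn E.mean E.naturalSpace) {θ₀ θ₃ κ : ℝ} (h₀ : θ₀ ∈ E.naturalSpace)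
    (h₃ : θ₃ ∈ E.naturalSpace) (h₀₃ : E.mean θ₀ < E.mean θ₃) (hκ : κ < E.klNat θ₀ θ₃) :
    ∃ e > 0, ∃ θ₁ ∈ E.naturalSpace, ∃ θ₂ ∈ E.naturalSpace, θ₁ ≤ θ₂ ∧
      E.mean θ₀ + e ≤ E.mean θ₁ ∧ E.mean θ₂ ≤ E.mean θ₃ - e ∧ κ < E.klNat θ₁ θ₂ := by
  have hlt : θ₀ < θ₃ := (hmono.lt_iff_lt h₀ h₃).1 h₀₃
  have hc₂ : ContinuousAt (fun x => E.klNat θ₀ x) θ₃ :=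
    (continuousOn_klNat_right hreg θ₀).continuousAt (hreg.mem_nhds h₃)
  obtain ⟨θ₂, hκ₂, h₂⟩ := ((hc₂.eventually (lt_mem_nhds hκ)).filter_mono nhdsWithin_le_nhds |>.and
    (Ioo_mem_nhdsLT hlt)).exists
  have h₂' : θ₂ ∈ E.naturalSpace := E.ordConnected_naturalSpace.out h₀ h₃ ⟨h₂.1.le, h₂.2.le⟩
  have hc₁ : ContinuousAt (fun x => E.klNat x θ₂) θ₀ :=
    (continuousOn_klNat_left hreg θ₂).continuousAt (hreg.mem_nhds h₀)
  obtain ⟨θ₁, hκ₁, h₁⟩ := ((hc₁.eventually (lt_mem_nhds hκ₂)).filter_mono nhdsWithin_le_nhds |>.and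
    (Ioo_mem_nhdsGT h₂.1)).exists
  have h₁' : θ₁ ∈ E.naturalSpace := E.ordConnected_naturalSpace.out h₀ h₂' ⟨h₁.1.le, h₁.2.le⟩
  have hm₁ := hmono h₀ h₁' h₁.1
  have hm₂ := hmono h₂' h₃ h₂.2
  refine ⟨min (E.mean θ₁ - E.mean θ₀) (E.mean θ₃ - E.mean θ₂),
    lt_min (by linarith) (by linarith), θ₁, h₁', θ₂, h₂', h₁.2.le, ?_, ?_, hκ₁⟩
  · linarith [min_le_left (E.mean θ₁ - E.mean θ₀) (E.mean θ₃ - E.mean θ₂)]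
  · linarith [min_le_right (E.mean θ₁ - E.mean θ₀) (E.mean θ₃ - E.mean θ₂)]

/-- The finite-time bound for the regret, with any `κ b` below the divergence of a bad arm `b` from
the threshold arm. -/
theorem exists_regret_le (hreg : IsOpen E.naturalSpace)
    (hmono : StrictMonoOn E.mean E.naturalSpace) (hM : 1 ≤ M) (hδ : 0 < δ) (hδK : δ < 1 / K)
    (hθ : ∀ a, θ a ∈ E.naturalSpace) (hm : IsThreshold M (fun a => E.mean (θ a)) m)
    {κ : Fin K → ℝ} (hκ0 : ∀ b, E.mean (θ b) < E.mean (θ m) → 0 < κ b)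
    (hκ : ∀ b, E.mean (θ b) < E.mean (θ m) → κ b < E.klNat (θ b) (θ m)) :
    ∃ C : ℝ, 0 ≤ C ∧ ∀ φ : ℕ → Sample 𝒳 K → Finset (Fin K), E.IsAllocationRule M φ →
      E.IsRoundRobinKLUCB M δ exploration φ → ∀ T : ℕ, 3 ≤ T → E.regret M θ φ T ≤
        (∑ b ∈ Finset.univ.filter (fun b => E.mean (θ b) < E.mean (θ m)),
          (E.mean (θ m) - E.mean (θ b)) / κ b) * Real.log T + C * (Real.log (Real.log T) + 1) := by
  have harm : ∀ a, ∃ e > 0, (E.mean (θ a) ≠ E.mean (θ m) → 2 * e ≤ |E.mean (θ a) - E.mean (θ m)|) ∧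
      (E.mean (θ a) < E.mean (θ m) → ∃ θ₁ ∈ E.naturalSpace, ∃ θ₂ ∈ E.naturalSpace, θ₁ ≤ θ₂ ∧
        E.mean (θ a) + e ≤ E.mean θ₁ ∧ E.mean θ₂ ≤ E.mean (θ m) - e ∧ κ a < E.klNat θ₁ θ₂) := by
    intro a
    rcases lt_trichotomy (E.mean (θ a)) (E.mean (θ m)) with h | h | h
    · obtain ⟨e, he, θ₁, h₁, θ₂, h₂, h₁₂, ha₁, h₂m, hlt⟩ :=
        exists_perturbation hreg hmono (hθ a) (hθ m) h (hκ a h)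
      refine ⟨min e ((E.mean (θ m) - E.mean (θ a)) / 2), lt_min he (by linarith), fun _ => ?_,
        fun _ => ⟨θ₁, h₁, θ₂, h₂, h₁₂, ?_, ?_, hlt⟩⟩
      · rw [abs_of_neg (by linarith)]
        linarith [min_le_right e ((E.mean (θ m) - E.mean (θ a)) / 2)]
      · linarith [min_le_left e ((E.mean (θ m) - E.mean (θ a)) / 2)]
      · linarith [min_le_left e ((E.mean (θ m) - E.mean (θ a)) / 2)]
    · exact ⟨1, one_pos, fun hne => absurd h hne, fun hlt => absurd h hlt.ne⟩
    · refine ⟨(E.mean (θ a) - E.mean (θ m)) / 2, by linarith, fun _ => ?_,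
        fun hlt => absurd h hlt.not_gt⟩
      rw [abs_of_pos (by linarith)]
      linarith
  choose e he hsep hpert using harm
  have : Nonempty (Fin K) := ⟨m⟩
  obtain ⟨a₀, ha₀⟩ := Finite.exists_min e
  obtain ⟨C, hC, hplays⟩ := exists_integral_plays_le hreg hmono hM hδ hδK (he a₀) hθ hm
    fun a ha => (by linarith [ha₀ a] : 2 * e a₀ ≤ 2 * e a).trans (hsep a ha)
  set G := Finset.univ.filter (fun a => E.mean (θ m) < E.mean (θ a)) with hG
  set B := Finset.univ.filter (fun b => E.mean (θ b) < E.mean (θ m)) with hB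
  refine ⟨∑ a ∈ G, (E.mean (θ a) - E.mean (θ m)) * C +
    ∑ b ∈ B, (E.mean (θ m) - E.mean (θ b)) * (3 / κ b + C), ?_, fun φ hφ halg T hT => ?_⟩
  · refine add_nonneg (Finset.sum_nonneg fun a ha => ?_) (Finset.sum_nonneg fun b hb => ?_)
    · have := (Finset.mem_filter.1 ha).2
      exact mul_nonneg (by linarith) hC
    · have h := (Finset.mem_filter.1 hb).2
      have := hκ0 b h
      exact mul_nonneg (by linarith) (by positivity)
  obtain ⟨hgood, hbad⟩ := hplays φ hφ halg T hT
  have hll := log_log_nonneg hT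
  rw [regret_eq_sum_plays hreg hθ hφ hm]
  have h1 : ∑ a ∈ G, (E.mean (θ a) - E.mean (θ m)) *
      (T - ∫ ω, (plays φ a T ω : ℝ) ∂(E.banditLaw θ)) ≤
      ∑ a ∈ G, (E.mean (θ a) - E.mean (θ m)) * C * (Real.log (Real.log T) + 1) := by
    refine Finset.sum_le_sum fun a ha => ?_
    have h := (Finset.mem_filter.1 ha).2
    rw [mul_assoc]
    exact mul_le_mul_of_nonneg_left (hgood a h) (by linarith)
  have h2 : ∑ b ∈ B, (E.mean (θ m) - E.mean (θ b)) * ∫ ω, (plays φ b T ω : ℝ) ∂(E.banditLaw θ) ≤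
      ∑ b ∈ B, ((E.mean (θ m) - E.mean (θ b)) / κ b * Real.log T +
        (E.mean (θ m) - E.mean (θ b)) * (3 / κ b + C) * (Real.log (Real.log T) + 1)) := by
    refine Finset.sum_le_sum fun b hb => ?_
    have h := (Finset.mem_filter.1 hb).2
    have hκb := hκ0 b h
    obtain ⟨θ₁, h₁, θ₂, h₂, h₁₂, hb₁, h₂m, hlt⟩ := hpert b h
    have hle := hbad b h (κ b) θ₁ θ₂ hκb h₁ h₂ h₁₂ (by linarith [ha₀ b]) (by linarith [ha₀ b]) hlt
    have h3 : exploration T / κ b + C * (Real.log (Real.log T) + 1) ≤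
        Real.log T / κ b + (3 / κ b + C) * (Real.log (Real.log T) + 1) := by
      rw [exploration, add_div]
      have : 3 * Real.log (Real.log T) / κ b ≤ 3 / κ b * (Real.log (Real.log T) + 1) := by
        rw [mul_div_right_comm]
        exact mul_le_mul_of_nonneg_left (by linarith) (by positivity)
      linarith
    calc (E.mean (θ m) - E.mean (θ b)) * ∫ ω, (plays φ b T ω : ℝ) ∂(E.banditLaw θ)
        ≤ (E.mean (θ m) - E.mean (θ b)) *
          (Real.log T / κ b + (3 / κ b + C) * (Real.log (Real.log T) + 1)) :=
          mul_le_mul_of_nonneg_left (hle.trans h3) (by linarith)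
      _ = _ := by ring
  rw [Finset.sum_add_distrib, ← Finset.sum_mul, ← Finset.sum_mul] at h2
  rw [← Finset.sum_mul] at h1
  linarith

theorem klNat_pos_of_mean_lt (hreg : IsOpen E.naturalSpace)
    (hmono : StrictMonoOn E.mean E.naturalSpace) (hθ : ∀ a, θ a ∈ E.naturalSpace) {b : Fin K}
    (hb : E.mean (θ b) < E.mean (θ m)) : 0 < E.klNat (θ b) (θ m) :=
  klNat_pos hreg hmono (hθ b) (hθ m) fun h => hb.ne (congrArg E.mean h)

/-- The coefficient of `log T` in the optimal regret, for the threshold arm `m`. -/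
def regretRate (E : ExpFamily 𝒳) (θ : Fin K → ℝ) (m : Fin K) : ℝ :=
  ∑ b ∈ Finset.univ.filter (fun b => E.mean (θ b) < E.mean (θ m)),
    (E.mean (θ m) - E.mean (θ b)) / E.klNat (θ b) (θ m)

/-- The finite-time bound with the divergences shrunk by a common factor `r < 1`. -/
theorem exists_regret_le_rate_div (hreg : IsOpen E.naturalSpace)
    (hmono : StrictMonoOn E.mean E.naturalSpace) (hM : 1 ≤ M) (hδ : 0 < δ) (hδK : δ < 1 / K)
    (hθ : ∀ a, θ a ∈ E.naturalSpace) (hm : IsThreshold M (fun a => E.mean (θ a)) m)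
    (hφ : E.IsAllocationRule M φ) (halg : E.IsRoundRobinKLUCB M δ exploration φ) {r : ℝ}
    (hr0 : 0 < r) (hr1 : r < 1) :
    ∃ C : ℝ, 0 ≤ C ∧ ∀ T : ℕ, 3 ≤ T →
      E.regret M θ φ T ≤ E.regretRate θ m / r * Real.log T + C * (Real.log (Real.log T) + 1) := by
  obtain ⟨C, hC, h⟩ := exists_regret_le hreg hmono hM hδ hδK hθ hm
    (κ := fun b => E.klNat (θ b) (θ m) * r)
    (fun b hb => mul_pos (klNat_pos_of_mean_lt hreg hmono hθ hb) hr0)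
    (fun b hb => mul_lt_of_lt_one_right (klNat_pos_of_mean_lt hreg hmono hθ hb) hr1)
  refine ⟨C, hC, fun T hT => ?_⟩
  rw [regretRate, Finset.sum_div]
  simpa only [div_div] using h φ hφ halg T hT

theorem isUniformlyGood_of_isRoundRobinKLUCB (hreg : IsOpen E.naturalSpace)
    (hmono : StrictMonoOn E.mean E.naturalSpace) (hM : 1 ≤ M) (hMK : M ≤ K) (hδ : 0 < δ)
    (hδK : δ < 1 / K) (hφ : E.IsAllocationRule M φ)
    (halg : E.IsRoundRobinKLUCB M δ exploration φ) : E.IsUniformlyGood M φ := by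
  intro θ hθ α hα
  obtain ⟨m, hm⟩ := exists_isThreshold hM hMK fun a => E.mean (θ a)
  obtain ⟨C, hC, h⟩ := exists_regret_le_rate_div hreg hmono hM hδ hδK hθ hm hφ halg
    (r := 1 / 2) (by norm_num) (by norm_num)
  refine Asymptotics.IsBigO.trans_isLittleO (g := fun T : ℕ => Real.log T) ?_
    ((isLittleO_log_rpow_atTop hα).comp_tendsto tendsto_natCast_atTop_atTop)
  refine Asymptotics.IsBigO.of_bound (E.regretRate θ m / (1 / 2) + C) ?_
  filter_upwards [eventually_ge_atTop 3] with T hT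
  have hlog := one_lt_log hT
  rw [Real.norm_of_nonneg (regret_nonneg hreg hθ hφ hm T), Real.norm_of_nonneg (by linarith)]
  have h1 : Real.log (Real.log T) + 1 ≤ Real.log T := by
    linarith [Real.log_le_sub_one_of_pos (show 0 < Real.log T by linarith)]
  have h2 := mul_le_mul_of_nonneg_left h1 hC
  linarith [h T hT]

theorem tendsto_regret_div_log (hreg : IsOpen E.naturalSpace)
    (hmono : StrictMonoOn E.mean E.naturalSpace) (hM : 1 ≤ M) (hMK : M ≤ K) (hδ : 0 < δ)
    (hδK : δ < 1 / K) (hθ : ∀ a, θ a ∈ E.naturalSpace)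
    (hm : IsThreshold M (fun a => E.mean (θ a)) m) (hφ : E.IsAllocationRule M φ)
    (halg : E.IsRoundRobinKLUCB M δ exploration φ) :
    Tendsto (fun T : ℕ => E.regret M θ φ T / Real.log T) atTop (𝓝 (E.regretRate θ m)) := by
  refine tendsto_order.2 ⟨fun c hc => ?_, fun c hc => ?_⟩
  · obtain ⟨c', hcc', hc'⟩ := exists_between hc
    filter_upwards [eventually_mul_log_le_regret hreg hmono hM hMK hθ hφ
      (isUniformlyGood_of_isRoundRobinKLUCB hreg hmono hM hMK hδ hδK hφ halg) hm hc',
      eventually_ge_atTop 3] with T hT hT3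
    have hlog := one_lt_log hT3
    exact hcc'.trans_le ((le_div_iff₀ (by linarith)).2 hT)
  · have hdiv : Tendsto (fun r : ℝ => E.regretRate θ m / r) (𝓝[<] 1) (𝓝 (E.regretRate θ m)) := by
      have h : Tendsto (fun r : ℝ => E.regretRate θ m / r) (𝓝 1) (𝓝 (E.regretRate θ m / 1)) :=
        tendsto_const_nhds.div tendsto_id one_ne_zero
      rw [div_one] at h
      exact h.mono_left nhdsWithin_le_nhds
    obtain ⟨r, hrc, hr⟩ := ((hdiv.eventually (gt_mem_nhds hc)).and
      (Ioo_mem_nhdsLT (zero_lt_one (α := ℝ)))).exists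
    obtain ⟨C, hC, h⟩ := exists_regret_le_rate_div hreg hmono hM hδ hδK hθ hm hφ halg hr.1 hr.2
    have hlim := (tendsto_log_log_add_one_div_log.const_mul C).const_add (E.regretRate θ m / r)
    rw [mul_zero, add_zero] at hlim
    filter_upwards [hlim.eventually (gt_mem_nhds hrc), eventually_ge_atTop 3] with T hT hT3
    have hlog := one_lt_log hT3
    refine lt_of_le_of_lt ?_ hT
    rw [div_le_iff₀ (by linarith)]
    refine (h T hT3).trans_eq ?_
    field_simp

theorem isAsymptoticallyOptimal_of_isRoundRobinKLUCB (hreg : IsOpen E.naturalSpace)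
    (hmono : StrictMonoOn E.mean E.naturalSpace) (hM : 1 ≤ M) (hMK : M ≤ K) (hδ : 0 < δ)
    (hδK : δ < 1 / K) (hθ : ∀ a, θ a ∈ E.naturalSpace)
    (hm : IsThreshold M (fun a => E.mean (θ a)) m) (hφ : E.IsAllocationRule M φ)
    (halg : E.IsRoundRobinKLUCB M δ exploration φ) : E.IsAsymptoticallyOptimal M θ φ := by
  refine ⟨isUniformlyGood_of_isRoundRobinKLUCB hreg hmono hM hMK hδ hδK hφ halg,
    fun ψ hψ hψgood => ?_⟩
  have hlim := (continuous_coe_real_ereal.tendsto _).comp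
    (tendsto_regret_div_log hreg hmono hM hMK hδ hδK hθ hm hφ halg)
  refine (hlim.limsup_eq).trans_le ?_
  by_contra! hlt
  obtain ⟨c, hc1, hc2⟩ := EReal.lt_iff_exists_real_btwn.1 hlt
  refine absurd hc1 (not_lt.2 (le_liminf_of_le (by isBoundedDefault) ?_))
  filter_upwards [eventually_mul_log_le_regret hreg hmono hM hMK hθ hψ hψgood hm
    (EReal.coe_lt_coe_iff.1 hc2), eventually_ge_atTop 3] with T hT hT3
  have hlog := one_lt_log hT3
  exact EReal.coe_le_coe_iff.2 ((le_div_iff₀ (by linarith)).2 hT)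

/-- If all members of the family have the same mean, then no rule has any regret. -/
theorem regret_eq_zero (hreg : IsOpen E.naturalSpace) (hM : 1 ≤ M) (hMK : M ≤ K)
    (hconst : ∀ θ₁ ∈ E.naturalSpace, ∀ θ₂ ∈ E.naturalSpace, E.mean θ₁ = E.mean θ₂)
    (hθ : ∀ a, θ a ∈ E.naturalSpace) (hφ : E.IsAllocationRule M φ) (T : ℕ) :
    E.regret M θ φ T = 0 := by
  obtain ⟨m, hm⟩ := exists_isThreshold hM hMK fun a => E.mean (θ a)
  have h : ∀ a, E.mean (θ a) = E.mean (θ m) := fun a => hconst _ (hθ a) _ (hθ m)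
  rw [regret_eq_sum_plays hreg hθ hφ hm]
  simp [h]

/-- Lowering the second argument of `KL` towards the first one, but not down to it, makes the
divergence strictly smaller and keeps it positive. -/
theorem klMean_toReal_mem_Ioo (hreg : IsOpen E.naturalSpace)
    (hmono : StrictMonoOn E.mean E.naturalSpace) {θ₁ θ₃ ν : ℝ} (h₁ : θ₁ ∈ E.naturalSpace)
    (h₃ : θ₃ ∈ E.naturalSpace) (hν₁ : E.mean θ₁ < ν) (hν₃ : ν < E.mean θ₃) :
    (E.klMean (E.mean θ₁) ν).toReal ∈ Set.Ioo 0 (E.klNat θ₁ θ₃) := by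
  obtain ⟨θ₂, h₂, rfl⟩ := (ordConnected_meanSpace hreg).out (mean_mem_meanSpace h₁)
    (mean_mem_meanSpace h₃) ⟨hν₁.le, hν₃.le⟩
  have h₁₂ := (hmono.lt_iff_lt h₁ h₂).1 hν₁
  have h₂₃ := (hmono.lt_iff_lt h₂ h₃).1 hν₃
  have hp₁ := klNat_pos hreg hmono h₁ h₂ h₁₂.ne
  have hp₂ := klNat_pos hreg hmono h₂ h₃ h₂₃.ne
  rw [klMean_mean hreg hmono h₁ h₂, ENNReal.toReal_ofReal hp₁.le]
  refine ⟨hp₁, ?_⟩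
  rw [klNat_three_point θ₁ θ₂ θ₃]
  have : 0 < (θ₂ - θ₃) * (E.mean θ₁ - E.mean θ₂) :=
    mul_pos_of_neg_of_neg (by linarith) (by linarith)
  linarith

end ExpFamily

end Bandit

end

/-! ### The theorem -/

theorem mainTheorem3 {𝒳 : Type*} [MeasurableSpace 𝒳] (E : Bandit.ExpFamily 𝒳)
    (hreg : IsOpen E.naturalSpace)
    (K M N L : ℕ) (hK : 2 ≤ K) (m : Fin K) (hm : (m : ℕ) + 1 = M)
    (hNM : N < M) (hML : M ≤ L) (hLK : L ≤ K)
    (θ : Fin K → ℝ) (hθ : ∀ a, θ a ∈ E.naturalSpace)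
    (hord : Antitone fun a => E.mean (θ a))
    (hN : ∀ a : Fin K, (a : ℕ) < N → E.mean (θ m) < E.mean (θ a))
    (hNL : ∀ a : Fin K, N ≤ (a : ℕ) → (a : ℕ) < L → E.mean (θ a) = E.mean (θ m))
    (hL : ∀ b : Fin K, L ≤ (b : ℕ) → E.mean (θ b) < E.mean (θ m))
    (δ : ℝ) (hδ0 : 0 < δ) (hδK : δ < 1 / (K : ℝ))
    (g : ℕ → ℝ) (hg : ∀ t : ℕ, g t = Real.log t + 3 * Real.log (Real.log t)) :
    (∀ ε : ℝ, 0 < ε →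
      (∀ a : Fin K, (a : ℕ) < N → ε < E.mean (θ a) - E.mean (θ m)) →
      (∀ b : Fin K, L ≤ (b : ℕ) → ε < E.mean (θ m) - E.mean (θ b)) →
      ∃ c₁ c₂ c₃ c₄ : ℝ, ∀ φ : ℕ → Bandit.Sample 𝒳 K → Finset (Fin K),
        E.IsAllocationRule M φ → E.IsRoundRobinKLUCB M δ g φ →
        ∀ T : ℕ, K ≤ T → 3 ≤ T →
          E.regret M θ φ T ≤
            (∑ b ∈ Finset.univ.filter (fun b : Fin K => L ≤ (b : ℕ)),
              (E.mean (θ m) - E.mean (θ b)) /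
              (E.klMean (E.mean (θ b)) (E.mean (θ m) - ε)).toReal) * Real.log T
            + c₁ * √(Real.log T) + c₂ * Real.log (Real.log T)
            + c₃ * √(Real.log (Real.log T)) + c₄) ∧
    (∀ φ : ℕ → Bandit.Sample 𝒳 K → Finset (Fin K),
      E.IsAllocationRule M φ → E.IsRoundRobinKLUCB M δ g φ →
        E.IsAsymptoticallyOptimal M θ φ ∧
        Tendsto (fun T : ℕ => E.regret M θ φ T / Real.log T) atTop
          (𝓝 (∑ b ∈ Finset.univ.filter (fun b : Fin K => L ≤ (b : ℕ)),
              (E.mean (θ m) - E.mean (θ b)) /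
              (E.klMean (E.mean (θ b)) (E.mean (θ m))).toReal))) := by
  have hM : 1 ≤ M := by omega
  have hMK : M ≤ K := hML.trans hLK
  obtain rfl : g = Bandit.exploration := funext hg
  have hthr : Bandit.IsThreshold M (fun a => E.mean (θ a)) m := by
    constructor
    · refine lt_of_le_of_lt (Finset.card_le_card
        (t := Finset.univ.filter fun a : Fin K => (a : ℕ) < N) fun a ha => ?_)
        (lt_of_le_of_lt ?_ hNM)
      · have h : E.mean (θ m) < E.mean (θ a) := (Finset.mem_filter.1 ha).2
        refine Finset.mem_filter.2 ⟨Finset.mem_univ a, ?_⟩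
        by_contra! hNa
        rcases lt_or_ge (a : ℕ) L with haL | haL
        · exact h.ne' (hNL a hNa haL)
        · exact absurd h (hL a haL).not_gt
      · rw [Fin.card_filter_val_lt]
        exact min_le_right _ _
    · refine le_trans ?_ (Finset.card_le_card (s := Finset.univ.filter fun a : Fin K => (a : ℕ) < M)
        fun a ha => ?_)
      · rw [Fin.card_filter_val_lt, min_eq_right hMK]
      · have h := (Finset.mem_filter.1 ha).2
        exact Finset.mem_filter.2 ⟨Finset.mem_univ a,
          hord (Fin.le_def.2 (by omega : (a : ℕ) ≤ (m : ℕ)))⟩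
  have hbad : Finset.univ.filter (fun b : Fin K => L ≤ (b : ℕ)) =
      Finset.univ.filter (fun b : Fin K => E.mean (θ b) < E.mean (θ m)) := by
    refine Finset.filter_congr fun b _ => ⟨hL b, fun h => ?_⟩
    by_contra! hbL
    rcases lt_or_ge (b : ℕ) N with hbN | hbN
    · exact absurd h (hN b hbN).not_gt
    · exact h.ne (hNL b hbN hbL)
  have hbadL : ∀ b, E.mean (θ b) < E.mean (θ m) → L ≤ (b : ℕ) := fun b hb =>
    (Finset.mem_filter.1 (hbad.symm.subset (Finset.mem_filter.2 ⟨Finset.mem_univ b, hb⟩))).2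
  rw [hbad]
  by_cases hnd : ∃ θ₁ ∈ E.naturalSpace, ∃ θ₂ ∈ E.naturalSpace, E.mean θ₁ ≠ E.mean θ₂
  · have hmono := Bandit.ExpFamily.strictMonoOn_mean hreg hnd
    refine ⟨fun ε hε _ hεL => ?_, fun φ hφ halg => ⟨?_, ?_⟩⟩
    · have hkl := fun b (hb : E.mean (θ b) < E.mean (θ m)) =>
        Bandit.ExpFamily.klMean_toReal_mem_Ioo hreg hmono (hθ b) (hθ m)
          (by linarith [hεL b (hbadL b hb)] : E.mean (θ b) < E.mean (θ m) - ε) (by linarith)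
      obtain ⟨C, -, h⟩ := Bandit.ExpFamily.exists_regret_le hreg hmono hM hδ0 hδK hθ hthr
        (fun b hb => (hkl b hb).1) (fun b hb => (hkl b hb).2)
      refine ⟨0, C, 0, C, fun φ hφ halg T _ hT => (h φ hφ halg T hT).trans (le_of_eq ?_)⟩
      ring
    · exact Bandit.ExpFamily.isAsymptoticallyOptimal_of_isRoundRobinKLUCB hreg hmono hM hMK hδ0 hδK
        hθ hthr hφ halg
    · have h := Bandit.ExpFamily.tendsto_regret_div_log hreg hmono hM hMK hδ0 hδK hθ hthr hφ halg
      have hrate : E.regretRate θ m = ∑ b ∈ Finset.univ.filter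
          (fun b : Fin K => E.mean (θ b) < E.mean (θ m)), (E.mean (θ m) - E.mean (θ b)) /
            (E.klMean (E.mean (θ b)) (E.mean (θ m))).toReal := by
        refine Finset.sum_congr rfl fun b hb => ?_
        rw [Bandit.ExpFamily.klMean_mean hreg hmono (hθ b) (hθ m), ENNReal.toReal_ofReal
          (Bandit.ExpFamily.klNat_pos_of_mean_lt hreg hmono hθ (Finset.mem_filter.1 hb).2).le]
      rwa [← hrate]
  -- a family with a single mean: there are no bad arms and there is no regret
  · push Not at hnd
    have hzero := fun (θ' : Fin K → ℝ) (hθ' : ∀ a, θ' a ∈ E.naturalSpace)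
        (φ : ℕ → Bandit.Sample 𝒳 K → Finset (Fin K)) (hφ : E.IsAllocationRule M φ) =>
      Bandit.ExpFamily.regret_eq_zero hreg hM hMK hnd hθ' hφ
    have hempty : Finset.univ.filter (fun b : Fin K => E.mean (θ b) < E.mean (θ m)) = ∅ :=
      Finset.filter_eq_empty_iff.2 fun b _ => (hnd _ (hθ b) _ (hθ m)).not_lt
    rw [hempty]
    refine ⟨fun ε _ _ _ => ⟨0, 0, 0, 0, fun φ hφ _ T _ _ => by simp [hzero θ hθ φ hφ]⟩,
      fun φ hφ _ => ⟨⟨fun θ' hθ' α _ => ?_, fun ψ hψ _ => ?_⟩, ?_⟩⟩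
    · simp only [hzero θ' hθ' φ hφ]
      exact Asymptotics.isLittleO_zero _ _
    · simp [hzero θ hθ φ hφ, hzero θ hθ ψ hψ]
    · simp [hzero θ hθ φ hφ]
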